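/- Let $\nu>0$, $T>0$, $\xi=(\xi_1,\xi_2)\in\mathbb Z^2$, $|\xi|=(\xi_1^2+\xi_2^2)^{1/2}$, $\mathbb R_+=[0,\infty)$ and $\Delta_\xi=\partial_z^2-|\xi|^2$. For $f\in L^\infty(0,T;L^2(\mathbb R_+))^3$, $g\in L^\infty(0,T)^2$ and $\omega_0\in L^1(\mathbb R_+)^3$ (complex valued) consider the linear Stokes vorticity problem for $\omega=(\omega_\tau,\omega_3)$, $\omega_\tau=(\omega_1,\omega_2)$, $$\partial_t\omega-\nu\Delta_\xi\omega=f \text{ for } z>0,\qquad -\nu(\partial_z+|\xi|)\omega_\tau+\nu\,\xi|\xi|^{-1}(\xi\cdot\omega_\tau)=g,\quad \omega_3=0 \text{ at } z=0,\qquad \omega|_{t=0}=\omega_0$$ (for $\xi=0$ the term $\xi|\xi|^{-1}(\xi\cdot\omega_\tau)$ is $0$). A weak solution is a function $\omega\in L^1(0,T;H^1(\mathbb R_+))$ that satisfies $\omega_3(t,0)=0$ for a.e. $t$ and, for $i=1,2,3$ and all $\varphi\in C_c^\infty([0,T)\times[0,\infty))$ (for $i=3$: those with $\varphi(\cdot,0)=0$),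 $$-\int_0^T\!\!\int_0^\infty\omega_i\,\partial_t\varphi+\nu\int_0^T\!\!\int_0^\infty\partial_z\omega_i\,\partial_z\varphi+\nu|\xi|^2\int_0^T\!\!\int_0^\infty\omega_i\,\varphi=\int_0^\infty\omega_{0,i}\,\varphi(0,\cdot)+\int_0^T\!\!\int_0^\infty f_i\,\varphi+\int_0^T q_i(t)\,\varphi(t,0)\,dt,$$ where, at $z=0$, $q_i=g_i+\nu|\xi|\omega_i-\nu\,\xi_i|\xi|^{-1}(\xi\cdot\omega_\tau)$ for $i=1,2$, and $q_3=0$. Fix $a>|\xi|$ and let $\Gamma$ be the contour $b\mapsto\nu((a+ib)^2-|\xi|^2)$, $b\in\mathbb R$, which passes to the right of $0$ and surrounds $(-\infty,-\nu|\xi|^2]\cup\{0\}$. With $\mu=\nu^{-1/2}\sqrt{\lambda+\nu|\xi|^2}$ (principal root) let $G_\xi=\mathrm{diag}(G_{\xi,\tau},G_{\xi,3})$, $$G_{\xi,\tau}(t,y;z)=\frac{e^{-\nu|\xi|^2t}}{\sqrt{4\pi\nu t}}\Bigl(e^{-\frac{(z-y)^2}{4\nu t}}+e^{-\frac{(z+y)^2}{4\nu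 t}}\Bigr)I_2+\frac1{2\pi i}\int_\Gamma e^{\lambda t}\,\frac{\mu+|\xi|}{\mu\lambda|\xi|}\begin{pmatrix}\xi_2^2&-\xi_1\xi_2\\-\xi_1\xi_2&\xi_1^2\end{pmatrix}e^{-\mu|y+z|}\,d\lambda,$$ $$G_{\xi,3}(t,y;z)=\frac{e^{-\nu|\xi|^2t}}{\sqrt{4\pi\nu t}}\Bigl(e^{-\frac{(z-y)^2}{4\nu t}}-e^{-\frac{(z+y)^2}{4\nu t}}\Bigr)$$ (the contour integral term is $0$ for $\xi=0$). Then for all $t\in(0,T]$ and $y\ge0$ the integrals in $$W(t,y)=\int_0^\infty G_\xi(t,y;z)\,\omega_0(z)\,dz+\int_0^t\!\!\int_0^\infty G_\xi(t-s,y;z)f(s,z)\,dz\,ds+\int_0^tG_\xi(t-s,y;0)\begin{pmatrix}g(s)\\0\end{pmatrix}ds$$ converge absolutely, and $W$ is the unique weak solution: $W$ is a weak solution, and every weak solution equals $W$ almost everywhere on $(0,T)\times\mathbb R_+$; in particular every weak solution in $L^2(0,T;H^1(\mathbb R_+))\cap L^\infty(0,T;L^2(\mathbb R_+))$ is given by this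 formula. If moreover $\omega_0\in L^2(\mathbb R_+)$, then $W\in L^2(0,T;H^1(\mathbb R_+))\cap L^\infty(0,T;L^2(\mathbb R_+))$. -/

import Mathlib

open MeasureTheory Set
open scoped ENNReal ContDiff

noncomputable section

namespace StokesDuhamel

/-- Lebesgue measure on the half-line `(0, ∞)` of the normal variable `z`. -/
abbrev halfLine : Measure ℝ := volume.restrict (Ioi (0 : ℝ))

/-- Lebesgue measure on the time interval `(0, T)`. -/
abbrev timeInterval (T : ℝ) : Measure ℝ := volume.restrict (Ioo (0 : ℝ) T)

/-- Euclidean length `|ξ|` of the tangential frequency `ξ ∈ ℤ²`. -/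
def freqNorm (ξ : Fin 2 → ℤ) : ℝ := Real.sqrt ((ξ 0 : ℝ) ^ 2 + (ξ 1 : ℝ) ^ 2)

/-! ### The Green function -/

/-- `μ(l) = ν ^ (-1/2) * sqrt (l + ν |ξ|²)`, with the principal square root, for complex `l`. -/
def rootMu (ν : ℝ) (ξ : Fin 2 → ℤ) (l : ℂ) : ℂ :=
  ((Real.sqrt ν : ℝ) : ℂ)⁻¹ * (l + ((ν * freqNorm ξ ^ 2 : ℝ) : ℂ)) ^ (1 / 2 : ℂ)

/-- The contour `Γ`: the parabola `b ↦ ν ((a + i b)² - |ξ|²)`, `b ∈ ℝ`. Both ends go to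
`Re l = -∞`, the lower one (`b → -∞`) with `Im l → -∞` and the upper one with `Im l → +∞`.
For `a > |ξ|` it surrounds the half-line `(-∞, -ν |ξ|²]` and the point `0`, which it passes on
the right. -/
def contour (ν : ℝ) (ξ : Fin 2 → ℤ) (a : ℝ) (b : ℝ) : ℂ :=
  (ν : ℂ) * (((a : ℂ) + (b : ℂ) * Complex.I) ^ 2 - ((freqNorm ξ ^ 2 : ℝ) : ℂ))

/-- The normalised contour integral `(2 π i)⁻¹ ∫_γ F(l) dl`. -/
def contourIntegral (γ : ℝ → ℂ) (F : ℂ → ℂ) : ℂ :=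
  (2 * (Real.pi : ℂ) * Complex.I)⁻¹ * ∫ b : ℝ, F (γ b) * deriv γ b

/-- The scalar factor
`(2 π i)⁻¹ ∫_Γ exp (l t) (μ + |ξ|) / (μ l |ξ|) exp (-μ |y + z|) dl` of the residual kernel. -/
def residualScalar (ν : ℝ) (ξ : Fin 2 → ℤ) (a t y z : ℝ) : ℂ :=
  contourIntegral (contour ν ξ a) fun l =>
    Complex.exp (l * (t : ℂ)) *
      ((rootMu ν ξ l + (freqNorm ξ : ℂ)) / (rootMu ν ξ l * l * (freqNorm ξ : ℂ))) *
      Complex.exp (-(rootMu ν ξ l * ((|y + z| : ℝ) : ℂ)))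

/-- The heat kernel on the half-line, damped by `exp (-ν |ξ|² t)`, with the image term
multiplied by `σ`: `σ = 1` is the Neumann kernel and `σ = -1` is the Dirichlet kernel. -/
def imageHeatKernel (ν : ℝ) (ξ : Fin 2 → ℤ) (σ t y z : ℝ) : ℝ :=
  (Real.sqrt (4 * Real.pi * ν * t))⁻¹ *
    (Real.exp (-((z - y) ^ 2 / (4 * ν * t))) + σ * Real.exp (-((z + y) ^ 2 / (4 * ν * t)))) *
    Real.exp (-(ν * freqNorm ξ ^ 2 * t))

/-- The matrix `[[ξ₂², -ξ₁ ξ₂], [-ξ₁ ξ₂, ξ₁²]]`. -/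
def perpMatrix (ξ : Fin 2 → ℤ) : Matrix (Fin 2) (Fin 2) ℂ :=
  !![(ξ 1 : ℂ) ^ 2, -((ξ 0 : ℂ) * (ξ 1 : ℂ)); -((ξ 0 : ℂ) * (ξ 1 : ℂ)), (ξ 0 : ℂ) ^ 2]

/-- The tangential block `G_{ξ,τ}(t, y; z)` of the Green function: Neumann heat kernel plus
residual kernel. -/
def greenTangential (ν : ℝ) (ξ : Fin 2 → ℤ) (a t y z : ℝ) : Matrix (Fin 2) (Fin 2) ℂ :=
  (imageHeatKernel ν ξ 1 t y z : ℂ) • (1 : Matrix (Fin 2) (Fin 2) ℂ) +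
    residualScalar ν ξ a t y z • perpMatrix ξ

/-- The Green function `G_ξ(t, y; z)`, block diagonal with the blocks `G_{ξ,τ}` and
`G_{ξ,3}`, the latter being the Dirichlet heat kernel. -/
def green (ν : ℝ) (ξ : Fin 2 → ℤ) (a t y z : ℝ) : Matrix (Fin 3) (Fin 3) ℂ :=
  !![greenTangential ν ξ a t y z 0 0, greenTangential ν ξ a t y z 0 1, 0;
     greenTangential ν ξ a t y z 1 0, greenTangential ν ξ a t y z 1 1, 0;
     0, 0, (imageHeatKernel ν ξ (-1) t y z : ℂ)]

/-- The Duhamel formula: the Green function applied to the initial datum `w₀`, to the forcing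
`f` and to the boundary datum `(g, 0)`. -/
def duhamel (ν : ℝ) (ξ : Fin 2 → ℤ) (a : ℝ) (w₀ : ℝ → Fin 3 → ℂ) (f : ℝ → ℝ → Fin 3 → ℂ)
    (g : ℝ → Fin 2 → ℂ) (t y : ℝ) : Fin 3 → ℂ :=
  (∫ z in Ioi (0 : ℝ), (green ν ξ a t y z).mulVec (w₀ z)) +
    (∫ s in Ioo (0 : ℝ) t, ∫ z in Ioi (0 : ℝ), (green ν ξ a (t - s) y z).mulVec (f s z)) +
    ∫ s in Ioo (0 : ℝ) t, (green ν ξ a (t - s) y 0).mulVec ![g s 0, g s 1, 0]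

/-! ### Function spaces -/

/-- `u ∈ H¹(0, ∞)` with weak derivative `u'` and boundary trace `u(0) = c`: both functions are
square integrable and integration by parts against every test function on `[0, ∞)` (the
restriction of a function in `C_c^∞(ℝ)`) holds with the boundary value `c`. -/
structure IsH1 (u u' : ℝ → ℂ) (c : ℂ) : Prop where
  memLp : MemLp u 2 halfLine
  memLp_deriv : MemLp u' 2 halfLine
  parts : ∀ φ : ℝ → ℂ, ContDiff ℝ ∞ φ → HasCompactSupport φ →
    ∫ z in Ioi (0 : ℝ), u z * deriv φ z = -(c * φ 0) - ∫ z in Ioi (0 : ℝ), u' z * φ z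

/-- `w` belongs to `L^p(0, T; H¹(0, ∞))`, with spatial weak derivative `w'` and boundary trace
`c`. -/
structure IsLpH1 (p : ℝ≥0∞) (T : ℝ) (w w' : ℝ → ℝ → Fin 3 → ℂ) (c : ℝ → Fin 3 → ℂ) :
    Prop where
  meas : AEStronglyMeasurable (Function.uncurry w) ((timeInterval T).prod halfLine)
  meas_deriv : AEStronglyMeasurable (Function.uncurry w') ((timeInterval T).prod halfLine)
  isH1 : ∀ᵐ t ∂(timeInterval T), ∀ i, IsH1 (fun z => w t z i) (fun z => w' t z i) (c t i)
  norm_lt_top :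
    eLpNorm (fun t => eLpNorm (w t) 2 halfLine + eLpNorm (w' t) 2 halfLine) p
      (timeInterval T) < ⊤

/-- `w ∈ L^∞(0, T; L²(0, ∞))`. -/
def MemLinftyL2 (T : ℝ) (w : ℝ → ℝ → Fin 3 → ℂ) : Prop :=
  AEStronglyMeasurable (Function.uncurry w) ((timeInterval T).prod halfLine) ∧
    ∃ C : NNReal, ∀ᵐ t ∂(timeInterval T), eLpNorm (w t) 2 halfLine ≤ C

/-- `w ∈ L²(0, T; H¹(0, ∞)) ∩ L^∞(0, T; L²(0, ∞))`. -/
def MemEnergyClass (T : ℝ) (w : ℝ → ℝ → Fin 3 → ℂ) : Prop :=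
  (∃ w' c, IsLpH1 2 T w w' c) ∧ MemLinftyL2 T w

/-! ### Weak solutions -/

/-- Test functions: smooth, compactly supported in `(-∞, T) × ℝ`; only their restriction to
`[0, T) × [0, ∞)` matters. -/
structure IsTest (T : ℝ) (φ : ℝ → ℝ → ℂ) : Prop where
  smooth : ContDiff ℝ ∞ (Function.uncurry φ)
  compact : HasCompactSupport (Function.uncurry φ)
  before : tsupport (Function.uncurry φ) ⊆ Iio T ×ˢ univ

/-- The part of the weak formulation common to all components: the function `u` of time and
space with weak spatial derivative `u'` satisfies
`-∬ u ∂ₜφ + ν ∬ u' ∂_zφ + ν |ξ|² ∬ u φ = ∫ u₀ φ(0, ·) + ∬ F φ + ∫ q φ(·, 0)`,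
where `q` stands for the flux `-ν ∂_z u` at `z = 0`. -/
def WeakHeat (ν : ℝ) (ξ : Fin 2 → ℤ) (T : ℝ) (u u' F : ℝ → ℝ → ℂ) (u₀ : ℝ → ℂ)
    (q : ℝ → ℂ) (φ : ℝ → ℝ → ℂ) : Prop :=
  -(∫ t in Ioo (0 : ℝ) T, ∫ z in Ioi (0 : ℝ), u t z * deriv (fun s => φ s z) t) +
      (ν : ℂ) * (∫ t in Ioo (0 : ℝ) T, ∫ z in Ioi (0 : ℝ), u' t z * deriv (φ t) z) +
      ((ν * freqNorm ξ ^ 2 : ℝ) : ℂ) *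
        (∫ t in Ioo (0 : ℝ) T, ∫ z in Ioi (0 : ℝ), u t z * φ t z) =
    (∫ z in Ioi (0 : ℝ), u₀ z * φ 0 z) +
      (∫ t in Ioo (0 : ℝ) T, ∫ z in Ioi (0 : ℝ), F t z * φ t z) +
      ∫ t in Ioo (0 : ℝ) T, q t * φ t 0

/-- The flux `-ν ∂_z w_τ` at the boundary prescribed by
`-ν (∂_z + |ξ|) w_τ + ν ξ |ξ|⁻¹ (ξ · w_τ) = g` for the boundary value `c` of `w`; the term
`ξ |ξ|⁻¹ (ξ · w_τ)` is zero for `ξ = 0`. -/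
def boundaryFlux (ν : ℝ) (ξ : Fin 2 → ℤ) (g : Fin 2 → ℂ) (c : Fin 3 → ℂ) (i : Fin 2) : ℂ :=
  g i + (ν : ℂ) * (freqNorm ξ : ℂ) * c i.castSucc -
    (ν : ℂ) * (ξ i : ℂ) * (freqNorm ξ : ℂ)⁻¹ * ((ξ 0 : ℂ) * c 0 + (ξ 1 : ℂ) * c 1)

/-- `w` is a weak solution on `(0, T)` of the Stokes vorticity problem at frequency `ξ`,

* `∂ₜ w - ν (∂_z² - |ξ|²) w = f` for `z > 0`,
* `-ν (∂_z + |ξ|) w_τ + ν ξ |ξ|⁻¹ (ξ · w_τ) = g` at `z = 0`,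
* `w₃ = 0` at `z = 0`,

with initial datum `w₀`. The membership `w ∈ L¹(0, T; H¹)` is what the weak formulation needs to
make sense. The Dirichlet condition is imposed through the trace, with test functions that
vanish at the boundary; the other boundary condition is the natural one. -/
def IsWeakSolution (ν : ℝ) (ξ : Fin 2 → ℤ) (T : ℝ) (w₀ : ℝ → Fin 3 → ℂ)
    (f : ℝ → ℝ → Fin 3 → ℂ) (g : ℝ → Fin 2 → ℂ) (w : ℝ → ℝ → Fin 3 → ℂ) : Prop :=
  ∃ (w' : ℝ → ℝ → Fin 3 → ℂ) (c : ℝ → Fin 3 → ℂ),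
    IsLpH1 1 T w w' c ∧
    (∀ φ, IsTest T φ → ∀ i : Fin 2,
      WeakHeat ν ξ T (fun t z => w t z i.castSucc) (fun t z => w' t z i.castSucc)
        (fun t z => f t z i.castSucc) (fun z => w₀ z i.castSucc)
        (fun t => boundaryFlux ν ξ (g t) (c t) i) φ) ∧
    (∀ᵐ t ∂(timeInterval T), c t 2 = 0) ∧
    (∀ φ, IsTest T φ → (∀ t, φ t 0 = 0) →
      WeakHeat ν ξ T (fun t z => w t z 2) (fun t z => w' t z 2) (fun t z => f t z 2)
        (fun z => w₀ z 2) (fun _ => 0) φ)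

end StokesDuhamel

end

noncomputable section

namespace StokesDuhamel

open Filter Topology

/-! ### The heat kernel and the Robin correction -/

/-! The problem decouples. Since `|ξ|² I - ξ ⊗ ξ = ξ^⊥ ⊗ ξ^⊥`, the prescribed flux is `g + ν |ξ| P
ω_τ` with `P` the orthogonal projection onto the line of `ξ^⊥` (`boundaryFlux_eq`). So the component
along `ξ` obeys a Neumann condition, the component along `ξ^⊥` the Robin condition `-ν (∂_z + |ξ|) u
= data`, and `ω₃` a Dirichlet condition: three scalar damped heat equations on the half-line. For `ξ
= 0` the convention `P = 0` leaves only Neumann and Dirichlet.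

The Green function decouples in the same way. On `Γ` one has `μ = a + i b`, `λ = ν (μ - |ξ|)(μ +
|ξ|)` and `dλ = 2 ν i μ db`, so the rational factor collapses to a multiple of `1 / (μ - |ξ|)`.
Writing this as `∫_0^∞ exp (-(μ - |ξ|) s) ds` and evaluating the Gaussian integral in `b` gives the
classical Robin correction of the Neumann heat kernel, up to the factor `|ξ|⁻²` that turns the
matrix into `P` (`residualScalar_eq`). Hence the Green function is a sum of constant projections
times three explicit kernels `kern` (`green_apply`).

Existence. These kernels are smooth for positive time, have Gaussian bounds (`exists_kern_le`) and
form an approximate identity (`tendsto_integral_kern`). The divergence theorem on a rectangle that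
avoids the singularity, followed by a limit, yields the weak form with a point source
(`heatForm_kern`). Fubini extends it to source measures (`IsSource.heatForm_pot`). The initial
datum, the force and the boundary datum are all sources, carried by `t = 0`, by the interior and by
`z = 0`. The worst singularity of the `L²` norm of a derivative is `t ^ (-3/4)`, which is
integrable, whence `L¹(0, T; H¹)`.

Uniqueness. In `L¹(0, T; H¹)` an energy argument is not available, so duality is used: a homogeneous
solution `u` is tested with the kernel run backward from time `t₁`, truncated in space and time.
This shows that `∫ u(t, z) kern(t₁ - t, z, y) dz = 0` for almost every `t < t₁`
(`IsHomogeneousSolution.ae_integral_kern`), and letting `t₁` decrease to `t` gives `u(t) = 0`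
(`eq_zero_of_integral_kern`).

Energy class. For initial data in `L²` the bound `t ^ (-1/2)` for the derivative is not square
integrable in time. Instead, the pairing of two Gaussian derivatives is computed exactly. It is a
time derivative, so its time integral is a difference of two heat kernels, to which Schur's test
applies (`lintegral_sq_heatDx_le`). -/

/-- The heat kernel on the line; it vanishes for `t ≤ 0`. -/
def heat (ν t x : ℝ) : ℝ :=
  (Real.sqrt (4 * Real.pi * ν * t))⁻¹ * Real.exp (-(x ^ 2 / (4 * ν * t)))

/-- The spatial derivative of the heat kernel. -/
def heatDx (ν t x : ℝ) : ℝ := -(x / (2 * ν * t)) * heat ν t x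

/-- The second spatial derivative of the heat kernel. -/
def heatDxx (ν t x : ℝ) : ℝ := (x ^ 2 / (4 * ν ^ 2 * t ^ 2) - 1 / (2 * ν * t)) * heat ν t x

/-- The Gaussian tail integral. -/
def gaussTail (w : ℝ) : ℝ := ∫ s in Ioi w, Real.exp (-s ^ 2)

/-- The correction of the Neumann heat kernel for the boundary condition `∂_x u + β u = 0`. -/
def robinTail (ν β t x : ℝ) : ℝ :=
  2 * β * ∫ s in Ioi (0 : ℝ), Real.exp (β * s) * heat ν t (x + s)

/-- The real square root of a nonpositive number is `0` and so is its inverse. Causality is thus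
built into the formula, and time integrals over `(0, t)` and over `(0, T)` agree without an
indicator. -/
theorem heat_of_nonpos {ν t : ℝ} (hν : 0 < ν) (ht : t ≤ 0) (x : ℝ) : heat ν t x = 0 := by
  have : 4 * Real.pi * ν * t ≤ 0 := mul_nonpos_of_nonneg_of_nonpos (by positivity) ht
  simp [heat, Real.sqrt_eq_zero_of_nonpos this]

theorem heat_nonneg (ν t x : ℝ) : 0 ≤ heat ν t x := by unfold heat; positivity

theorem heat_neg (ν t x : ℝ) : heat ν t (-x) = heat ν t x := by simp [heat]

theorem heatDx_neg (ν t x : ℝ) : heatDx ν t (-x) = -heatDx ν t x := by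
  simp [heatDx, heat_neg, neg_div]

theorem robinTail_of_nonpos {ν t : ℝ} (hν : 0 < ν) (ht : t ≤ 0) (β x : ℝ) :
    robinTail ν β t x = 0 := by
  simp [robinTail, heat_of_nonpos hν ht]

theorem integrable_exp_neg_sq : Integrable fun s : ℝ => Real.exp (-s ^ 2) := by
  simpa using integrable_exp_neg_mul_sq (b := 1) one_pos

theorem hasDerivAt_gaussTail (w : ℝ) : HasDerivAt gaussTail (-Real.exp (-w ^ 2)) w := by
  have h : gaussTail = fun w => (∫ s, Real.exp (-s ^ 2)) - ∫ s in Iic w, Real.exp (-s ^ 2) := by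
    funext w
    rw [gaussTail, ← intervalIntegral.integral_Iic_add_Ioi
      integrable_exp_neg_sq.integrableOn integrable_exp_neg_sq.integrableOn (b := w)]
    ring
  have h2 : (fun w => ∫ s in Iic w, Real.exp (-s ^ 2)) =
      fun w => (∫ s in Iic (0 : ℝ), Real.exp (-s ^ 2)) + ∫ s in (0 : ℝ)..w, Real.exp (-s ^ 2) := by
    funext w
    rw [← intervalIntegral.integral_Iic_sub_Iic
      integrable_exp_neg_sq.integrableOn integrable_exp_neg_sq.integrableOn]
    ring
  have hc : Continuous fun s : ℝ => Real.exp (-s ^ 2) := by fun_prop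
  rw [h]
  have h3 : HasDerivAt (fun w => ∫ s in Iic w, Real.exp (-s ^ 2)) (Real.exp (-w ^ 2)) w := by
    rw [h2]
    exact (intervalIntegral.integral_hasDerivAt_right (hc.intervalIntegrable _ _)
      (hc.stronglyMeasurableAtFilter _ _) hc.continuousAt).const_add _
  simpa using h3.const_sub (∫ s, Real.exp (-s ^ 2))

theorem contDiff_gaussTail : ContDiff ℝ ∞ gaussTail := by
  have hd : deriv gaussTail = fun w => -Real.exp (-w ^ 2) := by
    funext w; exact (hasDerivAt_gaussTail w).deriv
  refine (contDiff_infty_iff_deriv).2 ⟨fun w => (hasDerivAt_gaussTail w).differentiableAt, ?_⟩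
  rw [hd]; fun_prop

theorem gaussTail_eq_shift (w : ℝ) :
    gaussTail w = ∫ s in Ioi (0 : ℝ), Real.exp (-(w + s) ^ 2) := by
  rw [gaussTail, ← integral_indicator measurableSet_Ioi, ← integral_indicator measurableSet_Ioi,
    ← integral_add_left_eq_self _ w]
  congr 1 with s
  simp [indicator]

theorem sqrt_mul_eq_half (ν t : ℝ) : Real.sqrt (ν * t) = Real.sqrt (4 * ν * t) / 2 := by
  rw [show 4 * ν * t = 2 ^ 2 * (ν * t) by ring, Real.sqrt_mul (show (0 : ℝ) ≤ 2 ^ 2 by norm_num),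
    Real.sqrt_sq (by norm_num)]
  ring

/-- Completing the square: with `r = √(4νt)` one has `(x/r - βr/2)² = x²/(4νt) - βx + νβ²t`. The
extracted exponential absorbs the weight `exp (β s)` of the Robin correction. -/
theorem heat_eq_exp_mul {ν t : ℝ} (hν : 0 < ν) (ht : 0 < t) (β x : ℝ) :
    heat ν t x = (Real.sqrt Real.pi)⁻¹ * (Real.sqrt (4 * ν * t))⁻¹ *
      (Real.exp (ν * β ^ 2 * t - β * x) *
      Real.exp (-(x / Real.sqrt (4 * ν * t) - β * Real.sqrt (ν * t)) ^ 2)) := by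
  rw [sqrt_mul_eq_half ν t, heat, show 4 * Real.pi * ν * t = Real.pi * (4 * ν * t) by ring,
    Real.sqrt_mul Real.pi_pos.le, ← Real.exp_add, mul_inv]
  have hr0 : 0 < Real.sqrt (4 * ν * t) := Real.sqrt_pos.2 (by positivity)
  have hr2 : Real.sqrt (4 * ν * t) ^ 2 = 4 * ν * t := Real.sq_sqrt (by positivity)
  generalize Real.sqrt (4 * ν * t) = r at *
  rw [← hr2, show ν * β ^ 2 * t = β ^ 2 * r ^ 2 / 4 by rw [hr2]; ring]
  congr 2
  field_simp
  ring

/-- The weight cancels after completing the square, and rescaling `s` by `√(4νt)` leaves a Gaussian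
tail. From this closed form smoothness and all derivatives follow without differentiating under the
integral. -/
theorem robinTail_eq {ν t : ℝ} (hν : 0 < ν) (ht : 0 < t) (β x : ℝ) :
    robinTail ν β t x = 2 * β * (Real.sqrt Real.pi)⁻¹ * Real.exp (ν * β ^ 2 * t - β * x) *
      gaussTail (x / Real.sqrt (4 * ν * t) - β * Real.sqrt (ν * t)) := by
  set r := Real.sqrt (4 * ν * t) with hr
  have hr0 : 0 < r := Real.sqrt_pos.2 (by positivity)
  have hr2 : r ^ 2 = 4 * ν * t := Real.sq_sqrt (by positivity)
  rw [gaussTail_eq_shift, robinTail]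
  have := integral_comp_mul_left_Ioi
    (fun s : ℝ => Real.exp (-(x / r - β * Real.sqrt (ν * t) + s) ^ 2)) 0 (inv_pos.2 hr0)
  simp only [mul_zero, inv_inv, smul_eq_mul] at this
  have h2 : ∀ s, Real.exp (β * s) * heat ν t (x + s) =
      (Real.sqrt Real.pi)⁻¹ * r⁻¹ * Real.exp (ν * β ^ 2 * t - β * x) *
        Real.exp (-(x / r - β * Real.sqrt (ν * t) + r⁻¹ * s) ^ 2) := by
    intro s
    rw [heat_eq_exp_mul hν ht β, ← hr, mul_add, ← sub_sub, Real.exp_sub _ (β * s),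
      show (x + s) / r - β * Real.sqrt (ν * t) = x / r - β * Real.sqrt (ν * t) + r⁻¹ * s by ring]
    field_simp
  simp_rw [h2]
  rw [integral_const_mul, this]
  field_simp

theorem hasDerivAt_heat {ν t : ℝ} (hν : 0 < ν) (ht : 0 < t) (x : ℝ) :
    HasDerivAt (heat ν t) (heatDx ν t x) x := by
  have : HasDerivAt (fun x : ℝ => -(x ^ 2 / (4 * ν * t))) (-(2 * x / (4 * ν * t))) x := by
    simpa using ((hasDerivAt_pow 2 x).div_const (4 * ν * t)).fun_neg
  convert! this.exp.const_mul (Real.sqrt (4 * Real.pi * ν * t))⁻¹ using 1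
  unfold heatDx heat
  field_simp
  ring

theorem hasDerivAt_heatDx {ν t : ℝ} (hν : 0 < ν) (ht : 0 < t) (x : ℝ) :
    HasDerivAt (heatDx ν t) (heatDxx ν t x) x := by
  have : HasDerivAt (fun x : ℝ => -(x / (2 * ν * t))) (-(1 / (2 * ν * t))) x :=
    ((hasDerivAt_id x).div_const (2 * ν * t)).neg
  convert! this.mul (hasDerivAt_heat hν ht x) using 1
  unfold heatDxx heatDx
  field_simp
  ring

theorem hasDerivAt_heat_time {ν t : ℝ} (hν : 0 < ν) (ht : 0 < t) (x : ℝ) :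
    HasDerivAt (fun t => heat ν t x) (ν * heatDxx ν t x) t := by
  have h0 : 0 < 4 * Real.pi * ν * t := by positivity
  have h1 : HasDerivAt (fun t : ℝ => 4 * Real.pi * ν * t) (4 * Real.pi * ν) t := by
    simpa using (hasDerivAt_id t).const_mul (4 * Real.pi * ν)
  have h2 := (h1.sqrt h0.ne').inv (Real.sqrt_pos.2 h0).ne'
  have h3 : HasDerivAt (fun t : ℝ => -(x ^ 2 / (4 * ν * t))) (x ^ 2 / (4 * ν * t ^ 2)) t := by
    have h4 : HasDerivAt (fun t : ℝ => 4 * ν * t) (4 * ν) t := by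
      simpa using (hasDerivAt_id t).const_mul (4 * ν)
    convert! ((hasDerivAt_const t (x ^ 2)).div h4 (by positivity)).neg using 1
    field_simp
    ring
  convert! h2.mul h3.exp using 1
  unfold heatDxx heat
  rw [Real.sq_sqrt h0.le, Pi.inv_apply]
  have := (Real.sqrt_pos.2 h0).ne'
  field_simp
  ring

/-- The relation `(∂_x + β) R = -2β · heat` is what produces the Robin condition: at the wall the
Neumann kernel has zero derivative and value `2 · heat`, so `∂_x + β` annihilates the sum. -/
theorem hasDerivAt_robinTail {ν t : ℝ} (hν : 0 < ν) (ht : 0 < t) (β x : ℝ) :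
    HasDerivAt (robinTail ν β t) (-(β * robinTail ν β t x) - 2 * β * heat ν t x) x := by
  set r := Real.sqrt (4 * ν * t) with hr
  have hr0 : 0 < r := Real.sqrt_pos.2 (by positivity)
  have hr2 : r ^ 2 = 4 * ν * t := Real.sq_sqrt (by positivity)
  have hf : robinTail ν β t = fun x => 2 * β * (Real.sqrt Real.pi)⁻¹ *
      Real.exp (ν * β ^ 2 * t - β * x) * gaussTail (x / r - β * Real.sqrt (ν * t)) := by
    funext x; exact robinTail_eq hν ht β x
  have h1 : HasDerivAt (fun x : ℝ => ν * β ^ 2 * t - β * x) (-β) x := by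
    simpa using ((hasDerivAt_id x).const_mul β).const_sub (ν * β ^ 2 * t)
  have h2 : HasDerivAt (fun x : ℝ => x / r - β * Real.sqrt (ν * t)) (1 / r) x :=
    ((hasDerivAt_id x).div_const r).sub_const _
  have h3 := (h1.exp.const_mul (2 * β * (Real.sqrt Real.pi)⁻¹)).mul
    ((hasDerivAt_gaussTail _).comp x h2)
  rw [robinTail_eq hν ht]
  rw [hf]
  convert! h3 using 1
  have he := heat_eq_exp_mul hν ht β x
  rw [← hr] at he
  rw [he]
  simp only [Function.comp]
  generalize Real.exp (-(x / r - β * Real.sqrt (ν * t)) ^ 2) = e2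
  rw [← hr]
  generalize gaussTail (x / r - β * Real.sqrt (ν * t)) = G
  field_simp
  ring

/-- The bracket is the second space derivative, obtained by using the first-order relation twice, so
the correction solves the heat equation. -/
theorem hasDerivAt_robinTail_time {ν t : ℝ} (hν : 0 < ν) (ht : 0 < t) (β x : ℝ) :
    HasDerivAt (fun t => robinTail ν β t x)
      (ν * (β ^ 2 * robinTail ν β t x + 2 * β ^ 2 * heat ν t x - 2 * β * heatDx ν t x)) t := by
  set r := Real.sqrt (4 * ν * t) with hr
  have hr0 : 0 < r := Real.sqrt_pos.2 (by positivity)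
  have hr2 : r ^ 2 = 4 * ν * t := Real.sq_sqrt (by positivity)
  have hf : (fun t => robinTail ν β t x) =ᶠ[nhds t] fun t => 2 * β * (Real.sqrt Real.pi)⁻¹ *
      Real.exp (ν * β ^ 2 * t - β * x) *
        gaussTail (x / Real.sqrt (4 * ν * t) - β * Real.sqrt (ν * t)) := by
    filter_upwards [lt_mem_nhds ht] with t ht
    exact robinTail_eq hν ht β x
  have h1 : HasDerivAt (fun t : ℝ => ν * β ^ 2 * t - β * x) (ν * β ^ 2) t := by
    simpa using ((hasDerivAt_id t).const_mul (ν * β ^ 2)).sub_const (β * x)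
  have h4 : HasDerivAt (fun t : ℝ => 4 * ν * t) (4 * ν) t := by
    simpa using (hasDerivAt_id t).const_mul (4 * ν)
  have h5 : HasDerivAt (fun t : ℝ => ν * t) ν t := by
    simpa using (hasDerivAt_id t).const_mul ν
  have h2 := ((hasDerivAt_const t x).div (h4.sqrt (by positivity)) hr0.ne').sub
    ((h5.sqrt (by positivity)).const_mul β)
  have h3 := (h1.exp.const_mul (2 * β * (Real.sqrt Real.pi)⁻¹)).mul
    ((hasDerivAt_gaussTail _).comp t h2)
  rw [robinTail_eq hν ht]
  refine HasDerivAt.congr_of_eventuallyEq ?_ hf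
  convert! h3 using 1
  have he := heat_eq_exp_mul hν ht β x
  rw [← hr] at he
  rw [heatDx, he]
  simp only [Function.comp, Pi.sub_apply, Pi.div_apply]
  rw [← hr, show Real.sqrt (ν * t) = r / 2 from sqrt_mul_eq_half ν t]
  -- With `t` expressed through `r`, both sides are rational in `r` and the identity becomes purely
  -- algebraic.
  have ht' : t = r ^ 2 / (4 * ν) := by rw [hr2]; field_simp
  generalize Real.exp (ν * β ^ 2 * t - β * x) = e1
  generalize Real.exp (-(x / r - β * (r / 2)) ^ 2) = e2
  generalize gaussTail (x / r - β * (r / 2)) = G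
  rw [ht']
  field_simp
  ring

/-! ### The damped heat kernel on the half-line -/

/-- The damped heat kernel on the half-line with Robin parameter `β` and image sign `σ`. -/
def kern (ν d β σ t y z : ℝ) : ℝ :=
  Real.exp (-(d * t)) *
    (heat ν t (y - z) + σ * heat ν t (y + z) + robinTail ν β t (y + z))

/-- The derivative of `kern` in `y`. -/
def kernDy (ν d β σ t y z : ℝ) : ℝ :=
  Real.exp (-(d * t)) * (heatDx ν t (y - z) + σ * heatDx ν t (y + z) +
    (-(β * robinTail ν β t (y + z)) - 2 * β * heat ν t (y + z)))

/-- The second derivative of `kern` in `y`. -/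
def kernDyy (ν d β σ t y z : ℝ) : ℝ :=
  Real.exp (-(d * t)) * (heatDxx ν t (y - z) + σ * heatDxx ν t (y + z) +
    (β ^ 2 * robinTail ν β t (y + z) + 2 * β ^ 2 * heat ν t (y + z)
      - 2 * β * heatDx ν t (y + z)))

theorem kern_of_nonpos {ν t : ℝ} (hν : 0 < ν) (ht : t ≤ 0) (d β σ y z : ℝ) :
    kern ν d β σ t y z = 0 := by
  simp [kern, heat_of_nonpos hν ht, robinTail_of_nonpos hν ht]

theorem kernDy_of_nonpos {ν t : ℝ} (hν : 0 < ν) (ht : t ≤ 0) (d β σ y z : ℝ) :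
    kernDy ν d β σ t y z = 0 := by
  simp [kernDy, heatDx, heat_of_nonpos hν ht, robinTail_of_nonpos hν ht]

theorem kern_symm (ν d β σ t y z : ℝ) : kern ν d β σ t y z = kern ν d β σ t z y := by
  simp only [kern, add_comm z y]
  rw [← neg_sub z y, heat_neg]

theorem hasDerivAt_kern {ν t : ℝ} (hν : 0 < ν) (ht : 0 < t) (d β σ y z : ℝ) :
    HasDerivAt (fun y => kern ν d β σ t y z) (kernDy ν d β σ t y z) y :=
  ((((hasDerivAt_heat hν ht (y - z)).comp_sub_const y z).add
    (((hasDerivAt_heat hν ht (y + z)).comp_add_const y z).const_mul σ)).add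
    ((hasDerivAt_robinTail hν ht β (y + z)).comp_add_const y z)).const_mul _

theorem hasDerivAt_kernDy {ν t : ℝ} (hν : 0 < ν) (ht : 0 < t) (d β σ y z : ℝ) :
    HasDerivAt (fun y => kernDy ν d β σ t y z) (kernDyy ν d β σ t y z) y := by
  have h1 := (hasDerivAt_robinTail hν ht β (y + z)).comp_add_const y z
  have h2 := (hasDerivAt_heat hν ht (y + z)).comp_add_const y z
  convert! ((((hasDerivAt_heatDx hν ht (y - z)).comp_sub_const y z).add
    (((hasDerivAt_heatDx hν ht (y + z)).comp_add_const y z).const_mul σ)).add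
    ((h1.const_mul β).neg.sub (h2.const_mul (2 * β)))).const_mul _ using 1
  rw [kernDyy]
  ring

theorem hasDerivAt_kern_time {ν t : ℝ} (hν : 0 < ν) (ht : 0 < t) (d β σ y z : ℝ) :
    HasDerivAt (fun t => kern ν d β σ t y z)
      (ν * kernDyy ν d β σ t y z - d * kern ν d β σ t y z) t := by
  have h0 : HasDerivAt (fun t : ℝ => Real.exp (-(d * t))) (Real.exp (-(d * t)) * (-d)) t := by
    simpa using ((hasDerivAt_id t).const_mul d).fun_neg.exp
  convert! h0.mul (((hasDerivAt_heat_time hν ht (y - z)).add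
    ((hasDerivAt_heat_time hν ht (y + z)).const_mul σ)).add
    (hasDerivAt_robinTail_time hν ht β (y + z))) using 1
  simp only [kernDyy, kern, Pi.add_apply]
  ring

theorem contDiffAt_heat {ν : ℝ} (hν : 0 < ν) {p : ℝ × ℝ} (hp : 0 < p.1) :
    ContDiffAt ℝ ∞ (fun p : ℝ × ℝ => heat ν p.1 p.2) p := by
  have h0 : 4 * Real.pi * ν * p.1 ≠ 0 := by positivity
  have h1 : Real.sqrt (4 * Real.pi * ν * p.1) ≠ 0 := by positivity
  have h2 : 4 * ν * p.1 ≠ 0 := by positivity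
  unfold heat
  refine ContDiffAt.mul (ContDiffAt.inv (ContDiffAt.sqrt (by fun_prop) h0) h1)
    (ContDiffAt.exp (ContDiffAt.neg (ContDiffAt.div (by fun_prop) (by fun_prop) h2)))

theorem contDiffAt_heatDx {ν : ℝ} (hν : 0 < ν) {p : ℝ × ℝ} (hp : 0 < p.1) :
    ContDiffAt ℝ ∞ (fun p : ℝ × ℝ => heatDx ν p.1 p.2) p := by
  have h2 : 2 * ν * p.1 ≠ 0 := by positivity
  have h3 : ContDiffAt ℝ ∞ (fun p : ℝ × ℝ => p.2 / (2 * ν * p.1)) p :=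
    ContDiffAt.div (by fun_prop) (by fun_prop) h2
  exact h3.neg.mul (contDiffAt_heat hν hp)

theorem contDiffAt_robinTail {ν : ℝ} (hν : 0 < ν) (β : ℝ) {p : ℝ × ℝ} (hp : 0 < p.1) :
    ContDiffAt ℝ ∞ (fun p : ℝ × ℝ => robinTail ν β p.1 p.2) p := by
  have h : (fun p : ℝ × ℝ => robinTail ν β p.1 p.2) =ᶠ[nhds p] fun p =>
      2 * β * (Real.sqrt Real.pi)⁻¹ * Real.exp (ν * β ^ 2 * p.1 - β * p.2) *
      gaussTail (p.2 / Real.sqrt (4 * ν * p.1) - β * Real.sqrt (ν * p.1)) := by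
    filter_upwards [continuous_fst.continuousAt.eventually (lt_mem_nhds hp)] with q hq
    exact robinTail_eq hν hq β q.2
  refine ContDiffAt.congr_of_eventuallyEq ?_ h
  have h1 : ν * p.1 ≠ 0 := by positivity
  have h2 : 4 * ν * p.1 ≠ 0 := by positivity
  have h3 : Real.sqrt (4 * ν * p.1) ≠ 0 := by positivity
  refine ContDiffAt.mul (by fun_prop) (contDiff_gaussTail.contDiffAt.comp p
    (ContDiffAt.sub (ContDiffAt.div (by fun_prop) (ContDiffAt.sqrt (by fun_prop) h2) h3)
      (contDiffAt_const.mul (ContDiffAt.sqrt (by fun_prop) h1))))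

theorem contDiffAt_kern {ν : ℝ} (hν : 0 < ν) (d β σ : ℝ) {q : ℝ × ℝ × ℝ} (hq : 0 < q.1) :
    ContDiffAt ℝ ∞ (fun q : ℝ × ℝ × ℝ => kern ν d β σ q.1 q.2.1 q.2.2) q := by
  have h1 : ContDiffAt ℝ ∞ (fun q : ℝ × ℝ × ℝ => heat ν q.1 (q.2.1 - q.2.2)) q :=
    (contDiffAt_heat hν (p := (q.1, q.2.1 - q.2.2)) hq).comp q
      (f := fun q : ℝ × ℝ × ℝ => (q.1, q.2.1 - q.2.2)) (by fun_prop)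
  have h2 : ContDiffAt ℝ ∞ (fun q : ℝ × ℝ × ℝ => heat ν q.1 (q.2.1 + q.2.2)) q :=
    (contDiffAt_heat hν (p := (q.1, q.2.1 + q.2.2)) hq).comp q
      (f := fun q : ℝ × ℝ × ℝ => (q.1, q.2.1 + q.2.2)) (by fun_prop)
  have h3 : ContDiffAt ℝ ∞ (fun q : ℝ × ℝ × ℝ => robinTail ν β q.1 (q.2.1 + q.2.2)) q :=
    (contDiffAt_robinTail hν β (p := (q.1, q.2.1 + q.2.2)) hq).comp q
      (f := fun q : ℝ × ℝ × ℝ => (q.1, q.2.1 + q.2.2)) (by fun_prop)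
  unfold kern
  exact ContDiffAt.mul (by fun_prop) ((h1.add (contDiffAt_const.mul h2)).add h3)

theorem contDiffAt_kernDy {ν : ℝ} (hν : 0 < ν) (d β σ : ℝ) {q : ℝ × ℝ × ℝ} (hq : 0 < q.1) :
    ContDiffAt ℝ ∞ (fun q : ℝ × ℝ × ℝ => kernDy ν d β σ q.1 q.2.1 q.2.2) q := by
  have h1 : ContDiffAt ℝ ∞ (fun q : ℝ × ℝ × ℝ => heatDx ν q.1 (q.2.1 - q.2.2)) q :=
    (contDiffAt_heatDx hν (p := (q.1, q.2.1 - q.2.2)) hq).comp q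
      (f := fun q : ℝ × ℝ × ℝ => (q.1, q.2.1 - q.2.2)) (by fun_prop)
  have h2 : ContDiffAt ℝ ∞ (fun q : ℝ × ℝ × ℝ => heatDx ν q.1 (q.2.1 + q.2.2)) q :=
    (contDiffAt_heatDx hν (p := (q.1, q.2.1 + q.2.2)) hq).comp q
      (f := fun q : ℝ × ℝ × ℝ => (q.1, q.2.1 + q.2.2)) (by fun_prop)
  have h3 : ContDiffAt ℝ ∞ (fun q : ℝ × ℝ × ℝ => robinTail ν β q.1 (q.2.1 + q.2.2)) q :=
    (contDiffAt_robinTail hν β (p := (q.1, q.2.1 + q.2.2)) hq).comp q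
      (f := fun q : ℝ × ℝ × ℝ => (q.1, q.2.1 + q.2.2)) (by fun_prop)
  have h4 : ContDiffAt ℝ ∞ (fun q : ℝ × ℝ × ℝ => heat ν q.1 (q.2.1 + q.2.2)) q :=
    (contDiffAt_heat hν (p := (q.1, q.2.1 + q.2.2)) hq).comp q
      (f := fun q : ℝ × ℝ × ℝ => (q.1, q.2.1 + q.2.2)) (by fun_prop)
  unfold kernDy
  exact ContDiffAt.mul (by fun_prop) ((h1.add (contDiffAt_const.mul h2)).add
    ((contDiffAt_const.mul h3).neg.sub (contDiffAt_const.mul h4)))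

/-- The kernels are singular at `t = 0` on the diagonal, so joint measurability is glued from
continuity at positive times and the value zero elsewhere. -/
theorem measurable_of_continuousOn_pos {α : Type*} [MeasurableSpace α] [TopologicalSpace α]
    [OpensMeasurableSpace (ℝ × α)] [BorelSpace (ℝ × α)] {F : ℝ × α → ℝ}
    (h0 : ∀ q, q.1 ≤ 0 → F q = 0) (hF : ∀ q, 0 < q.1 → ContinuousAt F q) : Measurable F := by
  have hs : MeasurableSet {q : ℝ × α | 0 < q.1} :=
    (isOpen_lt continuous_const continuous_fst).measurableSet
  have : F = {q : ℝ × α | 0 < q.1}.piecewise F 0 := by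
    funext q
    by_cases hq : 0 < q.1
    · rw [piecewise_eq_of_mem _ _ _ (by exact hq)]
    · rw [piecewise_eq_of_notMem _ _ _ (by exact hq), h0 q (not_lt.1 hq)]; rfl
  have hc : ContinuousOn F {q : ℝ × α | 0 < q.1} := fun q hq => (hF q hq).continuousWithinAt
  rw [this]
  exact hc.measurable_piecewise continuous_zero.continuousOn hs

theorem measurable_kern {ν : ℝ} (hν : 0 < ν) (d β σ : ℝ) :
    Measurable fun q : ℝ × ℝ × ℝ => kern ν d β σ q.1 q.2.1 q.2.2 :=
  measurable_of_continuousOn_pos (fun _ h => kern_of_nonpos hν h _ _ _ _ _)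
    fun _ h => (contDiffAt_kern hν d β σ h).continuousAt

theorem measurable_kernDy {ν : ℝ} (hν : 0 < ν) (d β σ : ℝ) :
    Measurable fun q : ℝ × ℝ × ℝ => kernDy ν d β σ q.1 q.2.1 q.2.2 :=
  measurable_of_continuousOn_pos (fun _ h => kernDy_of_nonpos hν h _ _ _ _ _)
    fun _ h => (contDiffAt_kernDy hν d β σ h).continuousAt

theorem measurable_heat {ν : ℝ} : Measurable fun q : ℝ × ℝ => heat ν q.1 q.2 := by
  unfold heat; fun_prop

/-- The Robin condition at the boundary. -/
theorem kernDy_zero (ν d β t z : ℝ) :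
    kernDy ν d β 1 t 0 z = -(β * kern ν d β 1 t 0 z) := by
  simp only [kernDy, kern, zero_sub, zero_add, heat_neg, heatDx_neg]
  ring

/-- The Dirichlet condition at the boundary. -/
theorem kern_dirichlet_zero (ν d t z : ℝ) : kern ν d 0 (-1) t 0 z = 0 := by
  simp [kern, heat_neg, robinTail]

/-! ### Gaussian bounds -/

/-- Doubling the time costs `√2` in the prefactor and widens the Gaussian. The width gained later
absorbs the polynomial factor of the derivative. -/
theorem heat_le {ν t x : ℝ} (hν : 0 < ν) (ht : 0 < t) :
    heat ν t x ≤ 2 * heat ν (2 * t) x := by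
  unfold heat
  have h0 : 0 < 4 * Real.pi * ν * t := by positivity
  have h1 : (Real.sqrt (4 * Real.pi * ν * t))⁻¹ ≤
      2 * (Real.sqrt (4 * Real.pi * ν * (2 * t)))⁻¹ := by
    rw [inv_eq_one_div, ← div_eq_mul_inv, div_le_div_iff₀ (by positivity) (by positivity), one_mul,
      show (2 : ℝ) = Real.sqrt 4 by
        rw [show (4 : ℝ) = 2 ^ 2 by norm_num, Real.sqrt_sq (by norm_num)],
      ← Real.sqrt_mul (by norm_num)]
    have h2 : Real.sqrt 4 = 2 := by
      rw [show (4 : ℝ) = 2 ^ 2 by norm_num, Real.sqrt_sq (by norm_num)]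
    rw [h2]
    exact Real.sqrt_le_sqrt (by linarith)
  have h2 : Real.exp (-(x ^ 2 / (4 * ν * t))) ≤ Real.exp (-(x ^ 2 / (4 * ν * (2 * t)))) := by
    refine Real.exp_le_exp.2 (neg_le_neg ?_)
    exact div_le_div_of_nonneg_left (sq_nonneg x) (by positivity) (by nlinarith)
  rw [← mul_assoc]
  exact mul_le_mul h1 h2 (Real.exp_pos _).le (by positivity)

/-- The Gaussian splits into two equal halves. One absorbs the factor `|x| / √(νt)`, and the other
is the Gaussian at time `2t`. -/
theorem abs_heatDx_le {ν t x : ℝ} (hν : 0 < ν) (ht : 0 < t) :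
    |heatDx ν t x| ≤ 2 * (Real.sqrt ν)⁻¹ * ((Real.sqrt t)⁻¹ * heat ν (2 * t) x) := by
  have hn := Real.sqrt_pos.2 hν
  have hs := Real.sqrt_pos.2 ht
  have hn2 := Real.sq_sqrt hν.le
  have hs2 := Real.sq_sqrt ht.le
  have h0 := heat_le (x := 0) hν ht
  simp only [heat] at h0
  norm_num at h0
  set r := |x| / (Real.sqrt ν * Real.sqrt t) with hr
  have hr2 : r ^ 2 = x ^ 2 / (ν * t) := by
    rw [hr, div_pow, sq_abs, mul_pow, hn2, hs2]
  have hr0 : 0 ≤ r := by positivity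
  -- From `exp u ≥ 1 + u` and `2 + r²/4 - r = (r - 2)²/4 + 1`.
  have h1 : r ≤ 2 * Real.exp (r ^ 2 / 8) := by
    have := Real.add_one_le_exp (r ^ 2 / 8)
    nlinarith [sq_nonneg (r - 2)]
  have e1 : x ^ 2 / (4 * ν * t) = r ^ 2 / 8 + r ^ 2 / 8 := by rw [hr2]; field_simp; ring
  have e2 : x ^ 2 / (4 * ν * (2 * t)) = r ^ 2 / 8 := by rw [hr2]; field_simp; ring
  have h2 : |x / (2 * ν * t)| = r / 2 * ((Real.sqrt ν)⁻¹ * (Real.sqrt t)⁻¹) := by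
    rw [abs_div, abs_of_pos (show 0 < 2 * ν * t by positivity), hr,
      show 2 * ν * t = 2 * (Real.sqrt ν) ^ 2 * (Real.sqrt t) ^ 2 by rw [hn2, hs2]]
    field_simp
  rw [heatDx, abs_mul, abs_neg, h2, abs_of_nonneg (heat_nonneg _ _ _)]
  unfold heat
  rw [e1, e2, neg_add, Real.exp_add]
  have h3 : r / 2 * Real.exp (-(r ^ 2 / 8)) ≤ 1 := by
    rw [Real.exp_neg, ← div_eq_mul_inv, div_le_one (Real.exp_pos _)]
    linarith
  set A := (Real.sqrt (4 * Real.pi * ν * t))⁻¹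
  set B := (Real.sqrt (4 * Real.pi * ν * (2 * t)))⁻¹
  have hA : A ≤ 2 * B := by simpa [A, B] using h0
  have hA0 : 0 ≤ A := by positivity
  calc r / 2 * ((Real.sqrt ν)⁻¹ * (Real.sqrt t)⁻¹) *
        (A * (Real.exp (-(r ^ 2 / 8)) * Real.exp (-(r ^ 2 / 8))))
      = (r / 2 * Real.exp (-(r ^ 2 / 8))) *
        (((Real.sqrt ν)⁻¹ * (Real.sqrt t)⁻¹) * Real.exp (-(r ^ 2 / 8)) * A) := by ring
    _ ≤ 1 * (((Real.sqrt ν)⁻¹ * (Real.sqrt t)⁻¹) * Real.exp (-(r ^ 2 / 8)) * (2 * B)) := by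
        gcongr
    _ = _ := by ring

theorem robinTail_nonneg {β : ℝ} (hβ : 0 ≤ β) (ν t x : ℝ) : 0 ≤ robinTail ν β t x :=
  mul_nonneg (by positivity) (integral_nonneg fun s =>
    mul_nonneg (Real.exp_pos _).le (heat_nonneg _ _ _))

theorem integrable_exp_mul_sub_sq (b : ℝ) :
    Integrable fun s : ℝ => Real.exp (b * s - s ^ 2) := by
  have h := (integrable_exp_neg_sq.comp_sub_right (b / 2)).const_mul (Real.exp (b ^ 2 / 4))
  refine h.congr (ae_of_all _ fun s => ?_)
  simp only [← Real.exp_add]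
  congr 1
  ring

/-- After the shift, `(w + s)² ≥ w² - 2bs + s²` for `s > 0`, so the remaining integral depends only
on the lower bound `-b` of `w`. -/
theorem gaussTail_le {b w : ℝ} (hw : -b ≤ w) :
    gaussTail w ≤ Real.exp (-w ^ 2) * ∫ s in Ioi (0 : ℝ), Real.exp (2 * b * s - s ^ 2) := by
  rw [gaussTail_eq_shift, ← integral_const_mul]
  refine setIntegral_mono_on ?_ ((integrable_exp_mul_sub_sq _).const_mul _).integrableOn
    measurableSet_Ioi fun s hs => ?_
  · exact (integrable_exp_neg_sq.comp_add_left w).integrableOn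
  · rw [← Real.exp_add, Real.exp_le_exp]
    nlinarith [mem_Ioi.1 hs]

/-- For `x ≥ 0` and `t ≤ T` the argument of the Gaussian tail is at least `-β √(νT)`, so the tail is
comparable to its leading Gaussian and the exponentials recombine to the heat kernel. The closed
form lacks the prefactor `(4νt) ^ (-1/2)`, which leaves the gain `√t`; this gain makes the
correction vanish as `t → 0`. -/
theorem exists_robinTail_le {ν β : ℝ} (hν : 0 < ν) (hβ : 0 ≤ β) (T : ℝ) :
    ∃ C, 0 ≤ C ∧ ∀ t, 0 < t → t ≤ T → ∀ x, 0 ≤ x →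
      robinTail ν β t x ≤ C * (Real.sqrt t * heat ν t x) := by
  refine ⟨2 * β * Real.sqrt (4 * ν) *
    ∫ s in Ioi (0 : ℝ), Real.exp (2 * (β * Real.sqrt (ν * T)) * s - s ^ 2), ?_, ?_⟩
  · exact mul_nonneg (by positivity) (integral_nonneg fun _ => (Real.exp_pos _).le)
  intro t ht htT x hx
  have hI : 0 ≤ ∫ s in Ioi (0 : ℝ), Real.exp (2 * (β * Real.sqrt (ν * T)) * s - s ^ 2) :=
    integral_nonneg fun _ => (Real.exp_pos _).le
  have hw : -(β * Real.sqrt (ν * T)) ≤ x / Real.sqrt (4 * ν * t) - β * Real.sqrt (ν * t) := by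
    have h1 : Real.sqrt (ν * t) ≤ Real.sqrt (ν * T) := Real.sqrt_le_sqrt (by gcongr)
    have h2 : 0 ≤ x / Real.sqrt (4 * ν * t) := by positivity
    nlinarith [mul_le_mul_of_nonneg_left h1 hβ]
  rw [robinTail_eq hν ht, heat_eq_exp_mul hν ht β]
  have hg := gaussTail_le hw
  set I := ∫ s in Ioi (0 : ℝ), Real.exp (2 * (β * Real.sqrt (ν * T)) * s - s ^ 2)
  set w := x / Real.sqrt (4 * ν * t) - β * Real.sqrt (ν * t)
  set e := Real.exp (ν * β ^ 2 * t - β * x)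
  have he : 0 ≤ e := (Real.exp_pos _).le
  have hE : 0 ≤ Real.exp (-w ^ 2) := (Real.exp_pos _).le
  have hr : Real.sqrt (4 * ν) * Real.sqrt t * (Real.sqrt (4 * ν * t))⁻¹ = 1 := by
    rw [Real.sqrt_mul (by positivity) t, mul_inv_cancel₀ (by positivity)]
  calc 2 * β * (Real.sqrt Real.pi)⁻¹ * e * gaussTail w
      ≤ 2 * β * (Real.sqrt Real.pi)⁻¹ * e * (Real.exp (-w ^ 2) * I) := by gcongr
    _ = (2 * β * (Real.sqrt Real.pi)⁻¹ * e * Real.exp (-w ^ 2) * I) * 1 := by ring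
    _ ≤ (2 * β * (Real.sqrt Real.pi)⁻¹ * e * Real.exp (-w ^ 2) * I) *
        (Real.sqrt (4 * ν) * Real.sqrt t * (Real.sqrt (4 * ν * t))⁻¹) := by rw [hr]
    _ = _ := by ring

theorem heat_add_le_sub {ν t y z : ℝ} (hν : 0 < ν) (ht : 0 < t) (hy : 0 ≤ y) (hz : 0 ≤ z) :
    heat ν t (y + z) ≤ heat ν t (y - z) := by
  unfold heat
  gcongr 1
  refine Real.exp_le_exp.2 (neg_le_neg ?_)
  gcongr 1
  nlinarith [mul_nonneg hy hz]

/-- Gaussian bounds for the kernel and its derivative. -/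
theorem exists_kern_le {ν d β σ : ℝ} (hν : 0 < ν) (hd : 0 ≤ d) (hβ : 0 ≤ β) (hσ : |σ| ≤ 1)
    {T : ℝ} (hT : 0 < T) :
    ∃ C, 0 < C ∧ ∀ t, 0 < t → t ≤ T → ∀ y, 0 ≤ y → ∀ z, 0 ≤ z →
      |kern ν d β σ t y z| ≤ C * heat ν (2 * t) (y - z) ∧
      |kernDy ν d β σ t y z| ≤ C * ((Real.sqrt t)⁻¹ * heat ν (2 * t) (y - z)) := by
  obtain ⟨R, hR, hRt⟩ : ∃ R, 0 ≤ R ∧ ∀ t, 0 < t → t ≤ T → ∀ x, 0 ≤ x →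
      robinTail ν β t x ≤ R * heat ν t x := by
    obtain ⟨C, hC, h⟩ := exists_robinTail_le hν hβ T
    refine ⟨C * Real.sqrt T, by positivity, fun t ht htT x hx => (h t ht htT x hx).trans ?_⟩
    rw [mul_assoc]
    have := heat_nonneg ν t x
    gcongr
  -- The summand `4 + 2R` serves the kernel, the rest serves its derivative. In the latter, terms
  -- without a singularity are multiplied by `√T / √t ≥ 1`.
  refine ⟨4 + 2 * R + (4 * (Real.sqrt ν)⁻¹ + (β * R + 2 * β) * 2 * Real.sqrt T), by positivity, ?_⟩
  intro t ht htT y hy z hz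
  have h2t : 0 < 2 * t := by linarith
  have hex : Real.exp (-(d * t)) ≤ 1 := Real.exp_le_one_iff.2 (by simpa using by positivity)
  have hex0 := (Real.exp_pos (-(d * t))).le
  set H := heat ν (2 * t) (y - z) with hH
  have hH0 : 0 ≤ H := heat_nonneg _ _ _
  have hHp : heat ν (2 * t) (y + z) ≤ H := heat_add_le_sub hν h2t hy hz
  have a1 : heat ν t (y - z) ≤ 2 * H := heat_le hν ht
  have a2 : heat ν t (y + z) ≤ 2 * H := (heat_le hν ht).trans (by linarith)
  have a3 : robinTail ν β t (y + z) ≤ R * (2 * H) :=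
    (hRt t ht htT _ (add_nonneg hy hz)).trans (by gcongr)
  have n1 := heat_nonneg ν t (y - z)
  have n2 := heat_nonneg ν t (y + z)
  have n3 := robinTail_nonneg hβ ν t (y + z)
  have b1 : |heatDx ν t (y - z)| ≤ 2 * (Real.sqrt ν)⁻¹ * ((Real.sqrt t)⁻¹ * H) :=
    abs_heatDx_le hν ht
  have b2 : |heatDx ν t (y + z)| ≤ 2 * (Real.sqrt ν)⁻¹ * ((Real.sqrt t)⁻¹ * H) :=
    (abs_heatDx_le hν ht).trans (by gcongr)
  have hst : 1 ≤ Real.sqrt T * (Real.sqrt t)⁻¹ := by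
    rw [← div_eq_mul_inv, one_le_div (by positivity)]
    exact Real.sqrt_le_sqrt htT
  have hsν : 0 ≤ (Real.sqrt ν)⁻¹ := by positivity
  have hsH : 0 ≤ (Real.sqrt t)⁻¹ * H := by positivity
  constructor
  · rw [kern, abs_mul, abs_of_nonneg hex0]
    calc _ ≤ 1 * |heat ν t (y - z) + σ * heat ν t (y + z) + robinTail ν β t (y + z)| := by gcongr
      _ ≤ 1 * (2 * H + 1 * (2 * H) + R * (2 * H)) := by
        gcongr
        refine (abs_add_three _ _ _).trans ?_
        rw [abs_of_nonneg n1, abs_mul, abs_of_nonneg n2, abs_of_nonneg n3]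
        gcongr
      _ ≤ _ := by
        have : 0 ≤ (4 * (Real.sqrt ν)⁻¹ + (β * R + 2 * β) * 2 * Real.sqrt T) * H := by positivity
        nlinarith
  · rw [kernDy, abs_mul, abs_of_nonneg hex0]
    calc _ ≤ 1 * |heatDx ν t (y - z) + σ * heatDx ν t (y + z) +
          (-(β * robinTail ν β t (y + z)) - 2 * β * heat ν t (y + z))| := by gcongr
      _ ≤ 1 * (2 * (Real.sqrt ν)⁻¹ * ((Real.sqrt t)⁻¹ * H) +
          1 * (2 * (Real.sqrt ν)⁻¹ * ((Real.sqrt t)⁻¹ * H)) +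
          ((β * R + 2 * β) * (2 * H)) * 1) := by
        gcongr
        refine (abs_add_three _ _ _).trans ?_
        rw [abs_mul]
        gcongr
        rw [← neg_add', abs_neg, abs_of_nonneg (by positivity)]
        nlinarith [mul_le_mul_of_nonneg_left a3 hβ, mul_le_mul_of_nonneg_left a2 hβ]
      _ ≤ 1 * (2 * (Real.sqrt ν)⁻¹ * ((Real.sqrt t)⁻¹ * H) +
          1 * (2 * (Real.sqrt ν)⁻¹ * ((Real.sqrt t)⁻¹ * H)) +
          ((β * R + 2 * β) * (2 * H)) * (Real.sqrt T * (Real.sqrt t)⁻¹)) := by gcongr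
      _ ≤ _ := by
        have : 0 ≤ (4 + 2 * R) * ((Real.sqrt t)⁻¹ * H) := by positivity
        nlinarith

/-! ### Integral inequalities -/

section Minkowski

variable {α β : Type*} [MeasurableSpace α] [MeasurableSpace β]

theorem eLpNorm_two_sq {ε : Type*} [TopologicalSpace ε] [ContinuousENorm ε] (f : α → ε)
    (μ : Measure α) : eLpNorm f 2 μ ^ 2 = ∫⁻ x, ‖f x‖ₑ ^ 2 ∂μ := by
  rw [eLpNorm_eq_lintegral_rpow_enorm_toReal (by norm_num) (by norm_num)]
  simp only [ENNReal.toReal_ofNat, one_div]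
  rw [← ENNReal.rpow_natCast, ← ENNReal.rpow_mul]
  norm_num

theorem lintegral_mul_le_eLpNorm {μ : Measure α} {f g : α → ℝ≥0∞} (hf : AEMeasurable f μ)
    (hg : AEMeasurable g μ) : ∫⁻ x, f x * g x ∂μ ≤ eLpNorm f 2 μ * eLpNorm g 2 μ := by
  have := ENNReal.lintegral_mul_le_Lp_mul_Lq μ Real.HolderConjugate.two_two hf hg
  rw [eLpNorm_eq_lintegral_rpow_enorm_toReal (by norm_num) (by norm_num),
    eLpNorm_eq_lintegral_rpow_enorm_toReal (by norm_num) (by norm_num)]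
  simpa using this

/-- With `S` the inner integral, `‖S‖²` is the integral of `⟨F_p, F_q⟩` over all pairs `(p, q)`, and
Cauchy–Schwarz for each pair gives the square of the right side. Nothing is divided by `‖S‖`, so no
finiteness is needed. -/
theorem eLpNorm_lintegral_le_of_measurable {μ : Measure α} {ρ : Measure β} [SFinite μ] [SFinite ρ]
    {F : α → β → ℝ≥0∞} (hF : Measurable (Function.uncurry F)) :
    eLpNorm (fun y => ∫⁻ p, F y p ∂ρ) 2 μ ≤ ∫⁻ p, eLpNorm (fun y => F y p) 2 μ ∂ρ := by
  have hFp : ∀ p, Measurable fun y => F y p := fun p => hF.of_uncurry_right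
  have hFy : ∀ y, Measurable fun p => F y p := fun y => hF.of_uncurry_left
  have hS : Measurable fun y => ∫⁻ p, F y p ∂ρ := hF.lintegral_prod_right'
  refine (ENNReal.pow_le_pow_left_iff (two_ne_zero)).1 ?_
  rw [eLpNorm_two_sq]
  simp only [enorm_eq_self]
  set A := ∫⁻ p, eLpNorm (fun y => F y p) 2 μ ∂ρ
  have h1 : ∀ p, ∫⁻ y, F y p * ∫⁻ q, F y q ∂ρ ∂μ ≤ eLpNorm (fun y => F y p) 2 μ * A := by
    intro p
    calc ∫⁻ y, F y p * ∫⁻ q, F y q ∂ρ ∂μ = ∫⁻ y, ∫⁻ q, F y p * F y q ∂ρ ∂μ := by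
          congr 1 with y; rw [lintegral_const_mul _ (hFy y)]
      _ = ∫⁻ q, ∫⁻ y, F y p * F y q ∂μ ∂ρ := lintegral_lintegral_swap
          ((((hFp p).comp measurable_fst).mul hF).aemeasurable)
      _ ≤ ∫⁻ q, eLpNorm (fun y => F y p) 2 μ * eLpNorm (fun y => F y q) 2 μ ∂ρ :=
          lintegral_mono fun q => lintegral_mul_le_eLpNorm (hFp p).aemeasurable (hFp q).aemeasurable
      _ = _ := by
          rw [lintegral_const_mul]
          simp_rw [eLpNorm_eq_lintegral_rpow_enorm_toReal (two_ne_zero : (2 : ℝ≥0∞) ≠ 0)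
            (ENNReal.ofNat_ne_top : (2 : ℝ≥0∞) ≠ ⊤)]
          simp only [enorm_eq_self]
          exact (Measurable.lintegral_prod_left' (hF.pow_const _)).pow_const _
  have hm : Measurable fun p => eLpNorm (fun y => F y p) 2 μ := by
    simp_rw [eLpNorm_eq_lintegral_rpow_enorm_toReal (two_ne_zero : (2 : ℝ≥0∞) ≠ 0)
      (ENNReal.ofNat_ne_top : (2 : ℝ≥0∞) ≠ ⊤)]
    simp only [enorm_eq_self]
    exact (Measurable.lintegral_prod_left' (hF.pow_const _)).pow_const _
  calc ∫⁻ y, (∫⁻ p, F y p ∂ρ) ^ 2 ∂μ = ∫⁻ y, ∫⁻ p, F y p * ∫⁻ q, F y q ∂ρ ∂ρ ∂μ := by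
        congr 1 with y; rw [lintegral_mul_const _ (hFy y), sq]
    _ = ∫⁻ p, ∫⁻ y, F y p * ∫⁻ q, F y q ∂ρ ∂μ ∂ρ := lintegral_lintegral_swap
        ((hF.mul (hS.comp measurable_fst)).aemeasurable)
    _ ≤ ∫⁻ p, eLpNorm (fun y => F y p) 2 μ * A ∂ρ := lintegral_mono h1
    _ = A ^ 2 := by rw [lintegral_mul_const _ hm, sq]

theorem ae_ae_swap {μ : Measure α} {ρ : Measure β} [SFinite μ] [SFinite ρ] {P : α × β → Prop}
    (h : ∀ᵐ q ∂μ.prod ρ, P q) : ∀ᵐ p ∂ρ, ∀ᵐ y ∂μ, P (y, p) := by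
  have h2 : ∀ᵐ q ∂ρ.prod μ, P q.swap := by
    rw [← Measure.prod_swap] at h
    exact ae_of_ae_map measurable_swap.aemeasurable h
  exact Measure.ae_ae_of_ae_prod h2

/-- Minkowski's integral inequality in `L²`. -/
theorem eLpNorm_lintegral_le {μ : Measure α} {ρ : Measure β} [SFinite μ] [SFinite ρ]
    {F : α → β → ℝ≥0∞} (hF : AEMeasurable (Function.uncurry F) (μ.prod ρ)) :
    eLpNorm (fun y => ∫⁻ p, F y p ∂ρ) 2 μ ≤ ∫⁻ p, eLpNorm (fun y => F y p) 2 μ ∂ρ := by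
  set G : α → β → ℝ≥0∞ := Function.curry (hF.mk _)
  have h0 : ∀ᵐ q ∂μ.prod ρ, F q.1 q.2 = G q.1 q.2 := hF.ae_eq_mk
  have h1 : (fun y => ∫⁻ p, F y p ∂ρ) =ᵐ[μ] fun y => ∫⁻ p, G y p ∂ρ := by
    filter_upwards [Measure.ae_ae_of_ae_prod h0] with y hy
    exact lintegral_congr_ae hy
  have h2 : (fun p => eLpNorm (fun y => F y p) 2 μ) =ᵐ[ρ] fun p => eLpNorm (fun y => G y p) 2 μ := by
    filter_upwards [ae_ae_swap h0] with p hp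
    exact eLpNorm_congr_ae hp
  rw [eLpNorm_congr_ae h1, lintegral_congr_ae h2]
  exact eLpNorm_lintegral_le_of_measurable hF.measurable_mk

/-- Schur's test in `L²`. -/
theorem eLpNorm_lintegral_mul_le {μ : Measure α} {ρ : Measure β} [SFinite μ] [SFinite ρ]
    {k : α → β → ℝ≥0∞} (hk : Measurable (Function.uncurry k)) {u : β → ℝ≥0∞}
    (hu : AEMeasurable u ρ) (h1 : ∀ y, ∫⁻ p, k y p ∂ρ ≤ 1) (h2 : ∀ p, ∫⁻ y, k y p ∂μ ≤ 1) :
    eLpNorm (fun y => ∫⁻ p, k y p * u p ∂ρ) 2 μ ≤ eLpNorm u 2 ρ := by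
  have hky : ∀ y, Measurable fun p => k y p := fun y => hk.of_uncurry_left
  have hkp : ∀ p, Measurable fun y => k y p := fun p => hk.of_uncurry_right
  refine (ENNReal.pow_le_pow_left_iff (two_ne_zero)).1 ?_
  rw [eLpNorm_two_sq, eLpNorm_two_sq]
  simp only [enorm_eq_self]
  -- Cauchy–Schwarz after splitting `k u = √k · (√k u)`; the first factor contributes the row
  -- integral, which is at most one. The column integrals are used after exchanging the order.
  have hcs : ∀ y, (∫⁻ p, k y p * u p ∂ρ) ^ 2 ≤ ∫⁻ p, k y p * u p ^ 2 ∂ρ := by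
    intro y
    have e : ∀ p, k y p * u p = k y p ^ (1 / 2 : ℝ) * (k y p ^ (1 / 2 : ℝ) * u p) := by
      intro p
      rw [← mul_assoc, ← ENNReal.rpow_add_of_nonneg _ _ (by norm_num) (by norm_num)]
      norm_num
    have hs := lintegral_mul_le_eLpNorm (μ := ρ) ((hky y).pow_const (1 / 2 : ℝ)).aemeasurable
      (((hky y).pow_const (1 / 2 : ℝ)).aemeasurable.mul hu)
    simp_rw [e]
    calc _ ≤ (_ * _) ^ 2 := pow_le_pow_left' hs 2
      _ = (∫⁻ p, k y p ∂ρ) * ∫⁻ p, k y p * u p ^ 2 ∂ρ := by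
        rw [mul_pow, eLpNorm_two_sq, eLpNorm_two_sq]
        simp only [enorm_eq_self, Pi.mul_apply, mul_pow]
        simp_rw [← ENNReal.rpow_natCast, ← ENNReal.rpow_mul]
        norm_num
      _ ≤ 1 * _ := by gcongr; exact h1 y
      _ = _ := one_mul _
  calc ∫⁻ y, (∫⁻ p, k y p * u p ∂ρ) ^ 2 ∂μ ≤ ∫⁻ y, ∫⁻ p, k y p * u p ^ 2 ∂ρ ∂μ :=
        lintegral_mono hcs
    _ = ∫⁻ p, ∫⁻ y, k y p * u p ^ 2 ∂μ ∂ρ := lintegral_lintegral_swap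
        (hk.aemeasurable.mul (hu.pow_const 2).comp_snd)
    _ = ∫⁻ p, (∫⁻ y, k y p ∂μ) * u p ^ 2 ∂ρ := by
        congr 1 with p; rw [lintegral_mul_const _ (hkp p)]
    _ ≤ ∫⁻ p, 1 * u p ^ 2 ∂ρ := lintegral_mono fun p => mul_le_mul_left (h2 p) _
    _ = _ := by simp

end Minkowski

/-! ### Integrals of the heat kernel -/

theorem integrable_heat {ν t : ℝ} (hν : 0 < ν) (ht : 0 < t) : Integrable (heat ν t) := by
  have := (integrable_exp_neg_mul_sq (b := (4 * ν * t)⁻¹) (by positivity)).const_mul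
    (Real.sqrt (4 * Real.pi * ν * t))⁻¹
  refine this.congr (ae_of_all _ fun x => ?_)
  simp only [heat]
  congr 2
  field_simp

theorem integral_heat {ν t : ℝ} (hν : 0 < ν) (ht : 0 < t) : ∫ x, heat ν t x = 1 := by
  have := integral_gaussian (4 * ν * t)⁻¹
  have h2 : ∀ x : ℝ, heat ν t x =
      (Real.sqrt (4 * Real.pi * ν * t))⁻¹ * Real.exp (-(4 * ν * t)⁻¹ * x ^ 2) := by
    intro x
    simp only [heat]
    congr 2
    field_simp
  simp_rw [h2]
  rw [integral_const_mul, this, div_inv_eq_mul, show Real.pi * (4 * ν * t) = 4 * Real.pi * ν * t by ring]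
  have : 0 < Real.sqrt (4 * Real.pi * ν * t) := by positivity
  field_simp

/-- The heat kernel as an extended nonnegative real number. -/
def eheat (ν t x : ℝ) : ℝ≥0∞ := ENNReal.ofReal (heat ν t x)

theorem measurable_eheat (ν : ℝ) : Measurable fun q : ℝ × ℝ => eheat ν q.1 q.2 :=
  measurable_heat.ennreal_ofReal

theorem lintegral_eheat_le {ν : ℝ} (hν : 0 < ν) (t : ℝ) : ∫⁻ x, eheat ν t x ≤ 1 := by
  rcases le_or_gt t 0 with ht | ht
  · simp [eheat, heat_of_nonpos hν ht]
  · simp only [eheat]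
    rw [← ofReal_integral_eq_lintegral_ofReal (integrable_heat hν ht)
      (ae_of_all _ (heat_nonneg ν t)), integral_heat hν ht]
    simp

theorem lintegral_eheat_sub_le {ν : ℝ} (hν : 0 < ν) (t z : ℝ) (s : Set ℝ) :
    ∫⁻ y in s, eheat ν t (y - z) ≤ 1 :=
  (setLIntegral_le_lintegral _ _).trans
    ((lintegral_sub_right_eq_self (eheat ν t) z).le.trans (lintegral_eheat_le hν t))

theorem lintegral_eheat_sub_le' {ν : ℝ} (hν : 0 < ν) (t y : ℝ) (s : Set ℝ) :
    ∫⁻ z in s, eheat ν t (y - z) ≤ 1 :=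
  (setLIntegral_le_lintegral _ _).trans
    ((lintegral_sub_left_eq_self (eheat ν t) y).le.trans (lintegral_eheat_le hν t))

theorem eheat_of_nonpos {ν t : ℝ} (hν : 0 < ν) (ht : t ≤ 0) (x : ℝ) : eheat ν t x = 0 := by
  simp [eheat, heat_of_nonpos hν ht]

/-- The power `t ^ (-a)` for `t > 0`, extended by zero. -/
def tpow (a t : ℝ) : ℝ≥0∞ := (Ioi (0 : ℝ)).indicator (fun t => ENNReal.ofReal (t ^ (-a))) t

theorem tpow_of_pos (a : ℝ) {t : ℝ} (ht : 0 < t) : tpow a t = ENNReal.ofReal (t ^ (-a)) := by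
  simp [tpow, ht]

theorem tpow_of_nonpos (a : ℝ) {t : ℝ} (ht : t ≤ 0) : tpow a t = 0 := by
  simp [tpow, ht]

theorem tpow_ne_top (a t : ℝ) : tpow a t ≠ ⊤ := by
  rcases le_or_gt t 0 with ht | ht
  · simp [tpow_of_nonpos _ ht]
  · simp [tpow_of_pos _ ht]

theorem measurable_tpow (a : ℝ) : Measurable (tpow a) :=
  (Measurable.ennreal_ofReal (by fun_prop)).indicator measurableSet_Ioi

theorem tpow_mul (a b t : ℝ) : tpow a t * tpow b t = tpow (a + b) t := by
  rcases le_or_gt t 0 with ht | ht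
  · simp [tpow_of_nonpos _ ht]
  · rw [tpow_of_pos _ ht, tpow_of_pos _ ht, tpow_of_pos _ ht, ← ENNReal.ofReal_mul (by positivity),
      ← Real.rpow_add ht, neg_add]

theorem lintegral_tpow_lt_top {a : ℝ} (ha : a < 1) (T : ℝ) :
    ∫⁻ t in Ioo (0 : ℝ) T, tpow a t < ⊤ := by
  rcases le_or_gt T 0 with hT | hT
  · simp [Ioo_eq_empty (not_lt.2 hT)]
  have h := (intervalIntegral.intervalIntegrable_rpow' (a := 0) (b := T) (r := -a) (by linarith))
  rw [intervalIntegrable_iff_integrableOn_Ioo_of_le hT.le] at h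
  have := h.lintegral_lt_top
  refine lt_of_le_of_lt (le_of_eq (setLIntegral_congr_fun measurableSet_Ioo fun t ht => ?_)) this
  exact tpow_of_pos a ht.1

theorem lintegral_tpow_sub_le (a : ℝ) {t T : ℝ} (htT : t ≤ T) :
    ∫⁻ s in Ioo (0 : ℝ) T, tpow a (t - s) ≤ ∫⁻ r in Ioo (0 : ℝ) T, tpow a r := by
  rw [← lintegral_indicator measurableSet_Ioo, ← lintegral_indicator measurableSet_Ioo,
    ← lintegral_sub_left_eq_self _ t]
  refine lintegral_mono fun s => ?_
  simp only [indicator, mem_Ioo]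
  split_ifs with h1 h2 h2
  · simp
  · rw [sub_sub_cancel, tpow_of_nonpos]
    by_contra! h3
    exact h2 ⟨h3, by linarith⟩
  · simp
  · simp

theorem eheat_le {ν : ℝ} (hν : 0 < ν) (t x : ℝ) :
    eheat ν (2 * t) x ≤ ENNReal.ofReal ((Real.sqrt (8 * Real.pi * ν))⁻¹) * tpow (1 / 2) t := by
  rcases le_or_gt t 0 with ht | ht
  · simp [eheat_of_nonpos hν (show 2 * t ≤ 0 by linarith)]
  rw [tpow_of_pos _ ht, ← ENNReal.ofReal_mul (by positivity)]
  refine ENNReal.ofReal_le_ofReal ?_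
  rw [Real.rpow_neg ht.le, ← Real.sqrt_eq_rpow, ← mul_inv, ← Real.sqrt_mul (by positivity),
    show 8 * Real.pi * ν * t = 4 * Real.pi * ν * (2 * t) by ring]
  exact mul_le_of_le_one_right (by positivity) (Real.exp_le_one_iff.2 (by simpa using by positivity))

/-- Interpolation between `L¹` and `L^∞` through `f² ≤ A f`. Applied to the heat kernel, whose
supremum is of order `t ^ (-1/2)`, it gives an `L²` norm of order `t ^ (-1/4)`. -/
theorem eLpNorm_le_of_lintegral_le {α : Type*} [MeasurableSpace α] {μ : Measure α} {f : α → ℝ≥0∞}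
    {A : ℝ≥0∞} (hA : A ≠ ⊤) (h1 : ∀ x, f x ≤ A) (h2 : ∫⁻ x, f x ∂μ ≤ 1) :
    eLpNorm f 2 μ ≤ A ^ (1 / 2 : ℝ) := by
  refine (ENNReal.pow_le_pow_left_iff (two_ne_zero)).1 ?_
  rw [eLpNorm_two_sq, ← ENNReal.rpow_natCast, ← ENNReal.rpow_mul]
  simp only [enorm_eq_self]
  norm_num
  calc ∫⁻ x, f x ^ 2 ∂μ ≤ ∫⁻ x, A * f x ∂μ :=
        lintegral_mono fun x => by rw [sq]; exact mul_le_mul_left (h1 x) _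
    _ = A * ∫⁻ x, f x ∂μ := lintegral_const_mul' _ _ hA
    _ ≤ A := by simpa using mul_le_mul_right h2 A

/-- The constant in the `L²` bound of the heat kernel. -/
def heatConst (ν : ℝ) : ℝ≥0∞ := ENNReal.ofReal ((Real.sqrt (8 * Real.pi * ν))⁻¹) ^ (1 / 2 : ℝ)

theorem heatConst_lt_top (ν : ℝ) : heatConst ν < ⊤ :=
  ENNReal.rpow_lt_top_of_nonneg (by norm_num) ENNReal.ofReal_ne_top

theorem tpow_rpow (t : ℝ) : tpow (1 / 2) t ^ (1 / 2 : ℝ) = tpow (1 / 4) t := by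
  rcases le_or_gt t 0 with ht | ht
  · rw [tpow_of_nonpos _ ht, tpow_of_nonpos _ ht]; norm_num
  · rw [tpow_of_pos _ ht, tpow_of_pos _ ht, ENNReal.ofReal_rpow_of_nonneg (by positivity) (by norm_num),
      ← Real.rpow_mul ht.le]
    norm_num

theorem eLpNorm_eheat_le {ν : ℝ} (hν : 0 < ν) (t z : ℝ) (s : Set ℝ) :
    eLpNorm (fun y => eheat ν (2 * t) (y - z)) 2 (volume.restrict s) ≤
      heatConst ν * tpow (1 / 4) t := by
  rw [heatConst, ← tpow_rpow, ← ENNReal.mul_rpow_of_nonneg _ _ (by norm_num)]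
  exact eLpNorm_le_of_lintegral_le
    (ENNReal.mul_ne_top ENNReal.ofReal_ne_top (tpow_ne_top _ _)) (fun y => eheat_le hν t _) (lintegral_eheat_sub_le hν _ z s)

theorem eLpNorm_eheat_le' {ν : ℝ} (hν : 0 < ν) (t y : ℝ) (s : Set ℝ) :
    eLpNorm (fun z => eheat ν (2 * t) (y - z)) 2 (volume.restrict s) ≤
      heatConst ν * tpow (1 / 4) t := by
  rw [heatConst, ← tpow_rpow, ← ENNReal.mul_rpow_of_nonneg _ _ (by norm_num)]
  exact eLpNorm_le_of_lintegral_le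
    (ENNReal.mul_ne_top ENNReal.ofReal_ne_top (tpow_ne_top _ _)) (fun z => eheat_le hν t _) (lintegral_eheat_sub_le' hν _ y s)

/-! ### Potentials of space-time sources -/

theorem enorm_complex_ofReal (r : ℝ) : ‖(r : ℂ)‖ₑ = ‖r‖ₑ := by
  rw [← ofReal_norm, ← ofReal_norm, Complex.norm_real]

/-- The potential of the source `a ρ` with respect to the kernel `k`. -/
def pot (k : ℝ → ℝ → ℝ → ℝ) (ρ : Measure (ℝ × ℝ)) (a : ℝ × ℝ → ℂ) (t y : ℝ) : ℂ :=
  ∫ p, (k (t - p.1) y p.2 : ℂ) * a p ∂ρ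

/-- The Gaussian majorant of the potentials. -/
def potMajZero (ν : ℝ) (ρ : Measure (ℝ × ℝ)) (a : ℝ × ℝ → ℂ) (t y : ℝ) : ℝ≥0∞ :=
  ∫⁻ p, eheat ν (2 * (t - p.1)) (y - p.2) * ‖a p‖ₑ ∂ρ

/-- The Gaussian majorant of the derivatives of the potentials. -/
def potMaj (ν : ℝ) (ρ : Measure (ℝ × ℝ)) (a : ℝ × ℝ → ℂ) (t y : ℝ) : ℝ≥0∞ :=
  ∫⁻ p, tpow (1 / 2) (t - p.1) * eheat ν (2 * (t - p.1)) (y - p.2) * ‖a p‖ₑ ∂ρ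

/-- Sources in `[0, T) × [0, ∞)` whose potentials belong to `L¹(0, T; H¹)`. -/
structure IsSource (ν T : ℝ) (ρ : Measure (ℝ × ℝ)) (a : ℝ × ℝ → ℂ) : Prop where
  meas : AEStronglyMeasurable a ρ
  supp : ∀ᵐ p ∂ρ, 0 ≤ p.1 ∧ p.1 < T ∧ 0 ≤ p.2
  norm_lt_top : ∫⁻ t in Ioo (0 : ℝ) T, eLpNorm (potMaj ν ρ a t) 2 halfLine < ⊤
  trace_lt_top : ∫⁻ t in Ioo (0 : ℝ) T, potMajZero ν ρ a t 0 < ⊤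

/-- Scalar functions in `L¹(0, T; H¹(0, ∞))`. -/
structure MemLOneH1 (T : ℝ) (u u' : ℝ → ℝ → ℂ) (c : ℝ → ℂ) : Prop where
  meas : AEStronglyMeasurable (Function.uncurry u) ((timeInterval T).prod halfLine)
  meas_deriv : AEStronglyMeasurable (Function.uncurry u') ((timeInterval T).prod halfLine)
  isH1 : ∀ᵐ t ∂(timeInterval T), IsH1 (u t) (u' t) (c t)
  norm_lt_top : ∫⁻ t in Ioo (0 : ℝ) T, eLpNorm (u t) 2 halfLine < ⊤
  norm_deriv_lt_top : ∫⁻ t in Ioo (0 : ℝ) T, eLpNorm (u' t) 2 halfLine < ⊤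

/-- The kernel is recorded with both its natural bound and the weaker bound of its derivative, so
that one majorant controls the full `H¹` norm. For `t ≤ 0` all kernels vanish, hence no positivity
of the time is asked for. -/
theorem exists_kern_enorm_le {ν d β σ : ℝ} (hν : 0 < ν) (hd : 0 ≤ d) (hβ : 0 ≤ β)
    (hσ : |σ| ≤ 1) {T : ℝ} (hT : 0 < T) :
    ∃ C : ℝ≥0∞, C ≠ ⊤ ∧ ∀ t, t ≤ T → ∀ y, 0 ≤ y → ∀ z, 0 ≤ z →
      ‖kern ν d β σ t y z‖ₑ ≤ C * eheat ν (2 * t) (y - z) ∧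
      ‖kern ν d β σ t y z‖ₑ ≤ C * (tpow (1 / 2) t * eheat ν (2 * t) (y - z)) ∧
      ‖kernDy ν d β σ t y z‖ₑ ≤ C * (tpow (1 / 2) t * eheat ν (2 * t) (y - z)) := by
  obtain ⟨C, hC, h⟩ := exists_kern_le (ν := ν) (d := d) (β := β) (σ := σ) hν hd hβ hσ hT
  refine ⟨ENNReal.ofReal (C * (1 + Real.sqrt T)), ENNReal.ofReal_ne_top, fun t htT y hy z hz => ?_⟩
  rcases le_or_gt t 0 with ht | ht
  · simp [kern_of_nonpos hν ht, kernDy_of_nonpos hν ht]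
  obtain ⟨h1, h2⟩ := h t ht htT y hy z hz
  have hst : 1 ≤ Real.sqrt T * (Real.sqrt t)⁻¹ := by
    rw [← div_eq_mul_inv, one_le_div (by positivity)]
    exact Real.sqrt_le_sqrt htT
  have hs0 : 0 ≤ Real.sqrt T := by positivity
  have ht0 : 0 ≤ (Real.sqrt t)⁻¹ := by positivity
  have hH := heat_nonneg ν (2 * t) (y - z)
  have hp : tpow (1 / 2) t * eheat ν (2 * t) (y - z) =
      ENNReal.ofReal ((Real.sqrt t)⁻¹ * heat ν (2 * t) (y - z)) := by
    rw [tpow_of_pos _ ht, eheat, ← ENNReal.ofReal_mul (by positivity), Real.rpow_neg ht.le,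
      ← Real.sqrt_eq_rpow]
  rw [hp, eheat, ← ENNReal.ofReal_mul (by positivity), ← ENNReal.ofReal_mul (by positivity),
    Real.enorm_eq_ofReal_abs, Real.enorm_eq_ofReal_abs]
  refine ⟨ENNReal.ofReal_le_ofReal (h1.trans ?_), ENNReal.ofReal_le_ofReal (h1.trans ?_),
    ENNReal.ofReal_le_ofReal (h2.trans ?_)⟩
  · gcongr; nlinarith
  · calc C * heat ν (2 * t) (y - z) = C * heat ν (2 * t) (y - z) * 1 := by ring
      _ ≤ C * heat ν (2 * t) (y - z) * (Real.sqrt T * (Real.sqrt t)⁻¹) := by gcongr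
      _ ≤ C * heat ν (2 * t) (y - z) * (Real.sqrt T * (Real.sqrt t)⁻¹) +
          C * ((Real.sqrt t)⁻¹ * heat ν (2 * t) (y - z)) := le_add_of_nonneg_right (by positivity)
      _ = _ := by ring
  · gcongr; nlinarith

section Fubini

variable {Ω : Type*} [MeasurableSpace Ω] {m : Measure Ω} [SFinite m]
  {ρ : Measure (ℝ × ℝ)} [SFinite ρ] {a : ℝ × ℝ → ℂ} {k : ℝ → ℝ → ℝ → ℝ} {τ η : Ω → ℝ}

theorem aestronglyMeasurable_kernel_mul
    (hk : Measurable fun q : ℝ × ℝ × ℝ => k q.1 q.2.1 q.2.2) (ha : AEStronglyMeasurable a ρ)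
    (hτ : Measurable τ) (hη : Measurable η) :
    AEStronglyMeasurable (fun q : Ω × (ℝ × ℝ) => (k (τ q.1 - q.2.1) (η q.1) q.2.2 : ℂ) * a q.2)
      (m.prod ρ) := by
  have h1 : Measurable fun q : Ω × (ℝ × ℝ) => (k (τ q.1 - q.2.1) (η q.1) q.2.2 : ℂ) :=
    Complex.measurable_ofReal.comp (hk.comp
      (f := fun q : Ω × (ℝ × ℝ) => (τ q.1 - q.2.1, η q.1, q.2.2)) (by fun_prop))
  exact h1.aestronglyMeasurable.mul ha.comp_snd

theorem aestronglyMeasurable_pot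
    (hk : Measurable fun q : ℝ × ℝ × ℝ => k q.1 q.2.1 q.2.2) (ha : AEStronglyMeasurable a ρ)
    (hτ : Measurable τ) (hη : Measurable η) :
    AEStronglyMeasurable (fun w => pot k ρ a (τ w) (η w)) m :=
  (aestronglyMeasurable_kernel_mul (m := m) hk ha hτ hη).integral_prod_right'

theorem aemeasurable_potMaj (ν : ℝ) (ha : AEStronglyMeasurable a ρ)
    (hτ : Measurable τ) (hη : Measurable η) :
    AEMeasurable (fun w => potMaj ν ρ a (τ w) (η w)) m := by
  have h1 : Measurable fun q : Ω × (ℝ × ℝ) =>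
      tpow (1 / 2) (τ q.1 - q.2.1) * eheat ν (2 * (τ q.1 - q.2.1)) (η q.1 - q.2.2) :=
    ((measurable_tpow _).comp (by fun_prop)).mul ((measurable_eheat ν).comp
      (f := fun q : Ω × (ℝ × ℝ) => (2 * (τ q.1 - q.2.1), η q.1 - q.2.2)) (by fun_prop))
  have h2 : AEMeasurable (fun q : Ω × (ℝ × ℝ) =>
      tpow (1 / 2) (τ q.1 - q.2.1) * eheat ν (2 * (τ q.1 - q.2.1)) (η q.1 - q.2.2) * ‖a q.2‖ₑ)
      (m.prod ρ) := h1.aemeasurable.mul ha.enorm.comp_snd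
  exact h2.lintegral_prod_right'

/-- Moves a pairing from the potential onto the kernel, so that facts about point sources transfer
to any source. The parameter space is the half-line at fixed time, the time axis at fixed height, or
space-time, according to the choice of `τ` and `η`. -/
theorem pot_fubini
    (hk : Measurable fun q : ℝ × ℝ × ℝ => k q.1 q.2.1 q.2.2) (ha : AEStronglyMeasurable a ρ)
    (hτ : Measurable τ) (hη : Measurable η) {ψ : Ω → ℂ} (hψ : AEStronglyMeasurable ψ m)
    (hfin : ∫⁻ w, (∫⁻ p, ‖k (τ w - p.1) (η w) p.2‖ₑ * ‖a p‖ₑ ∂ρ) * ‖ψ w‖ₑ ∂m < ⊤) :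
    Integrable (fun w => pot k ρ a (τ w) (η w) * ψ w) m ∧
    Integrable (fun p => a p * ∫ w, (k (τ w - p.1) (η w) p.2 : ℂ) * ψ w ∂m) ρ ∧
    ∫ w, pot k ρ a (τ w) (η w) * ψ w ∂m =
      ∫ p, a p * ∫ w, (k (τ w - p.1) (η w) p.2 : ℂ) * ψ w ∂m ∂ρ := by
  set F : Ω × (ℝ × ℝ) → ℂ := fun q => (k (τ q.1 - q.2.1) (η q.1) q.2.2 : ℂ) * a q.2 * ψ q.1
  have hF : Integrable F (m.prod ρ) := by
    have hm : AEStronglyMeasurable F (m.prod ρ) :=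
      (aestronglyMeasurable_kernel_mul hk ha hτ hη).mul hψ.comp_fst
    refine ⟨hm, ?_⟩
    rw [HasFiniteIntegral, lintegral_prod _ hm.enorm]
    refine lt_of_le_of_lt (le_of_eq (lintegral_congr fun w => ?_)) hfin
    simp only [F, enorm_mul, enorm_complex_ofReal]
    rw [lintegral_mul_const' _ _ enorm_ne_top]
  have e1 : ∀ w, ∫ p, F (w, p) ∂ρ = pot k ρ a (τ w) (η w) * ψ w := fun w =>
    integral_mul_const (ψ w) fun p : ℝ × ℝ => (k (τ w - p.1) (η w) p.2 : ℂ) * a p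
  have e2 : ∀ p, ∫ w, F (w, p) ∂m = a p * ∫ w, (k (τ w - p.1) (η w) p.2 : ℂ) * ψ w ∂m := by
    intro p
    rw [← integral_const_mul]
    congr 1 with w
    simp only [F]; ring
  refine ⟨?_, ?_, ?_⟩
  · simpa only [e1] using hF.integral_prod_left
  · simpa only [e2] using hF.integral_prod_right
  · simp_rw [← e1, ← e2]
    exact integral_integral_swap hF

end Fubini

/-- Decay like `exp (-z)` is the common class for test functions and for backward kernels: it
contains both compactly supported functions and Gaussian tails, and pairs with `L²`. Here `exp (-2z)
≤ exp (-z)`, which has integral one. -/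
theorem eLpNorm_exp_neg_le (B : ℝ≥0∞) {f : ℝ → ℂ}
    (h : ∀ z, 0 < z → ‖f z‖ₑ ≤ B * ENNReal.ofReal (Real.exp (-z))) :
    eLpNorm f 2 halfLine ≤ B := by
  refine (ENNReal.pow_le_pow_left_iff (two_ne_zero)).1 ?_
  rw [eLpNorm_two_sq]
  calc ∫⁻ z in Ioi (0 : ℝ), ‖f z‖ₑ ^ 2
      ≤ ∫⁻ z in Ioi (0 : ℝ), B ^ 2 * ENNReal.ofReal (Real.exp (-z)) := by
        refine setLIntegral_mono' measurableSet_Ioi fun z hz => ?_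
        calc ‖f z‖ₑ ^ 2 ≤ (B * ENNReal.ofReal (Real.exp (-z))) ^ 2 := by gcongr; exact h z hz
          _ = B ^ 2 * (ENNReal.ofReal (Real.exp (-z)) * ENNReal.ofReal (Real.exp (-z))) := by ring
          _ ≤ B ^ 2 * (1 * ENNReal.ofReal (Real.exp (-z))) := by
            gcongr
            simpa using (mem_Ioi.1 hz).le
          _ = _ := by rw [one_mul]
    _ = B ^ 2 * ∫⁻ z in Ioi (0 : ℝ), ENNReal.ofReal (Real.exp (-z)) :=
        lintegral_const_mul _ (by fun_prop)
    _ = B ^ 2 := by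
        rw [← ofReal_integral_eq_lintegral_ofReal
          (integrableOn_exp_neg_Ioi 0)
          (ae_of_all _ fun _ => (Real.exp_pos _).le)]
        rw [integral_exp_neg_Ioi_zero]
        simp

/-- Pairing of `L¹(0, T; L²)` functions with exponentially decaying functions. -/
theorem lintegral_mul_lt_top {T : ℝ} {F : ℝ → ℝ → ℝ≥0∞} {ψ : ℝ × ℝ → ℂ} {B : ℝ≥0∞} (hB : B ≠ ⊤)
    (hF : AEMeasurable (Function.uncurry F) ((timeInterval T).prod halfLine))
    (hFn : ∫⁻ t in Ioo (0 : ℝ) T, eLpNorm (F t) 2 halfLine < ⊤)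
    (hψ : AEStronglyMeasurable ψ ((timeInterval T).prod halfLine))
    (hb : ∀ t ∈ Ioo 0 T, ∀ z, 0 < z → ‖ψ (t, z)‖ₑ ≤ B * ENNReal.ofReal (Real.exp (-z))) :
    ∫⁻ q, F q.1 q.2 * ‖ψ q‖ₑ ∂(timeInterval T).prod halfLine < ⊤ := by
  rw [lintegral_prod (fun q => F q.1 q.2 * ‖ψ q‖ₑ) (hF.mul hψ.enorm)]
  refine lt_of_le_of_lt ?_ (ENNReal.mul_lt_top hFn hB.lt_top)
  rw [← lintegral_mul_const' _ _ hB]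
  have h1 := hF.aestronglyMeasurable.prodMk_left
  have h2 := hψ.prodMk_left
  refine lintegral_mono_ae ?_
  filter_upwards [h1, h2, ae_restrict_mem measurableSet_Ioo] with t ht1 ht2 ht
  refine (lintegral_mul_le_eLpNorm ht1.aemeasurable ht2.enorm).trans ?_
  gcongr
  · exact le_rfl
  · rw [show (fun y => ‖ψ (t, y)‖ₑ) = fun y => ‖(fun y => ψ (t, y)) y‖ₑ from rfl, eLpNorm_enorm]
    exact eLpNorm_exp_neg_le B (hb t ht)

theorem MemLOneH1.integrable_mul {T : ℝ} {u u' : ℝ → ℝ → ℂ} {c : ℝ → ℂ} (h : MemLOneH1 T u u' c)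
    {ψ : ℝ × ℝ → ℂ} {B : ℝ≥0∞} (hB : B ≠ ⊤)
    (hψ : AEStronglyMeasurable ψ ((timeInterval T).prod halfLine))
    (hb : ∀ t ∈ Ioo 0 T, ∀ z, 0 < z → ‖ψ (t, z)‖ₑ ≤ B * ENNReal.ofReal (Real.exp (-z))) :
    Integrable (fun q => u q.1 q.2 * ψ q) ((timeInterval T).prod halfLine) ∧
    Integrable (fun q => u' q.1 q.2 * ψ q) ((timeInterval T).prod halfLine) := by
  refine ⟨⟨h.meas.mul hψ, ?_⟩, ⟨h.meas_deriv.mul hψ, ?_⟩⟩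
  · simp only [HasFiniteIntegral, enorm_mul]
    refine lintegral_mul_lt_top (F := fun t z => ‖u t z‖ₑ) hB h.meas.enorm ?_ hψ hb
    simpa only [eLpNorm_enorm] using h.norm_lt_top
  · simp only [HasFiniteIntegral, enorm_mul]
    refine lintegral_mul_lt_top (F := fun t z => ‖u' t z‖ₑ) hB h.meas_deriv.enorm ?_ hψ hb
    simpa only [eLpNorm_enorm] using h.norm_deriv_lt_top

theorem exists_exp_bound {f : ℝ → ℂ} (hf : Continuous f) (hc : HasCompactSupport f) :
    ∃ B : ℝ≥0∞, B ≠ ⊤ ∧ ∀ z, ‖f z‖ₑ ≤ B * ENNReal.ofReal (Real.exp (-z)) := by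
  have hc2 : HasCompactSupport fun z => f z * Real.exp z := hc.mul_right
  obtain ⟨C, hC⟩ := hc2.exists_bound_of_continuous (by fun_prop)
  refine ⟨ENNReal.ofReal C, ENNReal.ofReal_ne_top, fun z => ?_⟩
  rw [← ofReal_norm, ← ENNReal.ofReal_mul' (Real.exp_pos _).le]
  refine ENNReal.ofReal_le_ofReal ?_
  have := hC z
  rw [norm_mul, Complex.norm_real, Real.norm_eq_abs, Real.abs_exp] at this
  rw [Real.exp_neg, ← div_eq_mul_inv, le_div_iff₀ (Real.exp_pos _)]
  exact this

theorem exists_exp_bound₂ {f : ℝ × ℝ → ℂ} (hf : Continuous f) (hc : HasCompactSupport f) :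
    ∃ B : ℝ≥0∞, B ≠ ⊤ ∧ ∀ t z, ‖f (t, z)‖ₑ ≤ B * ENNReal.ofReal (Real.exp (-z)) := by
  have hc2 : HasCompactSupport fun q : ℝ × ℝ => f q * Real.exp q.2 := hc.mul_right
  obtain ⟨C, hC⟩ := hc2.exists_bound_of_continuous (by fun_prop)
  refine ⟨ENNReal.ofReal C, ENNReal.ofReal_ne_top, fun t z => ?_⟩
  rw [← ofReal_norm, ← ENNReal.ofReal_mul' (Real.exp_pos _).le]
  refine ENNReal.ofReal_le_ofReal ?_
  have := hC (t, z)
  rw [norm_mul, Complex.norm_real, Real.norm_eq_abs, Real.abs_exp] at this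
  rw [Real.exp_neg, ← div_eq_mul_inv, le_div_iff₀ (Real.exp_pos _)]
  exact this

/-! ### Potentials of sources belong to `L¹(0, T; H¹)` -/

section Source

variable {ν d β σ T : ℝ} {ρ : Measure (ℝ × ℝ)} [SFinite ρ] {a : ℝ × ℝ → ℂ}

theorem exists_lintegral_kern_le (hν : 0 < ν) (hd : 0 ≤ d) (hβ : 0 ≤ β) (hσ : |σ| ≤ 1)
    (hT : 0 < T) (hs : ∀ᵐ p ∂ρ, 0 ≤ p.1 ∧ p.1 < T ∧ 0 ≤ p.2) :
    ∃ C : ℝ≥0∞, C ≠ ⊤ ∧ ∀ t ≤ T, ∀ y, 0 ≤ y →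
      ∫⁻ p, ‖kern ν d β σ (t - p.1) y p.2‖ₑ * ‖a p‖ₑ ∂ρ ≤ C * potMajZero ν ρ a t y ∧
      ∫⁻ p, ‖kern ν d β σ (t - p.1) y p.2‖ₑ * ‖a p‖ₑ ∂ρ ≤ C * potMaj ν ρ a t y ∧
      ∫⁻ p, ‖kernDy ν d β σ (t - p.1) y p.2‖ₑ * ‖a p‖ₑ ∂ρ ≤ C * potMaj ν ρ a t y := by
  obtain ⟨C, hC, h⟩ := exists_kern_enorm_le (d := d) (β := β) (σ := σ) hν hd hβ hσ hT
  refine ⟨C, hC, fun t ht y hy => ?_⟩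
  rw [potMajZero, potMaj, ← lintegral_const_mul' _ _ hC, ← lintegral_const_mul' _ _ hC]
  refine ⟨lintegral_mono_ae ?_, lintegral_mono_ae ?_, lintegral_mono_ae ?_⟩
  all_goals
    filter_upwards [hs] with p hp
    obtain ⟨h1, h2, h3⟩ := h (t - p.1) (by linarith [hp.1]) y hy p.2 hp.2.2
    rw [← mul_assoc]
    gcongr

theorem enorm_pot_le (k : ℝ → ℝ → ℝ → ℝ) (t y : ℝ) :
    ‖pot k ρ a t y‖ₑ ≤ ∫⁻ p, ‖k (t - p.1) y p.2‖ₑ * ‖a p‖ₑ ∂ρ := by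
  refine (enorm_integral_le_lintegral_enorm _).trans (le_of_eq ?_)
  simp only [enorm_mul, enorm_complex_ofReal]

theorem exists_enorm_pot_le (hν : 0 < ν) (hd : 0 ≤ d) (hβ : 0 ≤ β) (hσ : |σ| ≤ 1)
    (hT : 0 < T) (hs : ∀ᵐ p ∂ρ, 0 ≤ p.1 ∧ p.1 < T ∧ 0 ≤ p.2) :
    ∃ C : ℝ≥0∞, C ≠ ⊤ ∧ ∀ t ≤ T, ∀ y, 0 ≤ y →
      ‖pot (kern ν d β σ) ρ a t y‖ₑ ≤ C * potMajZero ν ρ a t y ∧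
      ‖pot (kern ν d β σ) ρ a t y‖ₑ ≤ C * potMaj ν ρ a t y ∧
      ‖pot (kernDy ν d β σ) ρ a t y‖ₑ ≤ C * potMaj ν ρ a t y := by
  obtain ⟨C, hC, h⟩ := exists_lintegral_kern_le (a := a) (d := d) (β := β) (σ := σ) hν hd hβ hσ hT hs
  refine ⟨C, hC, fun t ht y hy => ?_⟩
  obtain ⟨h1, h2, h3⟩ := h t ht y hy
  exact ⟨(enorm_pot_le _ t y).trans h1, (enorm_pot_le _ t y).trans h2, (enorm_pot_le _ t y).trans h3⟩

theorem eLpNorm_le_mul_of_enorm_le {f : ℝ → ℂ} {F : ℝ → ℝ≥0∞} {C : ℝ≥0∞} (hC : C ≠ ⊤)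
    (h : ∀ y, 0 < y → ‖f y‖ₑ ≤ C * F y) :
    eLpNorm f 2 halfLine ≤ C * eLpNorm F 2 halfLine := by
  refine (ENNReal.pow_le_pow_left_iff (two_ne_zero)).1 ?_
  rw [mul_pow, eLpNorm_two_sq, eLpNorm_two_sq, ← lintegral_const_mul' _ _ (ENNReal.pow_ne_top hC)]
  refine setLIntegral_mono' measurableSet_Ioi fun y hy => ?_
  rw [enorm_eq_self, ← mul_pow]
  gcongr
  exact h y hy

theorem kern_integral_by_parts (hν : 0 < ν) (t z : ℝ) {φ : ℝ → ℂ} (hφ : ContDiff ℝ ∞ φ)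
    (hc : HasCompactSupport φ) :
    ∫ y in Ioi (0 : ℝ), (kern ν d β σ t y z : ℂ) * deriv φ y =
      -(kern ν d β σ t 0 z * φ 0) - ∫ y in Ioi (0 : ℝ), (kernDy ν d β σ t y z : ℂ) * φ y := by
  rcases le_or_gt t 0 with ht | ht
  · simp [kern_of_nonpos hν ht, kernDy_of_nonpos hν ht]
  have hd : ∀ y, HasDerivAt (fun y => (kern ν d β σ t y z : ℂ)) (kernDy ν d β σ t y z : ℂ) y :=
    fun y => (hasDerivAt_kern hν ht d β σ y z).ofReal_comp
  have hφd : ∀ y, HasDerivAt φ (deriv φ y) y := fun y =>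
    ((hφ.differentiable (by simp)) y).hasDerivAt
  have hk : Continuous fun y => (kern ν d β σ t y z : ℂ) :=
    continuous_iff_continuousAt.2 fun y => (hd y).continuousAt
  have hk' : Continuous fun y => (kernDy ν d β σ t y z : ℂ) :=
    continuous_iff_continuousAt.2 fun y =>
      ((hasDerivAt_kernDy hν ht d β σ y z).ofReal_comp).continuousAt
  have hφ' : Continuous (deriv φ) := hφ.continuous_deriv (by simp)
  have i1 : Integrable fun y => (kern ν d β σ t y z : ℂ) * deriv φ y :=
    (hk.mul hφ').integrable_of_hasCompactSupport hc.deriv.mul_left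
  have i2 : Integrable fun y => (kernDy ν d β σ t y z : ℂ) * φ y :=
    (hk'.mul hφ.continuous).integrable_of_hasCompactSupport hc.mul_left
  have := integral_Ioi_of_hasDerivAt_of_tendsto (a := (0 : ℝ)) (m := (0 : ℂ))
    (f := fun y => (kern ν d β σ t y z : ℂ) * φ y)
    ((hk.mul hφ.continuous).continuousWithinAt) (fun y _ => (hd y).mul (hφd y))
    (i2.add i1).integrableOn ?_
  · rw [integral_add i2.integrableOn i1.integrableOn] at this
    linear_combination this
  · have h0 : HasCompactSupport fun y => (kern ν d β σ t y z : ℂ) * φ y := hc.mul_left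
    exact h0.is_zero_at_infty.mono_left atTop_le_cocompact

/-- Integration by parts holds for each kernel section, and Fubini carries it to the potential. The
boundary terms integrate to the potential at `0`, which is therefore the trace. -/
theorem IsSource.isH1_pot (hν : 0 < ν) (hd : 0 ≤ d) (hβ : 0 ≤ β) (hσ : |σ| ≤ 1)
    (hT : 0 < T) (h : IsSource ν T ρ a) {t : ℝ} (ht : t ≤ T)
    (h1 : eLpNorm (potMaj ν ρ a t) 2 halfLine < ⊤) :
    IsH1 (pot (kern ν d β σ) ρ a t) (pot (kernDy ν d β σ) ρ a t) (pot (kern ν d β σ) ρ a t 0) := by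
  obtain ⟨C, hC, hle⟩ := exists_lintegral_kern_le (a := a) (d := d) (β := β) (σ := σ)
    hν hd hβ hσ hT h.supp
  have hmk := measurable_kern hν d β σ
  have hmk' := measurable_kernDy hν d β σ
  have hmaj : AEMeasurable (potMaj ν ρ a t) halfLine :=
    aemeasurable_potMaj (m := halfLine) (τ := fun _ => t) (η := fun y => y) ν h.meas
      measurable_const measurable_id
  refine ⟨⟨aestronglyMeasurable_pot (m := halfLine) (τ := fun _ => t) (η := fun y => y) hmk h.meas
      measurable_const measurable_id, ?_⟩,
    ⟨aestronglyMeasurable_pot (m := halfLine) (τ := fun _ => t) (η := fun y => y) hmk' h.meas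
      measurable_const measurable_id, ?_⟩, ?_⟩
  · exact (eLpNorm_le_mul_of_enorm_le hC fun y hy =>
      (enorm_pot_le _ t y).trans (hle t ht y hy.le).2.1).trans_lt (ENNReal.mul_lt_top hC.lt_top h1)
  · exact (eLpNorm_le_mul_of_enorm_le hC fun y hy =>
      (enorm_pot_le _ t y).trans (hle t ht y hy.le).2.2).trans_lt (ENNReal.mul_lt_top hC.lt_top h1)
  intro φ hφ hc
  have hφ' : Continuous (deriv φ) := hφ.continuous_deriv (by simp)
  have hfin : ∀ (k : ℝ → ℝ → ℝ → ℝ) (ψ : ℝ → ℂ), Continuous ψ → HasCompactSupport ψ →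
      (∀ y, 0 ≤ y → ∫⁻ p, ‖k (t - p.1) y p.2‖ₑ * ‖a p‖ₑ ∂ρ ≤ C * potMaj ν ρ a t y) →
      ∫⁻ y, (∫⁻ p, ‖k (t - p.1) y p.2‖ₑ * ‖a p‖ₑ ∂ρ) * ‖ψ y‖ₑ ∂halfLine < ⊤ := by
    intro k ψ hψ hψc hk
    obtain ⟨B, hB, hb⟩ := exists_exp_bound hψ hψc
    calc _ ≤ ∫⁻ y, C * (potMaj ν ρ a t y * ‖ψ y‖ₑ) ∂halfLine := by
          refine setLIntegral_mono' measurableSet_Ioi fun y hy => ?_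
          rw [← mul_assoc]
          gcongr
          exact hk y (mem_Ioi.1 hy).le
      _ = C * ∫⁻ y, potMaj ν ρ a t y * ‖ψ y‖ₑ ∂halfLine := lintegral_const_mul' _ _ hC
      _ ≤ C * (eLpNorm (potMaj ν ρ a t) 2 halfLine * B) := by
          gcongr
          refine (lintegral_mul_le_eLpNorm hmaj hψ.aestronglyMeasurable.enorm).trans ?_
          gcongr
          rw [eLpNorm_enorm]
          exact eLpNorm_exp_neg_le B fun z _ => hb z
      _ < ⊤ := ENNReal.mul_lt_top hC.lt_top (ENNReal.mul_lt_top h1 hB.lt_top)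
  obtain ⟨-, i1, e1⟩ := pot_fubini (m := halfLine) (τ := fun _ => t) (η := fun y => y) hmk h.meas
    measurable_const measurable_id hφ'.aestronglyMeasurable
    (hfin _ _ hφ' hc.deriv fun y hy => (hle t ht y hy).2.1)
  obtain ⟨-, i2, e2⟩ := pot_fubini (m := halfLine) (τ := fun _ => t) (η := fun y => y) hmk' h.meas
    measurable_const measurable_id hφ.continuous.aestronglyMeasurable
    (hfin _ _ hφ.continuous hc fun y hy => (hle t ht y hy).2.2)
  rw [e1, e2]
  simp_rw [kern_integral_by_parts hν _ _ hφ hc] at i1 ⊢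
  rw [eq_sub_iff_add_eq, ← integral_add i1 i2, pot, ← integral_mul_const, ← integral_neg]
  congr 1 with p
  ring

theorem IsSource.memLOneH1 (hν : 0 < ν) (hd : 0 ≤ d) (hβ : 0 ≤ β) (hσ : |σ| ≤ 1)
    (hT : 0 < T) (h : IsSource ν T ρ a) :
    MemLOneH1 T (pot (kern ν d β σ) ρ a) (pot (kernDy ν d β σ) ρ a)
      (fun t => pot (kern ν d β σ) ρ a t 0) := by
  obtain ⟨C, hC, hle⟩ := exists_enorm_pot_le (a := a) (d := d) (β := β) (σ := σ)
    hν hd hβ hσ hT h.supp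
  have hm1 : AEMeasurable (fun t => eLpNorm (potMaj ν ρ a t) 2 halfLine) (timeInterval T) := by
    simp_rw [eLpNorm_eq_lintegral_rpow_enorm_toReal (two_ne_zero : (2 : ℝ≥0∞) ≠ 0)
      (ENNReal.ofNat_ne_top : (2 : ℝ≥0∞) ≠ ⊤)]
    simp only [enorm_eq_self]
    refine AEMeasurable.pow_const (AEMeasurable.lintegral_prod_right
      (f := fun t y => potMaj ν ρ a t y ^ _) ?_) _
    exact (aemeasurable_potMaj ν h.meas measurable_fst measurable_snd).pow_const _
  refine ⟨aestronglyMeasurable_pot (measurable_kern hν d β σ) h.meas measurable_fst measurable_snd,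
    aestronglyMeasurable_pot (measurable_kernDy hν d β σ) h.meas measurable_fst measurable_snd,
    ?_, ?_, ?_⟩
  · filter_upwards [ae_lt_top' hm1 h.norm_lt_top.ne, ae_restrict_mem measurableSet_Ioo] with t h1 ht
    exact h.isH1_pot hν hd hβ hσ hT ht.2.le h1
  · refine lt_of_le_of_lt ?_ (ENNReal.mul_lt_top hC.lt_top h.norm_lt_top)
    rw [← lintegral_const_mul' _ _ hC]
    exact setLIntegral_mono' measurableSet_Ioo fun t ht =>
      eLpNorm_le_mul_of_enorm_le hC fun y hy => (hle t ht.2.le y hy.le).2.1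
  · refine lt_of_le_of_lt ?_ (ENNReal.mul_lt_top hC.lt_top h.norm_lt_top)
    rw [← lintegral_const_mul' _ _ hC]
    exact setLIntegral_mono' measurableSet_Ioo fun t ht =>
      eLpNorm_le_mul_of_enorm_le hC fun y hy => (hle t ht.2.le y hy.le).2.2

end Source

/-! ### The kernel as an approximate identity -/

theorem sqrt_mul_heat {ν t : ℝ} (hν : 0 < ν) (ht : 0 < t) (w : ℝ) :
    Real.sqrt t * heat ν t (Real.sqrt t * w) = heat ν 1 w := by
  have hs : 0 < Real.sqrt t := Real.sqrt_pos.2 ht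
  have h2 : Real.sqrt t ^ 2 = t := Real.sq_sqrt ht.le
  rw [heat, heat, Real.sqrt_mul (by positivity) t, mul_pow, h2]
  rw [show t * w ^ 2 / (4 * ν * t) = w ^ 2 / (4 * ν * 1) by field_simp, mul_one]
  field_simp

/-- Substituting `y = z + √ε w` turns the kernel into the fixed Gaussian at time one, and dominated
convergence applies. The integrand may depend on `ε` because test functions are evaluated at a
moving time. -/
theorem tendsto_integral_heat {ν : ℝ} (hν : 0 < ν) {Φ : ℝ × ℝ → ℂ} (hΦ : Continuous Φ) {B : ℝ}
    (hB : ∀ q, ‖Φ q‖ ≤ B) (z : ℝ) :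
    Tendsto (fun ε => ∫ y, (heat ν ε (y - z) : ℂ) * Φ (ε, y)) (𝓝[>] 0) (𝓝 (Φ (0, z))) := by
  have h1 : ∀ ε, 0 < ε → ∫ y, (heat ν ε (y - z) : ℂ) * Φ (ε, y) =
      ∫ w, (heat ν 1 w : ℂ) * Φ (ε, z + Real.sqrt ε * w) := by
    intro ε hε
    have hs : 0 < Real.sqrt ε := Real.sqrt_pos.2 hε
    rw [← integral_add_left_eq_self _ z]
    have := Measure.integral_comp_mul_left
      (fun x => (heat ν ε (z + x - z) : ℂ) * Φ (ε, z + x)) (Real.sqrt ε)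
    rw [abs_of_pos (by positivity)] at this
    have h3 : (∫ x, (heat ν ε (z + x - z) : ℂ) * Φ (ε, z + x)) =
        Real.sqrt ε • ∫ x, (heat ν ε (z + Real.sqrt ε * x - z) : ℂ) * Φ (ε, z + Real.sqrt ε * x) := by
      rw [this, smul_smul, mul_inv_cancel₀ hs.ne', one_smul]
    rw [h3, ← integral_smul]
    congr 1 with w
    rw [add_sub_cancel_left, ← sqrt_mul_heat hν hε w, Complex.real_smul]
    push_cast
    ring
  have h2 : (∫ w, (heat ν 1 w : ℂ) * Φ (0, z)) = Φ (0, z) := by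
    rw [integral_mul_const, integral_complex_ofReal, integral_heat hν one_pos]
    simp
  rw [← h2]
  refine Tendsto.congr' (f₁ := fun ε => ∫ w, (heat ν 1 w : ℂ) * Φ (ε, z + Real.sqrt ε * w)) ?_ ?_
  · filter_upwards [self_mem_nhdsWithin] with ε hε
    exact (h1 ε hε).symm
  have hi := integrable_heat hν one_pos
  refine tendsto_integral_filter_of_dominated_convergence (fun w => heat ν 1 w * B) ?_ ?_
    (hi.mul_const B) ?_
  · refine Eventually.of_forall fun ε => ?_
    refine (Complex.continuous_ofReal.comp_aestronglyMeasurable hi.1).mul ?_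
    exact Continuous.aestronglyMeasurable (by fun_prop)
  · refine Eventually.of_forall fun ε => ae_of_all _ fun w => ?_
    rw [norm_mul, Complex.norm_real, Real.norm_of_nonneg (heat_nonneg _ _ _)]
    exact mul_le_mul_of_nonneg_left (hB _) (heat_nonneg _ _ _)
  · refine ae_of_all _ fun w => Tendsto.mul tendsto_const_nhds ?_
    refine Tendsto.mono_left ?_ nhdsWithin_le_nhds
    have : Continuous fun ε => Φ (ε, z + Real.sqrt ε * w) := by fun_prop
    simpa using this.tendsto 0

/-- Method of images: the half-line integral against the two Gaussians is a whole-line integral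
against the even or odd extension. The Robin correction contributes `O(√ε)`, and the damping factor
tends to one. -/
theorem tendsto_integral_kern {ν d β σ : ℝ} (hν : 0 < ν) (hβ : 0 ≤ β) {Φ : ℝ × ℝ → ℂ}
    (hΦ : Continuous Φ) {B : ℝ} (hB : ∀ q, ‖Φ q‖ ≤ B)
    (hσ : σ = 1 ∨ σ = -1 ∧ ∀ ε, Φ (ε, 0) = 0) {z : ℝ} (hz : 0 ≤ z) :
    Tendsto (fun ε => ∫ y in Ioi (0 : ℝ), (kern ν d β σ ε y z : ℂ) * Φ (ε, y)) (𝓝[>] 0)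
      (𝓝 (Φ (0, z))) := by
  have hB0 : 0 ≤ B := (norm_nonneg _).trans (hB 0)
  have hσ1 : |σ| = 1 := by rcases hσ with h | ⟨h, -⟩ <;> simp [h]
  -- The extension by `σ` is continuous across `0`: trivially when even, and when odd because the
  -- function vanishes on the boundary.
  set Ψ : ℝ × ℝ → ℂ := fun q => if 0 ≤ q.2 then Φ q else σ * Φ (q.1, -q.2) with hΨ
  have hΨc : Continuous Ψ := by
    refine Continuous.if_le hΦ (by fun_prop) continuous_const continuous_snd ?_
    rintro ⟨ε, y⟩ hy
    simp only at hy
    subst hy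
    rcases hσ with h | ⟨h, h0⟩
    · simp [h]
    · simp [h0]
  have hΨB : ∀ q, ‖Ψ q‖ ≤ B := by
    intro q
    simp only [hΨ]
    split_ifs
    · exact hB q
    · rw [norm_mul, Complex.norm_real, Real.norm_eq_abs, hσ1, one_mul]; exact hB _
  have hint : ∀ ε, 0 < ε → ∀ (x : ℝ) (Θ : ℝ × ℝ → ℂ), Continuous Θ → (∀ q, ‖Θ q‖ ≤ B) →
      Integrable fun y => (heat ν ε (y - x) : ℂ) * Θ (ε, y) := by
    intro ε hε x Θ hΘ hΘB
    refine Integrable.mul_bdd (c := B) (((integrable_heat hν hε).comp_sub_right x).ofReal) ?_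
      (ae_of_all _ fun y => hΘB _)
    exact Continuous.aestronglyMeasurable (by fun_prop)
  have e1 : ∀ ε, 0 < ε → ∫ y, (heat ν ε (y - z) : ℂ) * Ψ (ε, y) =
      (∫ y in Ioi (0 : ℝ), (heat ν ε (y - z) : ℂ) * Φ (ε, y)) +
        σ * ∫ y in Ioi (0 : ℝ), (heat ν ε (y + z) : ℂ) * Φ (ε, y) := by
    intro ε hε
    have hi := hint ε hε z Ψ hΨc hΨB
    rw [← intervalIntegral.integral_Iic_add_Ioi hi.integrableOn hi.integrableOn (b := 0), add_comm]
    congr 1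
    · refine setIntegral_congr_fun measurableSet_Ioi fun y hy => ?_
      simp [hΨ, (mem_Ioi.1 hy).le]
    · have hneg := integral_comp_neg_Ioi 0 fun y => (heat ν ε (y - z) : ℂ) * Ψ (ε, y)
      rw [neg_zero] at hneg
      rw [← hneg, ← integral_const_mul]
      refine setIntegral_congr_fun measurableSet_Ioi fun y hy => ?_
      have hy' : ¬ (0 : ℝ) ≤ -y := by simpa using hy
      simp only [hΨ, hy', if_false, neg_neg]
      rw [show -y - z = -(y + z) by ring, heat_neg]
      ring
  obtain ⟨R, hR, hRt⟩ := exists_robinTail_le hν hβ 1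
  have hheat_meas : ∀ ε, Measurable fun y => heat ν ε (y + z) := fun ε => by
    unfold heat; fun_prop
  have hrob : ∀ ε, 0 < ε → ε ≤ 1 → ∀ y ∈ Ioi (0 : ℝ), ‖(robinTail ν β ε (y + z) : ℂ) * Φ (ε, y)‖ ≤
      R * Real.sqrt ε * B * heat ν ε (y + z) := by
    intro ε hε hε1 y hy
    rw [norm_mul, Complex.norm_real, Real.norm_of_nonneg (robinTail_nonneg hβ _ _ _)]
    have h1 := hRt ε hε hε1 (y + z) (add_nonneg (mem_Ioi.1 hy).le hz)
    calc _ ≤ R * (Real.sqrt ε * heat ν ε (y + z)) * B := by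
          have := heat_nonneg ν ε (y + z)
          gcongr
          exact hB _
      _ = _ := by ring
  have hheat_int : ∀ ε, 0 < ε → Integrable fun y => heat ν ε (y + z) := fun ε hε =>
    (integrable_heat hν hε).comp_add_right z
  have hrob_int : ∀ ε, 0 < ε → ε ≤ 1 →
      IntegrableOn (fun y => (robinTail ν β ε (y + z) : ℂ) * Φ (ε, y)) (Ioi 0) := by
    intro ε hε hε1
    refine Integrable.mono' (((hheat_int ε hε).const_mul (R * Real.sqrt ε * B)).integrableOn) ?_
      ((ae_restrict_iff' measurableSet_Ioi).2 (ae_of_all _ (hrob ε hε hε1)))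
    refine Continuous.aestronglyMeasurable (Continuous.mul (Complex.continuous_ofReal.comp
      (continuous_iff_continuousAt.2 fun y =>
        ((hasDerivAt_robinTail hν hε β (y + z)).comp_add_const y z).continuousAt)) (by fun_prop))
  have hrob0 : Tendsto (fun ε => ∫ y in Ioi (0 : ℝ), (robinTail ν β ε (y + z) : ℂ) * Φ (ε, y))
      (𝓝[>] 0) (𝓝 0) := by
    refine squeeze_zero_norm' (a := fun ε => R * Real.sqrt ε * B) ?_ ?_
    · filter_upwards [Ioo_mem_nhdsGT (show (0 : ℝ) < 1 by norm_num)] with ε hε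
      have h3 : ∫ y in Ioi (0 : ℝ), heat ν ε (y + z) ≤ 1 := by
        refine (setIntegral_le_integral (hheat_int ε hε.1)
          (ae_of_all _ fun y => heat_nonneg _ _ _)).trans ?_
        rw [integral_add_right_eq_self (heat ν ε), integral_heat hν hε.1]
      calc _ ≤ ∫ y in Ioi (0 : ℝ), R * Real.sqrt ε * B * heat ν ε (y + z) :=
            norm_integral_le_of_norm_le ((hheat_int ε hε.1).const_mul _).integrableOn
              ((ae_restrict_iff' measurableSet_Ioi).2 (ae_of_all _ (hrob ε hε.1 hε.2.le)))
        _ ≤ _ := by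
            rw [integral_const_mul]
            exact mul_le_of_le_one_right (by positivity) h3
    · refine Tendsto.mono_left ?_ nhdsWithin_le_nhds
      have : Continuous fun ε => R * Real.sqrt ε * B := by fun_prop
      simpa using this.tendsto 0
  have hmain := (tendsto_integral_heat hν hΨc hΨB z).add hrob0
  have hexp : Tendsto (fun ε : ℝ => ((Real.exp (-(d * ε)) : ℝ) : ℂ)) (𝓝[>] 0) (𝓝 1) := by
    refine Tendsto.mono_left ?_ nhdsWithin_le_nhds
    have : Continuous fun ε : ℝ => ((Real.exp (-(d * ε)) : ℝ) : ℂ) := by fun_prop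
    simpa using this.tendsto 0
  have hfin := hexp.mul hmain
  have h0 : Ψ (0, z) = Φ (0, z) := by simp [hΨ, hz]
  rw [one_mul, add_zero, h0] at hfin
  refine Tendsto.congr' ?_ hfin
  filter_upwards [Ioo_mem_nhdsGT (show (0 : ℝ) < 1 by norm_num)] with ε hε
  rw [e1 ε hε.1, ← integral_const_mul, ← integral_add (hint ε hε.1 z Φ hΦ hB).integrableOn,
    ← integral_add _ (hrob_int ε hε.1 hε.2.le), ← integral_const_mul]
  · congr 1 with y
    simp only [kern]
    push_cast
    ring
  · refine ((hint ε hε.1 z Φ hΦ hB).integrableOn).add ?_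
    have := (hint ε hε.1 (-z) Φ hΦ hB).integrableOn (s := Ioi (0 : ℝ))
    simp only [sub_neg_eq_add] at this
    exact this.const_mul _
  · have := (hint ε hε.1 (-z) Φ hΦ hB).integrableOn (s := Ioi (0 : ℝ))
    simp only [sub_neg_eq_add] at this
    exact this.const_mul _

/-! ### Test functions and the weak form -/

/-- The time derivative of a function of time and space. -/
def testDt (φ : ℝ → ℝ → ℂ) (q : ℝ × ℝ) : ℂ := deriv (fun s => φ s q.2) q.1

/-- The space derivative of a function of time and space. -/
def testDz (φ : ℝ → ℝ → ℂ) (q : ℝ × ℝ) : ℂ := deriv (φ q.1) q.2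

/-- The bilinear form of the damped heat equation. -/
def heatForm (ν d T : ℝ) (u u' φ : ℝ → ℝ → ℂ) : ℂ :=
  -(∫ q, u q.1 q.2 * testDt φ q ∂(timeInterval T).prod halfLine) +
    ν * (∫ q, u' q.1 q.2 * testDz φ q ∂(timeInterval T).prod halfLine) +
    d * ∫ q, u q.1 q.2 * φ q.1 q.2 ∂(timeInterval T).prod halfLine

theorem integral_neg_add_add {α : Type*} [MeasurableSpace α] {μ : Measure α} {f₁ f₂ f₃ : α → ℂ}
    (h₁ : Integrable f₁ μ) (h₂ : Integrable f₂ μ) (h₃ : Integrable f₃ μ) (b c : ℂ) :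
    ∫ x, (-(f₁ x) + b * f₂ x + c * f₃ x) ∂μ =
      -(∫ x, f₁ x ∂μ) + b * (∫ x, f₂ x ∂μ) + c * ∫ x, f₃ x ∂μ := by
  have h := integral_add (h₁.neg.add (h₂.const_mul b)) (h₃.const_mul c)
  have h' := integral_add h₁.neg (h₂.const_mul b)
  simp only [Pi.add_apply, Pi.neg_apply] at h h'
  rw [h, h', integral_neg, integral_const_mul, integral_const_mul]

theorem integral_neg_add_add_sub {α : Type*} [MeasurableSpace α] {μ : Measure α}
    {f₁ f₂ f₃ f₄ : α → ℂ} (h₁ : Integrable f₁ μ) (h₂ : Integrable f₂ μ) (h₃ : Integrable f₃ μ)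
    (h₄ : Integrable f₄ μ) (b c e : ℂ) :
    ∫ x, (-(f₁ x) + b * f₂ x + c * f₃ x - e * f₄ x) ∂μ =
      -(∫ x, f₁ x ∂μ) + b * (∫ x, f₂ x ∂μ) + c * (∫ x, f₃ x ∂μ) - e * ∫ x, f₄ x ∂μ := by
  have h := integral_sub ((h₁.neg.add (h₂.const_mul b)).add (h₃.const_mul c)) (h₄.const_mul e)
  simp only [Pi.add_apply, Pi.neg_apply] at h
  rw [h, integral_neg_add_add h₁ h₂ h₃, integral_const_mul]

section Test

variable {φ : ℝ → ℝ → ℂ}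

theorem hasDerivAt_fst_of_differentiableAt {φ : ℝ → ℝ → ℂ} {t y : ℝ}
    (h : DifferentiableAt ℝ (Function.uncurry φ) (t, y)) :
    HasDerivAt (fun s => φ s y) (fderiv ℝ (Function.uncurry φ) (t, y) (1, 0)) t :=
  h.hasFDerivAt.comp_hasDerivAt t (f := fun s => (s, y))
    ((hasDerivAt_id t).prodMk (hasDerivAt_const t y))

theorem hasDerivAt_snd_of_differentiableAt {φ : ℝ → ℝ → ℂ} {t y : ℝ}
    (h : DifferentiableAt ℝ (Function.uncurry φ) (t, y)) :
    HasDerivAt (φ t) (fderiv ℝ (Function.uncurry φ) (t, y) (0, 1)) y :=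
  h.hasFDerivAt.comp_hasDerivAt y (f := fun x => (t, x))
    ((hasDerivAt_const y t).prodMk (hasDerivAt_id y))

theorem testDt_eq (h : ContDiff ℝ ∞ (Function.uncurry φ)) (q : ℝ × ℝ) :
    testDt φ q = fderiv ℝ (Function.uncurry φ) q (1, 0) :=
  (hasDerivAt_fst_of_differentiableAt (h.differentiable (by simp) q)).deriv

theorem testDz_eq (h : ContDiff ℝ ∞ (Function.uncurry φ)) (q : ℝ × ℝ) :
    testDz φ q = fderiv ℝ (Function.uncurry φ) q (0, 1) :=
  (hasDerivAt_snd_of_differentiableAt (h.differentiable (by simp) q)).deriv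

theorem hasDerivAt_testDt (h : ContDiff ℝ ∞ (Function.uncurry φ)) (t y : ℝ) :
    HasDerivAt (fun s => φ s y) (testDt φ (t, y)) t := by
  rw [testDt_eq h]
  exact hasDerivAt_fst_of_differentiableAt (h.differentiable (by simp) (t, y))

theorem hasDerivAt_testDz (h : ContDiff ℝ ∞ (Function.uncurry φ)) (t y : ℝ) :
    HasDerivAt (φ t) (testDz φ (t, y)) y := by
  rw [testDz_eq h]
  exact hasDerivAt_snd_of_differentiableAt (h.differentiable (by simp) (t, y))

theorem continuous_testDt (h : ContDiff ℝ ∞ (Function.uncurry φ)) : Continuous (testDt φ) := by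
  rw [funext (testDt_eq h)]
  exact (h.continuous_fderiv (by simp)).clm_apply continuous_const

theorem continuous_testDz (h : ContDiff ℝ ∞ (Function.uncurry φ)) : Continuous (testDz φ) := by
  rw [funext (testDz_eq h)]
  exact (h.continuous_fderiv (by simp)).clm_apply continuous_const

theorem testDt_eq_zero (h : ContDiff ℝ ∞ (Function.uncurry φ)) {q : ℝ × ℝ}
    (hq : q ∉ tsupport (Function.uncurry φ)) : testDt φ q = 0 := by
  rw [testDt_eq h, fderiv_of_notMem_tsupport ℝ hq]; rfl

theorem testDz_eq_zero (h : ContDiff ℝ ∞ (Function.uncurry φ)) {q : ℝ × ℝ}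
    (hq : q ∉ tsupport (Function.uncurry φ)) : testDz φ q = 0 := by
  rw [testDz_eq h, fderiv_of_notMem_tsupport ℝ hq]; rfl

theorem hasCompactSupport_testDt (h : ContDiff ℝ ∞ (Function.uncurry φ))
    (hc : HasCompactSupport (Function.uncurry φ)) : HasCompactSupport (testDt φ) :=
  HasCompactSupport.intro hc fun _ hq => testDt_eq_zero h hq

theorem hasCompactSupport_testDz (h : ContDiff ℝ ∞ (Function.uncurry φ))
    (hc : HasCompactSupport (Function.uncurry φ)) : HasCompactSupport (testDz φ) :=
  HasCompactSupport.intro hc fun _ hq => testDz_eq_zero h hq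

theorem MemLOneH1.integrable_test {T : ℝ} {u u' : ℝ → ℝ → ℂ} {c : ℝ → ℂ}
    (h : MemLOneH1 T u u' c) {ψ : ℝ × ℝ → ℂ} (hψ : Continuous ψ) (hc : HasCompactSupport ψ) :
    Integrable (fun q => u q.1 q.2 * ψ q) ((timeInterval T).prod halfLine) ∧
    Integrable (fun q => u' q.1 q.2 * ψ q) ((timeInterval T).prod halfLine) := by
  obtain ⟨B, hB, hb⟩ := exists_exp_bound₂ hψ hc
  exact h.integrable_mul hB hψ.aestronglyMeasurable fun t _ z _ => hb t z

theorem exists_bound_snd_tsupport {f : ℝ × ℝ → ℂ} (hc : HasCompactSupport f) :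
    ∃ R, 0 < R ∧ ∀ q : ℝ × ℝ, R ≤ q.2 → q ∉ tsupport f := by
  obtain ⟨R, hR⟩ := hc.isBounded.subset_closedBall (0 : ℝ × ℝ)
  refine ⟨|R| + 1, by positivity, fun q hq hmem => ?_⟩
  have h1 := hR hmem
  rw [mem_closedBall_zero_iff] at h1
  have h2 := (norm_snd_le q).trans h1
  rw [Real.norm_eq_abs] at h2
  linarith [le_abs_self q.2, le_abs_self R]

end Test

theorem eLpNorm_const_mul_le {c : ℝ≥0∞} (hc : c ≠ ⊤) (F : ℝ → ℝ≥0∞) (μ : Measure ℝ) :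
    eLpNorm (fun y => c * F y) 2 μ ≤ c * eLpNorm F 2 μ := by
  refine (ENNReal.pow_le_pow_left_iff (two_ne_zero)).1 ?_
  rw [mul_pow, eLpNorm_two_sq, eLpNorm_two_sq, ← lintegral_const_mul' _ _ (ENNReal.pow_ne_top hc)]
  simp [mul_pow]

theorem lintegral_tpow_shift_le (a : ℝ) {s T : ℝ} (hs : 0 ≤ s) :
    ∫⁻ t in Ioo (0 : ℝ) T, tpow a (t - s) ≤ ∫⁻ r in Ioo (0 : ℝ) T, tpow a r := by
  rw [← lintegral_indicator measurableSet_Ioo, ← lintegral_indicator measurableSet_Ioo,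
    ← lintegral_add_right_eq_self _ s]
  refine lintegral_mono fun t => ?_
  simp only [indicator, mem_Ioo, add_sub_cancel_right]
  split_ifs with h1 h2 h2
  · simp
  · rw [tpow_of_nonpos]
    by_contra! h3
    exact h2 ⟨h3, by linarith⟩
  · simp
  · simp

theorem isSource_dirac {ν T s z : ℝ} (hν : 0 < ν) (hs : 0 ≤ s) (hsT : s < T) (hz : 0 ≤ z) :
    IsSource ν T (Measure.dirac (s, z)) fun _ => 1 := by
  refine ⟨aestronglyMeasurable_const, ?_, ?_, ?_⟩
  · rw [ae_dirac_eq]; exact ⟨hs, hsT, hz⟩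
  · have h1 : ∀ t, eLpNorm (potMaj ν (Measure.dirac (s, z)) (fun _ => 1) t) 2 halfLine ≤
        heatConst ν * tpow (3 / 4) (t - s) := by
      intro t
      have : potMaj ν (Measure.dirac (s, z)) (fun _ => 1) t =
          fun y => tpow (1 / 2) (t - s) * eheat ν (2 * (t - s)) (y - z) := by
        funext y
        rw [potMaj, lintegral_dirac]
        simp
      rw [this]
      refine (eLpNorm_const_mul_le (tpow_ne_top _ _) _ _).trans ?_
      calc _ ≤ tpow (1 / 2) (t - s) * (heatConst ν * tpow (1 / 4) (t - s)) := by
            gcongr; exact eLpNorm_eheat_le hν _ _ _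
        _ = heatConst ν * (tpow (1 / 2) (t - s) * tpow (1 / 4) (t - s)) := by ring
        _ = _ := by rw [tpow_mul]; norm_num
    refine (lintegral_mono h1).trans_lt ?_
    rw [lintegral_const_mul' _ _ (heatConst_lt_top ν).ne]
    exact ENNReal.mul_lt_top (heatConst_lt_top ν)
      ((lintegral_tpow_shift_le _ hs).trans_lt (lintegral_tpow_lt_top (by norm_num) T))
  · have h1 : ∀ t, potMajZero ν (Measure.dirac (s, z)) (fun _ => 1) t 0 ≤
        ENNReal.ofReal ((Real.sqrt (8 * Real.pi * ν))⁻¹) * tpow (1 / 2) (t - s) := by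
      intro t
      rw [potMajZero, lintegral_dirac]
      simpa using eheat_le hν (t - s) (0 - z)
    refine (lintegral_mono h1).trans_lt ?_
    rw [lintegral_const_mul' _ _ ENNReal.ofReal_ne_top]
    exact ENNReal.mul_lt_top ENNReal.ofReal_lt_top
      ((lintegral_tpow_shift_le _ hs).trans_lt (lintegral_tpow_lt_top (by norm_num) T))

theorem pot_dirac (k : ℝ → ℝ → ℝ → ℝ) (s z t y : ℝ) :
    pot k (Measure.dirac (s, z)) (fun _ => 1) t y = k (t - s) y z := by
  simp [pot]

/-! ### The fundamental solution satisfies the weak form with a point source -/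

section Green

variable {ν d β σ T s z : ℝ} {φ : ℝ → ℝ → ℂ}

/-- The weak form on a rectangle that excludes the source. -/
theorem kern_rectangle_identity (hν : 0 < ν) (hφ : IsTest T φ) {R : ℝ}
    (hRs : ∀ q : ℝ × ℝ, R ≤ q.2 → q ∉ tsupport (Function.uncurry φ))
    (hbc : ∀ t, (kernDy ν d β σ t 0 z : ℂ) * φ (t + s) 0 = -(β * kern ν d β σ t 0 z * φ (t + s) 0))
    {r : ℝ} (hsr : s < r) (hrT : r ≤ T) :
    ∫ t in r..T, ((∫ y in (0 : ℝ)..R,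
        (-((kern ν d β σ (t - s) y z : ℂ) * testDt φ (t, y)) +
          ν * (kernDy ν d β σ (t - s) y z * testDz φ (t, y)) +
          d * (kern ν d β σ (t - s) y z * φ t y)))) =
      (∫ t in r..T, (ν * β * (kern ν d β σ (t - s) 0 z * φ t 0) : ℂ)) +
      ∫ y in (0 : ℝ)..R, (kern ν d β σ (r - s) y z : ℂ) * φ r y := by
  set κ : ℝ → ℝ → ℂ := fun t y => (kern ν d β σ (t - s) y z : ℂ) with hκ
  set κ' : ℝ → ℝ → ℂ := fun t y => (kernDy ν d β σ (t - s) y z : ℂ) with hκ'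
  have hc1 : ∀ q : ℝ × ℝ, s < q.1 → ContDiffAt ℝ ∞ (Function.uncurry κ) q := fun q hq =>
    Complex.ofRealCLM.contDiff.contDiffAt.comp q ((contDiffAt_kern hν d β σ
      (q := (q.1 - s, q.2, z)) (by simpa using hq)).comp q
      (f := fun q : ℝ × ℝ => (q.1 - s, q.2, z)) (by fun_prop))
  have hc2 : ∀ q : ℝ × ℝ, s < q.1 → ContDiffAt ℝ ∞ (Function.uncurry κ') q := fun q hq =>
    Complex.ofRealCLM.contDiff.contDiffAt.comp q ((contDiffAt_kernDy hν d β σ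
      (q := (q.1 - s, q.2, z)) (by simpa using hq)).comp q
      (f := fun q : ℝ × ℝ => (q.1 - s, q.2, z)) (by fun_prop))
  -- The field `(f, g)` has divergence minus the integrand of the weak form, since `κ` solves the
  -- damped heat equation. Its flux vanishes on the face `t = T` and on the face `y = R` by the
  -- support of `φ`; the face `y = 0` gives the Robin term and the face `t = r` the spatial
  -- integral.
  set f : ℝ → ℝ → ℂ := fun t y => κ t y * φ t y with hf
  set g : ℝ → ℝ → ℂ := fun t y => -(ν * (κ' t y * φ t y)) with hg
  have hfc : ∀ q : ℝ × ℝ, s < q.1 → ContDiffAt ℝ ∞ (Function.uncurry f) q := fun q hq =>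
    (hc1 q hq).mul hφ.smooth.contDiffAt
  have hgc : ∀ q : ℝ × ℝ, s < q.1 → ContDiffAt ℝ ∞ (Function.uncurry g) q := fun q hq =>
    (contDiffAt_const.mul ((hc2 q hq).mul hφ.smooth.contDiffAt)).neg
  have hbox : ∀ q ∈ (uIcc r T ×ˢ uIcc 0 R : Set (ℝ × ℝ)), s < q.1 := by
    rintro q ⟨h1, -⟩
    rw [uIcc_of_le hrT] at h1
    exact hsr.trans_le h1.1
  have hbox' : ∀ q ∈ (Ioo (min r T) (max r T) ×ˢ Ioo (min 0 R) (max 0 R) : Set (ℝ × ℝ)),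
      s < q.1 := by
    rintro q ⟨h1, -⟩
    rw [min_eq_left hrT] at h1
    exact hsr.trans h1.1
  have hval : ∀ q : ℝ × ℝ, s < q.1 →
      fderiv ℝ (Function.uncurry f) q (1, 0) + fderiv ℝ (Function.uncurry g) q (0, 1) =
      -(-(κ q.1 q.2 * testDt φ q) + ν * (κ' q.1 q.2 * testDz φ q) + d * (κ q.1 q.2 * φ q.1 q.2)) := by
    rintro ⟨t, y⟩ hq
    have e1 := hasDerivAt_fst_of_differentiableAt ((hfc (t, y) hq).differentiableAt (by simp))
    have e2 := hasDerivAt_snd_of_differentiableAt ((hgc (t, y) hq).differentiableAt (by simp))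
    have hts : 0 < t - s := by simpa using hq
    have k1 : HasDerivAt (fun t => κ t y)
        ((ν * kernDyy ν d β σ (t - s) y z - d * kern ν d β σ (t - s) y z : ℝ) : ℂ) t :=
      ((hasDerivAt_kern_time hν hts d β σ y z).comp_sub_const t s).ofReal_comp
    have k2 : HasDerivAt (κ' t) (kernDyy ν d β σ (t - s) y z : ℂ) y :=
      (hasDerivAt_kernDy hν hts d β σ y z).ofReal_comp
    have e3 := k1.mul (hasDerivAt_testDt hφ.smooth t y)
    have e4 := ((k2.mul (hasDerivAt_testDz hφ.smooth t y)).const_mul (ν : ℂ)).neg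
    rw [e1.unique e3, e2.unique e4]
    simp only [hκ, hκ']
    push_cast
    ring
  have hdiv := integral2_divergence_prod_of_hasFDerivAt (Function.uncurry f) (Function.uncurry g)
    (fderiv ℝ (Function.uncurry f)) (fderiv ℝ (Function.uncurry g)) r 0 T R
    (fun q hq => (hfc q (hbox q hq)).continuousAt.continuousWithinAt)
    (fun q hq => (hgc q (hbox q hq)).continuousAt.continuousWithinAt)
    (fun q hq => ((hfc q (hbox' q hq)).differentiableAt (by simp)).hasFDerivAt)
    (fun q hq => ((hgc q (hbox' q hq)).differentiableAt (by simp)).hasFDerivAt)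
    (by
      refine ContinuousOn.integrableOn_compact (isCompact_uIcc.prod isCompact_uIcc) ?_
      intro q hq
      refine ContinuousAt.continuousWithinAt ?_
      have c1 := ((hfc q (hbox q hq)).fderiv_right (m := 0) (by simp)).continuousAt
      have c2 := ((hgc q (hbox q hq)).fderiv_right (m := 0) (by simp)).continuousAt
      exact (c1.clm_apply continuousAt_const).add (c2.clm_apply continuousAt_const))
  have hlhs : (∫ t in r..T, ∫ y in (0 : ℝ)..R, (fderiv ℝ (Function.uncurry f) (t, y) (1, 0) +
      fderiv ℝ (Function.uncurry g) (t, y) (0, 1))) = -∫ t in r..T, ∫ y in (0 : ℝ)..R,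
        (-(κ t y * testDt φ (t, y)) + ν * (κ' t y * testDz φ (t, y)) + d * (κ t y * φ t y)) := by
    rw [← intervalIntegral.integral_neg]
    refine intervalIntegral.integral_congr fun t ht => ?_
    rw [uIcc_of_le hrT] at ht
    rw [← intervalIntegral.integral_neg]
    refine intervalIntegral.integral_congr fun y _ => ?_
    exact hval (t, y) (hsr.trans_le ht.1)
  have hfT : ∀ y, Function.uncurry f (T, y) = 0 := by
    intro y
    have : (T, y) ∉ tsupport (Function.uncurry φ) := fun h => lt_irrefl T (hφ.before h).1
    have h0 := image_eq_zero_of_notMem_tsupport this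
    simp only [Function.uncurry] at h0
    simp [Function.uncurry, hf, h0]
  have hgR : ∀ t, Function.uncurry g (t, R) = 0 := by
    intro t
    have h0 := image_eq_zero_of_notMem_tsupport (hRs (t, R) le_rfl)
    simp only [Function.uncurry] at h0
    simp [Function.uncurry, hg, h0]
  have hg0 : ∀ t, Function.uncurry g (t, 0) = ν * β * (kern ν d β σ (t - s) 0 z * φ t 0) := by
    intro t
    have := hbc (t - s)
    rw [sub_add_cancel] at this
    simp only [Function.uncurry, hg, hκ']
    rw [this]
    ring
  rw [hlhs] at hdiv
  simp only [hfT, hgR, hg0, intervalIntegral.integral_zero] at hdiv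
  simp only [Function.uncurry, hf] at hdiv
  linear_combination -hdiv

/-- The kernel vanishes before the source time `s`. After it, the rectangle identity holds on `(r,
T)` for every `r > s`, and as `r` decreases to `s` the integral over the initial face tends to the
value of `φ` at the source. The term with `β` is the flux through the wall. -/
theorem heatForm_kern (hν : 0 < ν) (hd : 0 ≤ d) (hβ : 0 ≤ β) (hs : 0 ≤ s) (hsT : s < T)
    (hz : 0 ≤ z) (hφ : IsTest T φ) (hσ : σ = 1 ∨ σ = -1 ∧ β = 0 ∧ ∀ t, φ t 0 = 0) :
    heatForm ν d T (fun t y => kern ν d β σ (t - s) y z) (fun t y => kernDy ν d β σ (t - s) y z) φ =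
      φ s z + ν * β * ∫ t in Ioo (0 : ℝ) T, (kern ν d β σ (t - s) 0 z : ℂ) * φ t 0 := by
  have hT : 0 < T := hs.trans_lt hsT
  have hσ1 : |σ| ≤ 1 := by rcases hσ with h | ⟨h, -⟩ <;> simp [h]
  have hsrc := isSource_dirac hν hs hsT hz
  have hmem := hsrc.memLOneH1 (d := d) (β := β) (σ := σ) hν hd hβ hσ1 hT
  have i1 := (hmem.integrable_test (continuous_testDt hφ.smooth)
    (hasCompactSupport_testDt hφ.smooth hφ.compact)).1
  have i2 := (hmem.integrable_test (continuous_testDz hφ.smooth)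
    (hasCompactSupport_testDz hφ.smooth hφ.compact)).2
  have i3 := (hmem.integrable_test hφ.smooth.continuous hφ.compact).1
  simp only [pot_dirac] at i1 i2 i3
  change Integrable (fun q : ℝ × ℝ => (kern ν d β σ (q.1 - s) q.2 z : ℂ) * φ q.1 q.2) _ at i3
  have hbc : ∀ t, (kernDy ν d β σ t 0 z : ℂ) * φ (t + s) 0 =
      -(β * kern ν d β σ t 0 z * φ (t + s) 0) := by
    intro t
    rcases hσ with h | ⟨-, -, h0⟩
    · rw [h, kernDy_zero]; push_cast; ring
    · simp [h0]
  set I : ℝ × ℝ → ℂ := fun q => -((kern ν d β σ (q.1 - s) q.2 z : ℂ) * testDt φ q) +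
          ν * (kernDy ν d β σ (q.1 - s) q.2 z * testDz φ q) +
          d * (kern ν d β σ (q.1 - s) q.2 z * φ q.1 q.2) with hI
  have hIint : Integrable I ((timeInterval T).prod halfLine) :=
    (i1.neg.add (i2.const_mul _)).add (i3.const_mul _)
  have hform : heatForm ν d T (fun t y => kern ν d β σ (t - s) y z)
      (fun t y => kernDy ν d β σ (t - s) y z) φ = ∫ q, I q ∂(timeInterval T).prod halfLine := by
    simp only [hI]
    rw [integral_neg_add_add i1 i2 i3]
    rfl
  obtain ⟨R, hR, hRs⟩ := exists_bound_snd_tsupport hφ.compact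
  set A : ℝ → ℂ := fun t => ∫ y in Ioi (0 : ℝ), I (t, y) with hA
  set Bd : ℝ → ℂ := fun t => ν * β * (kern ν d β σ (t - s) 0 z * φ t 0) with hBd
  have hAint : Integrable A (timeInterval T) := hIint.integral_prod_left
  have hφ0 : Continuous fun t => φ t 0 :=
    hφ.smooth.continuous.comp (continuous_id.prodMk continuous_const)
  have hBint0 : Integrable (fun t => (kern ν d β σ (t - s) 0 z : ℂ) * φ t 0) (timeInterval T) := by
    obtain ⟨C, hC, hle⟩ := exists_enorm_pot_le (a := fun _ => 1) (d := d) (β := β) (σ := σ)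
      hν hd hβ hσ1 hT hsrc.supp
    obtain ⟨B, hB⟩ := hφ.compact.exists_bound_of_continuous hφ.smooth.continuous
    refine Integrable.mul_bdd (c := B) ⟨?_, ?_⟩ hφ0.aestronglyMeasurable
      (ae_of_all _ fun t => hB (t, 0))
    · exact (Complex.measurable_ofReal.comp ((measurable_kern hν d β σ).comp
        (f := fun t : ℝ => (t - s, (0 : ℝ), z)) (by fun_prop))).aestronglyMeasurable
    · refine lt_of_le_of_lt ?_ (ENNReal.mul_lt_top hC.lt_top hsrc.trace_lt_top)
      rw [← lintegral_const_mul' _ _ hC]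
      refine setLIntegral_mono' measurableSet_Ioo fun t ht => ?_
      simpa only [pot_dirac] using (hle t ht.2.le 0 le_rfl).1
  have hBint : Integrable Bd (timeInterval T) := hBint0.const_mul _
  have hD := hAint.sub hBint
  have hDi : IntervalIntegrable (A - Bd) volume 0 T :=
    (intervalIntegrable_iff_integrableOn_Ioo_of_le hT.le).2 hD
  have hD0 : ∀ t, t ≤ s → (A - Bd) t = 0 := by
    intro t ht
    have ht' : t - s ≤ 0 := by linarith
    simp [hA, hBd, hI, kern_of_nonpos hν ht', kernDy_of_nonpos hν ht']
  -- `A` is the time density of the weak form and `Bd` that of the boundary term, so this is the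
  -- rectangle identity with the truncation at `R` removed.
  have hkey : ∀ r, s < r → r < T → ∫ t in r..T, (A - Bd) t =
      ∫ y in Ioi (0 : ℝ), (kern ν d β σ (r - s) y z : ℂ) * φ r y := by
    intro r hsr hrT
    have htrunc : ∀ F : ℝ → ℂ, (∀ y, R ≤ y → F y = 0) →
        ∫ y in Ioi (0 : ℝ), F y = ∫ y in (0 : ℝ)..R, F y := by
      intro F hF
      rw [intervalIntegral.integral_of_le hR.le]
      refine setIntegral_eq_of_subset_of_forall_sdiff_eq_zero measurableSet_Ioi
        (fun y hy => hy.1) fun y hy => hF y ?_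
      by_contra! h
      exact hy.2 ⟨hy.1, h.le⟩
    have h1 := kern_rectangle_identity (d := d) (β := β) (σ := σ) hν hφ hRs hbc hsr hrT.le
    have hz0 : ∀ t y, R ≤ y → φ t y = 0 := fun t y hy =>
      image_eq_zero_of_notMem_tsupport (f := Function.uncurry φ) (hRs (t, y) hy)
    have h2 : ∀ t, A t = ∫ y in (0 : ℝ)..R, I (t, y) := by
      intro t
      refine htrunc (fun y => I (t, y)) fun y hy => ?_
      simp [hI, testDt_eq_zero hφ.smooth (hRs (t, y) hy), testDz_eq_zero hφ.smooth (hRs (t, y) hy),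
        hz0 t y hy]
    have hsub : uIcc r T ⊆ uIcc 0 T := by
      rw [uIcc_of_le hrT.le, uIcc_of_le hT.le]
      exact Icc_subset_Icc_left (hs.trans hsr.le)
    have hAi : IntervalIntegrable A volume r T :=
      ((intervalIntegrable_iff_integrableOn_Ioo_of_le hT.le).2 hAint).mono_set hsub
    have hBi : IntervalIntegrable Bd volume r T :=
      ((intervalIntegrable_iff_integrableOn_Ioo_of_le hT.le).2 hBint).mono_set hsub
    simp only [Pi.sub_apply]
    rw [intervalIntegral.integral_sub hAi hBi, htrunc _ fun y hy => by rw [hz0 r y hy, mul_zero]]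
    simp only [h2, hI, hBd]
    rw [h1]
    ring
  have htotal : ∫ t in Ioo (0 : ℝ) T, (A - Bd) t = φ s z := by
    have hcont : ContinuousOn (fun x => ∫ t in x..T, (A - Bd) t) (uIcc 0 T) :=
      intervalIntegral.continuousOn_primitive_interval_left
        ((intervalIntegrable_iff' (by simp)).1 hDi)
    have hs_mem : s ∈ uIcc 0 T := by rw [uIcc_of_le hT.le]; exact ⟨hs, hsT.le⟩
    have hlim1 : Tendsto (fun ε => ∫ t in (s + ε)..T, (A - Bd) t) (𝓝[>] 0)
        (𝓝 (∫ t in s..T, (A - Bd) t)) := by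
      have h3 := hcont s hs_mem
      have h4 : Tendsto (fun ε : ℝ => s + ε) (𝓝[>] 0) (𝓝[uIcc 0 T] s) := by
        refine tendsto_nhdsWithin_iff.2 ⟨?_, ?_⟩
        · refine Tendsto.mono_left ?_ nhdsWithin_le_nhds
          have : Continuous fun ε : ℝ => s + ε := by fun_prop
          simpa using this.tendsto 0
        · filter_upwards [Ioo_mem_nhdsGT (show (0 : ℝ) < T - s by linarith)] with ε hε
          rw [uIcc_of_le hT.le]
          exact ⟨by linarith [hε.1], by linarith [hε.2]⟩
      exact h3.tendsto.comp h4
    obtain ⟨B, hB⟩ := hφ.compact.exists_bound_of_continuous hφ.smooth.continuous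
    have hφc : Continuous fun q : ℝ × ℝ => φ (s + q.1) q.2 :=
      hφ.smooth.continuous.comp (f := fun q : ℝ × ℝ => (s + q.1, q.2)) (by fun_prop)
    have hlim2 := tendsto_integral_kern (d := d) (σ := σ) (z := z) hν hβ hφc
      (B := B) (fun q => hB (s + q.1, q.2))
      (by rcases hσ with h | ⟨h, -, h0⟩
          · exact Or.inl h
          · exact Or.inr ⟨h, fun ε => h0 _⟩) hz
    -- The same quantity has two limits as `ε` decreases to `0`: one by continuity of the primitive,
    -- the other by the approximate identity.
    have heq : ∫ t in s..T, (A - Bd) t = φ (s + 0) z := by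
      refine tendsto_nhds_unique hlim1 (hlim2.congr' ?_)
      filter_upwards [Ioo_mem_nhdsGT (show (0 : ℝ) < T - s by linarith)] with ε hε
      rw [hkey (s + ε) (by linarith [hε.1]) (by linarith [hε.2])]
      simp
    rw [← integral_Ioc_eq_integral_Ioo, ← intervalIntegral.integral_of_le hT.le,
      ← intervalIntegral.integral_add_adjacent_intervals (b := s)
        (hDi.mono_set (by rw [uIcc_of_le hs, uIcc_of_le hT.le]; exact Icc_subset_Icc_right hsT.le))
        (hDi.mono_set (by rw [uIcc_of_le hsT.le, uIcc_of_le hT.le]; exact Icc_subset_Icc_left hs)),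
      heq, add_zero]
    have : ∫ t in (0 : ℝ)..s, (A - Bd) t = 0 := by
      rw [intervalIntegral.integral_congr (g := fun _ => 0) fun t ht => ?_]
      · simp
      · rw [uIcc_of_le hs] at ht
        exact hD0 t ht.2
    rw [this, zero_add]
  simp only [Pi.sub_apply] at htotal
  rw [integral_sub hAint hBint] at htotal
  rw [hform, integral_prod _ hIint]
  have hBc : ∫ t in Ioo (0 : ℝ) T, Bd t =
      ν * β * ∫ t in Ioo (0 : ℝ) T, (kern ν d β σ (t - s) 0 z : ℂ) * φ t 0 :=
    integral_const_mul _ _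
  rw [← hBc]
  linear_combination htotal

/-- The potential of a source satisfies the weak form. -/
theorem IsSource.heatForm_pot {ρ : Measure (ℝ × ℝ)} [SFinite ρ] {a : ℝ × ℝ → ℂ}
    (hν : 0 < ν) (hd : 0 ≤ d) (hβ : 0 ≤ β) (hT : 0 < T) (h : IsSource ν T ρ a)
    (hφ : IsTest T φ) (hσ : σ = 1 ∨ σ = -1 ∧ β = 0 ∧ ∀ t, φ t 0 = 0) :
    Integrable (fun p => a p * φ p.1 p.2) ρ ∧
    Integrable (fun t => pot (kern ν d β σ) ρ a t 0 * φ t 0) (timeInterval T) ∧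
    heatForm ν d T (pot (kern ν d β σ) ρ a) (pot (kernDy ν d β σ) ρ a) φ =
      (∫ p, a p * φ p.1 p.2 ∂ρ) +
        ν * β * ∫ t in Ioo (0 : ℝ) T, pot (kern ν d β σ) ρ a t 0 * φ t 0 := by
  have hσ1 : |σ| ≤ 1 := by rcases hσ with h | ⟨h, -⟩ <;> simp [h]
  obtain ⟨C, hC, hle⟩ := exists_lintegral_kern_le (a := a) (d := d) (β := β) (σ := σ)
    hν hd hβ hσ1 hT h.supp
  have hmk := measurable_kern hν d β σ
  have hmk' := measurable_kernDy hν d β σ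
  have hmaj : AEMeasurable (Function.uncurry (potMaj ν ρ a)) ((timeInterval T).prod halfLine) :=
    aemeasurable_potMaj ν h.meas measurable_fst measurable_snd
  have hfin : ∀ (k : ℝ → ℝ → ℝ → ℝ) (ψ : ℝ × ℝ → ℂ), Continuous ψ → HasCompactSupport ψ →
      (∀ t ≤ T, ∀ y, 0 ≤ y → ∫⁻ p, ‖k (t - p.1) y p.2‖ₑ * ‖a p‖ₑ ∂ρ ≤ C * potMaj ν ρ a t y) →
      ∫⁻ q, (∫⁻ p, ‖k (q.1 - p.1) q.2 p.2‖ₑ * ‖a p‖ₑ ∂ρ) * ‖ψ q‖ₑ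
        ∂(timeInterval T).prod halfLine < ⊤ := by
    intro k ψ hψ hψc hk
    obtain ⟨B, hB, hb⟩ := exists_exp_bound₂ hψ hψc
    have := lintegral_mul_lt_top hB hmaj h.norm_lt_top hψ.aestronglyMeasurable
      fun t _ z _ => hb t z
    refine lt_of_le_of_lt ?_ (ENNReal.mul_lt_top hC.lt_top this)
    rw [← lintegral_const_mul' _ _ hC]
    refine lintegral_mono_ae ?_
    rw [Measure.prod_restrict]
    filter_upwards [ae_restrict_mem (measurableSet_Ioo.prod measurableSet_Ioi)] with q hq
    rw [← mul_assoc]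
    gcongr
    exact hk q.1 hq.1.2.le q.2 (mem_Ioi.1 hq.2).le
  obtain ⟨-, j1, e1⟩ := pot_fubini (m := (timeInterval T).prod halfLine) hmk h.meas
    measurable_fst measurable_snd (continuous_testDt hφ.smooth).aestronglyMeasurable
    (hfin _ _ (continuous_testDt hφ.smooth) (hasCompactSupport_testDt hφ.smooth hφ.compact)
      fun t ht y hy => (hle t ht y hy).2.1)
  obtain ⟨-, j2, e2⟩ := pot_fubini (m := (timeInterval T).prod halfLine) hmk' h.meas
    measurable_fst measurable_snd (continuous_testDz hφ.smooth).aestronglyMeasurable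
    (hfin _ _ (continuous_testDz hφ.smooth) (hasCompactSupport_testDz hφ.smooth hφ.compact)
      fun t ht y hy => (hle t ht y hy).2.2)
  obtain ⟨-, j3, e3⟩ := pot_fubini (m := (timeInterval T).prod halfLine)
    (ψ := fun q => φ q.1 q.2) hmk h.meas measurable_fst measurable_snd hφ.smooth.continuous.aestronglyMeasurable
    (hfin _ _ hφ.smooth.continuous hφ.compact fun t ht y hy => (hle t ht y hy).2.1)
  have hφ0 : Continuous fun t => φ t 0 :=
    hφ.smooth.continuous.comp (continuous_id.prodMk continuous_const)
  obtain ⟨i4, j4, e4⟩ := pot_fubini (m := timeInterval T) (τ := fun t => t) (η := fun _ => 0)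
    hmk h.meas measurable_id measurable_const hφ0.aestronglyMeasurable (by
      obtain ⟨B, hB⟩ := hφ.compact.exists_bound_of_continuous hφ.smooth.continuous
      have hB' : ∀ t, ‖φ t 0‖ₑ ≤ ENNReal.ofReal B := fun t => by
        rw [← ofReal_norm]; exact ENNReal.ofReal_le_ofReal (hB (t, 0))
      refine lt_of_le_of_lt ?_ (ENNReal.mul_lt_top (ENNReal.mul_lt_top hC.lt_top h.trace_lt_top)
        (ENNReal.ofReal_lt_top (r := B)))
      rw [← lintegral_const_mul' _ _ hC, ← lintegral_mul_const' _ _ ENNReal.ofReal_ne_top]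
      refine setLIntegral_mono' measurableSet_Ioo fun t ht => ?_
      gcongr
      · exact (hle t ht.2.le 0 le_rfl).1
      · exact hB' t)
  -- The point-source identity at `p`, multiplied by the density. Each term is integrable in `p`, so
  -- it may be integrated term by term and Fubini reversed.
  have hpt : ∀ᵐ p ∂ρ, a p * φ p.1 p.2 =
      -(a p * ∫ q, (kern ν d β σ (q.1 - p.1) q.2 p.2 : ℂ) * testDt φ q
          ∂(timeInterval T).prod halfLine) +
        ν * (a p * ∫ q, (kernDy ν d β σ (q.1 - p.1) q.2 p.2 : ℂ) * testDz φ q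
          ∂(timeInterval T).prod halfLine) +
        d * (a p * ∫ q, (kern ν d β σ (q.1 - p.1) q.2 p.2 : ℂ) * φ q.1 q.2
          ∂(timeInterval T).prod halfLine) -
        ν * β * (a p * ∫ t in Ioo (0 : ℝ) T, (kern ν d β σ (t - p.1) 0 p.2 : ℂ) * φ t 0) := by
    filter_upwards [h.supp] with p hp
    have := heatForm_kern hν hd hβ hp.1 hp.2.1 hp.2.2 hφ hσ
    rw [heatForm] at this
    linear_combination (-a p) * this
  have hint := ((j1.neg.add (j2.const_mul (ν : ℂ))).add (j3.const_mul (d : ℂ))).sub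
    (j4.const_mul (ν * β : ℂ))
  refine ⟨hint.congr (hpt.mono fun p hp => hp.symm), i4, ?_⟩
  rw [integral_congr_ae hpt, integral_neg_add_add_sub j1 j2 j3 j4, heatForm, e1, e2, e3, e4]
  ring

end Green

/-! ### Uniqueness of weak solutions -/

/-- By the arithmetic–geometric mean inequality, `|x| ≤ x²/(8νT) + 2νT`. This trades the Gaussian
for `exp (-|x|)` as long as the time stays away from zero. -/
theorem heat_two_mul_le_exp {ν T δ τ x : ℝ} (hν : 0 < ν) (hδ : 0 < δ) (h1 : δ ≤ τ) (h2 : τ ≤ T) :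
    heat ν (2 * τ) x ≤
      (Real.sqrt (4 * Real.pi * ν * (2 * δ)))⁻¹ * Real.exp (2 * ν * T) * Real.exp (-|x|) := by
  have hτ : 0 < τ := hδ.trans_le h1
  have hT : 0 < T := hτ.trans_le h2
  rw [heat, mul_assoc _ (Real.exp _) (Real.exp _), ← Real.exp_add]
  have e1 : Real.sqrt (4 * Real.pi * ν * (2 * δ)) ≤ Real.sqrt (4 * Real.pi * ν * (2 * τ)) :=
    Real.sqrt_le_sqrt (by gcongr)
  have e2 : -(x ^ 2 / (4 * ν * (2 * τ))) ≤ 2 * ν * T + -|x| := by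
    have h3 : x ^ 2 / (4 * ν * (2 * T)) ≤ x ^ 2 / (4 * ν * (2 * τ)) := by gcongr
    have h4 : |x| ≤ x ^ 2 / (4 * ν * (2 * T)) + 2 * ν * T := by
      rw [div_add' _ _ _ (by positivity), le_div_iff₀ (by positivity), ← sq_abs]
      nlinarith [sq_nonneg (|x| - 4 * ν * T)]
    linarith
  have hs : 0 < Real.sqrt (4 * Real.pi * ν * (2 * δ)) := by positivity
  gcongr

/-- Puts the backward kernel into the exponential decay class, uniformly for sources in `[0, Y]`;
the factor `exp Y` comes from `|z - y| ≥ z - Y`. -/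
theorem exists_kern_exp_bound {ν d β σ : ℝ} (hν : 0 < ν) (hd : 0 ≤ d) (hβ : 0 ≤ β)
    (hσ : |σ| ≤ 1) {T δ : ℝ} (hT : 0 < T) (hδ : 0 < δ) (Y : ℝ) :
    ∃ B, 0 ≤ B ∧ ∀ τ, δ ≤ τ → τ ≤ T → ∀ y, 0 ≤ y → y ≤ Y → ∀ z, 0 ≤ z →
      |kern ν d β σ τ z y| ≤ B * Real.exp (-z) ∧ |kernDy ν d β σ τ z y| ≤ B * Real.exp (-z) := by
  obtain ⟨C, hC, h⟩ := exists_kern_le (ν := ν) (d := d) (β := β) (σ := σ) hν hd hβ hσ hT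
  set K := (Real.sqrt (4 * Real.pi * ν * (2 * δ)))⁻¹ * Real.exp (2 * ν * T) with hK
  refine ⟨C * (1 + (Real.sqrt δ)⁻¹) * K * Real.exp Y, by positivity, ?_⟩
  intro τ h1 h2 y hy hyY z hz
  have hτ : 0 < τ := hδ.trans_le h1
  obtain ⟨b1, b2⟩ := h τ hτ h2 z hz y hy
  have hK0 : 0 ≤ K := by positivity
  have h3 : heat ν (2 * τ) (z - y) ≤ K * (Real.exp Y * Real.exp (-z)) := by
    refine (heat_two_mul_le_exp hν hδ h1 h2).trans ?_
    rw [← Real.exp_add]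
    gcongr
    linarith [le_abs_self (z - y)]
  have h4 : (Real.sqrt τ)⁻¹ ≤ (Real.sqrt δ)⁻¹ :=
    inv_anti₀ (Real.sqrt_pos.2 hδ) (Real.sqrt_le_sqrt h1)
  have hH := heat_nonneg ν (2 * τ) (z - y)
  have hδ' : 0 ≤ (Real.sqrt δ)⁻¹ := by positivity
  constructor
  · refine b1.trans ?_
    calc C * heat ν (2 * τ) (z - y) ≤ C * (K * (Real.exp Y * Real.exp (-z))) := by gcongr
      _ = C * 1 * (K * (Real.exp Y * Real.exp (-z))) := by ring
      _ ≤ C * (1 + (Real.sqrt δ)⁻¹) * (K * (Real.exp Y * Real.exp (-z))) := by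
          gcongr; linarith
      _ = _ := by ring
  · refine b2.trans ?_
    calc C * ((Real.sqrt τ)⁻¹ * heat ν (2 * τ) (z - y))
        ≤ C * ((1 + (Real.sqrt δ)⁻¹) * (K * (Real.exp Y * Real.exp (-z)))) := by
          gcongr; linarith
      _ = _ := by ring

/-- Dilations of one bump by `n + 1`. Being constant near `0`, they have value one and zero
derivative there, so multiplication by them preserves the boundary condition of the kernel; their
derivatives are of order `1/n`. -/
theorem exists_cutoff : ∃ X : ℕ → ℝ → ℝ, ∃ M : ℝ, 0 ≤ M ∧
    ∀ n, ContDiff ℝ ∞ (X n) ∧ HasCompactSupport (X n) ∧ X n 0 = 1 ∧ deriv (X n) 0 = 0 ∧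
      (∀ z, |X n z| ≤ M) ∧ (∀ z, |deriv (X n) z| ≤ M / (n + 1)) ∧
      (∀ z, |deriv (deriv (X n)) z| ≤ M / (n + 1)) ∧ ∀ z : ℝ, |z| ≤ n → X n z = 1 := by
  let f : ContDiffBump (0 : ℝ) := ⟨1, 2, one_pos, by norm_num⟩
  have hf : ContDiff ℝ ∞ f := f.contDiff
  have hc : HasCompactSupport f := f.hasCompactSupport
  have hf1 : ContDiff ℝ ∞ (deriv f) := ((contDiff_infty_iff_deriv).1 hf).2
  have hf2 : Continuous (deriv (deriv f)) := hf1.continuous_deriv (by simp)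
  obtain ⟨M0, h0⟩ := hc.exists_bound_of_continuous hf.continuous
  obtain ⟨M1, h1⟩ := hc.deriv.exists_bound_of_continuous hf1.continuous
  obtain ⟨M2, h2⟩ := hc.deriv.deriv.exists_bound_of_continuous hf2
  have p0 : 0 ≤ M0 := (norm_nonneg _).trans (h0 0)
  have p1 : 0 ≤ M1 := (norm_nonneg _).trans (h1 0)
  have p2 : 0 ≤ M2 := (norm_nonneg _).trans (h2 0)
  have d1 : ∀ n : ℕ, deriv (fun z => f (z * (n + 1 : ℝ)⁻¹)) =
      fun z => (n + 1 : ℝ)⁻¹ * deriv f (z * (n + 1 : ℝ)⁻¹) := by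
    intro n
    funext z
    have := ((hf.differentiable (by simp) (z * (n + 1 : ℝ)⁻¹)).hasDerivAt).comp z
      ((hasDerivAt_id z).mul_const (n + 1 : ℝ)⁻¹)
    rw [show (fun z => f (z * (n + 1 : ℝ)⁻¹)) = f ∘ fun z => id z * (n + 1 : ℝ)⁻¹ from rfl, this.deriv]
    ring
  have d2 : ∀ n : ℕ, deriv (fun z => (n + 1 : ℝ)⁻¹ * deriv f (z * (n + 1 : ℝ)⁻¹)) =
      fun z => (n + 1 : ℝ)⁻¹ * ((n + 1 : ℝ)⁻¹ * deriv (deriv f) (z * (n + 1 : ℝ)⁻¹)) := by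
    intro n
    funext z
    have := (((hf1.differentiable (by simp) (z * (n + 1 : ℝ)⁻¹)).hasDerivAt).comp z
      ((hasDerivAt_id z).mul_const (n + 1 : ℝ)⁻¹)).const_mul (n + 1 : ℝ)⁻¹
    rw [show (fun z => (n + 1 : ℝ)⁻¹ * deriv f (z * (n + 1 : ℝ)⁻¹)) =
      fun z => (n + 1 : ℝ)⁻¹ * (deriv f ∘ fun z => id z * (n + 1 : ℝ)⁻¹) z from rfl, this.deriv]
    ring
  have hone : ∀ z : ℝ, |z| ≤ 1 → f z = 1 := fun z hz =>
    f.one_of_mem_closedBall (by simpa [f, Real.norm_eq_abs] using hz)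
  refine ⟨fun n z => f (z * (n + 1 : ℝ)⁻¹), M0 + M1 + M2, by positivity, fun n => ?_⟩
  have hn : (0 : ℝ) < n + 1 := by positivity
  have hn1 : (n + 1 : ℝ)⁻¹ ≤ 1 := inv_le_one_of_one_le₀ (by linarith [n.cast_nonneg (α := ℝ)])
  refine ⟨hf.comp (by fun_prop), ?_, ?_, ?_, ?_, ?_, ?_, ?_⟩
  · exact hc.comp_homeomorph (Homeomorph.mulRight₀ _ (inv_ne_zero hn.ne'))
  · exact hone _ (by simp)
  · rw [d1]
    have : deriv f 0 = 0 := by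
      have he : (f : ℝ → ℝ) =ᶠ[𝓝 0] fun _ => 1 := f.eventuallyEq_one
      rw [he.deriv_eq, deriv_const]
    simp [this]
  · intro z
    exact (h0 _).trans (by linarith)
  · intro z
    rw [d1, abs_mul, abs_of_pos (inv_pos.2 hn), div_eq_inv_mul]
    gcongr
    exact (h1 _).trans (by linarith)
  · intro z
    rw [d1, d2, abs_mul, abs_of_pos (inv_pos.2 hn), div_eq_inv_mul, abs_mul,
      abs_of_pos (inv_pos.2 hn)]
    have := h2 (z * (n + 1 : ℝ)⁻¹)
    rw [Real.norm_eq_abs] at this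
    gcongr
    calc _ ≤ 1 * M2 := by gcongr
      _ ≤ _ := by linarith
  · intro z hz
    refine hone _ ?_
    rw [abs_mul, abs_of_pos (inv_pos.2 hn), ← div_eq_mul_inv, div_le_one hn]
    linarith

theorem exists_complex_cutoff :
    ∃ χ : ℝ → ℂ, ContDiff ℝ ∞ χ ∧ HasCompactSupport χ ∧ χ 0 = 1 := by
  have hex := exists_cutoff
  generalize_proofs at hex
  obtain ⟨X, M, -, h⟩ := hex
  obtain ⟨h1, h2, h3, -⟩ := h 0
  have h4 : ContDiff ℝ ∞ fun z => (X 0 z : ℂ) := Complex.ofRealCLM.contDiff.comp h1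
  have h5 : HasCompactSupport fun z => (X 0 z : ℂ) :=
    h2.comp_left (g := fun r : ℝ => (r : ℂ)) Complex.ofReal_zero
  have h6 : (X 0 0 : ℂ) = 1 := by rw [h3, Complex.ofReal_one]
  exact ⟨fun z => (X 0 z : ℂ), h4, h5, h6⟩

theorem contDiff_testDz {φ : ℝ → ℝ → ℂ} (h : ContDiff ℝ ∞ (Function.uncurry φ)) :
    ContDiff ℝ ∞ (testDz φ) := by
  rw [funext (testDz_eq h)]
  exact (h.fderiv_right (by simp)).clm_apply contDiff_const

section IntegrationByParts

variable {ν d T : ℝ} {u u' : ℝ → ℝ → ℂ} {c : ℝ → ℂ}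

/-- The trace of a function in `L¹(0, T; H¹)` is integrable. -/
theorem MemLOneH1.integrable_trace (h : MemLOneH1 T u u' c) : Integrable c (timeInterval T) := by
  -- Integration by parts against a function with value one at `0` expresses the trace through two
  -- spatial pairings, each integrable in time.
  obtain ⟨χ, hχs, hχc, hχ0⟩ := exists_complex_cutoff
  have hχ' : Continuous (deriv χ) := hχs.continuous_deriv (by simp)
  obtain ⟨B1, hB1, hb1⟩ := exists_exp_bound hχ' hχc.deriv
  obtain ⟨B2, hB2, hb2⟩ := exists_exp_bound hχs.continuous hχc
  have i1 := (h.integrable_mul (ψ := fun q => deriv χ q.2) hB1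
    (hχ'.comp continuous_snd).aestronglyMeasurable fun _ _ z _ => hb1 z).1.integral_prod_left
  have i2 := (h.integrable_mul (ψ := fun q => χ q.2) hB2
    (hχs.continuous.comp continuous_snd).aestronglyMeasurable
    fun _ _ z _ => hb2 z).2.integral_prod_left
  refine (i1.add i2).neg.congr ?_
  filter_upwards [h.isH1] with t ht
  have := ht.parts χ hχs hχc
  rw [hχ0] at this
  simp only [Pi.neg_apply, Pi.add_apply]
  rw [this]
  ring

/-- Moving both space derivatives onto the test function. -/
theorem MemLOneH1.heatForm_eq (h : MemLOneH1 T u u' c) {φ : ℝ → ℝ → ℂ}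
    (hφ : ContDiff ℝ ∞ (Function.uncurry φ)) (hc : HasCompactSupport (Function.uncurry φ)) :
    heatForm ν d T u u' φ =
      -(∫ q, u q.1 q.2 * (testDt φ q + ν * testDz (fun t z => testDz φ (t, z)) q - d * φ q.1 q.2)
        ∂(timeInterval T).prod halfLine) -
      ν * ∫ t in Ioo (0 : ℝ) T, c t * testDz φ (t, 0) := by
  set φ' : ℝ → ℝ → ℂ := fun t z => testDz φ (t, z) with hφ'
  have hs : ContDiff ℝ ∞ (Function.uncurry φ') := contDiff_testDz hφ
  have hcs : HasCompactSupport (Function.uncurry φ') := hasCompactSupport_testDz hφ hc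
  have i1 := (h.integrable_test (continuous_testDt hφ) (hasCompactSupport_testDt hφ hc)).1
  have i2 := (h.integrable_test (continuous_testDz hφ) (hasCompactSupport_testDz hφ hc)).2
  have i3 : Integrable (fun q : ℝ × ℝ => u q.1 q.2 * φ q.1 q.2) ((timeInterval T).prod halfLine) :=
    (h.integrable_test hφ.continuous hc).1
  have i4 := (h.integrable_test (continuous_testDz hs) (hasCompactSupport_testDz hs hcs)).1
  obtain ⟨B, hB⟩ := hcs.exists_bound_of_continuous hs.continuous
  have i5 : Integrable (fun t => c t * testDz φ (t, 0)) (timeInterval T) :=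
    h.integrable_trace.mul_bdd (c := B) ((continuous_testDz hφ).comp
      (continuous_id.prodMk continuous_const)).aestronglyMeasurable (ae_of_all _ fun t => hB (t, 0))
  have key : ∫ q, u' q.1 q.2 * testDz φ q ∂(timeInterval T).prod halfLine =
      -(∫ t in Ioo (0 : ℝ) T, c t * testDz φ (t, 0)) -
        ∫ q, u q.1 q.2 * testDz φ' q ∂(timeInterval T).prod halfLine := by
    have hsub := integral_sub i5.neg i4.integral_prod_left
    simp only [Pi.neg_apply] at hsub
    rw [integral_prod _ i2, integral_prod _ i4, ← integral_neg, ← hsub]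
    refine integral_congr_ae ?_
    filter_upwards [h.isH1] with t ht
    have hst : ContDiff ℝ ∞ (φ' t) := hs.comp (contDiff_const.prodMk contDiff_id)
    have hct : HasCompactSupport (φ' t) := by
      refine HasCompactSupport.of_support_subset_isCompact (hcs.isCompact.image continuous_snd) ?_
      intro z hz
      exact ⟨(t, z), subset_tsupport _ hz, rfl⟩
    have := ht.parts (φ' t) hst hct
    simp only [testDz] at this ⊢
    rw [this]
    simp only [hφ', testDz]
    ring
  have e : ∀ q : ℝ × ℝ, u q.1 q.2 * (testDt φ q + ν * testDz φ' q - d * φ q.1 q.2) =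
      -(-(u q.1 q.2 * testDt φ q) + (-ν : ℂ) * (u q.1 q.2 * testDz φ' q) +
        (d : ℂ) * (u q.1 q.2 * φ q.1 q.2)) := fun q => by ring
  simp_rw [e]
  rw [integral_neg, integral_neg_add_add i1 i4 i3, heatForm, key]
  ring

end IntegrationByParts

/-! ### Derivatives of the truncated backward kernel -/

section Duality

variable {ν d β σ T : ℝ} {u u' : ℝ → ℝ → ℂ} {c : ℝ → ℂ} {θ : ℝ → ℝ} {t₁ y : ℝ}

/-- The truncated backward fundamental solution. -/
def backwardTest (ν d β σ : ℝ) (θ X : ℝ → ℝ) (t₁ y t z : ℝ) : ℂ :=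
  ((θ t * X z * kern ν d β σ (t₁ - t) z y : ℝ) : ℂ)

/-- The time cutoff is supported strictly before `t₁`, so only smooth times of the kernel are seen,
and `t₁ ≤ T` places the support before `T`. -/
theorem isTest_backwardTest (hν : 0 < ν) (hθ : ContDiff ℝ ∞ θ) (hθc : HasCompactSupport θ)
    (hθs : tsupport θ ⊆ Iio t₁) (ht₁ : t₁ ≤ T) {X : ℝ → ℝ} (hX : ContDiff ℝ ∞ X)
    (hXc : HasCompactSupport X) : IsTest T (backwardTest ν d β σ θ X t₁ y) := by
  have hsub : tsupport (Function.uncurry (backwardTest ν d β σ θ X t₁ y)) ⊆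
      tsupport θ ×ˢ tsupport X := by
    refine closure_minimal ?_ ((isClosed_tsupport _).prod (isClosed_tsupport _))
    rintro ⟨t, z⟩ h
    rw [Function.mem_support] at h
    refine ⟨subset_tsupport _ ?_, subset_tsupport _ ?_⟩ <;>
    · rw [Function.mem_support]
      intro h0
      simp [Function.uncurry, backwardTest, h0] at h
  refine ⟨contDiff_iff_contDiffAt.2 fun q => ?_, ?_, fun q hq => ?_⟩
  · by_cases hq : q.1 ∈ tsupport θ
    · refine Complex.ofRealCLM.contDiff.contDiffAt.comp q ?_
      refine ((hθ.contDiffAt.comp q contDiffAt_fst).mul (hX.contDiffAt.comp q contDiffAt_snd)).mul ?_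
      exact (contDiffAt_kern hν d β σ (q := (t₁ - q.1, q.2, y))
        (by simpa using hθs hq)).comp q
        (f := fun q : ℝ × ℝ => (t₁ - q.1, q.2, y)) (by fun_prop)
    · have h0 : (Function.uncurry (backwardTest ν d β σ θ X t₁ y)) =ᶠ[𝓝 q] fun _ => 0 := by
        filter_upwards [continuous_fst.continuousAt.eventually
          ((isClosed_tsupport θ).isOpen_compl.mem_nhds hq)] with p hp
        have : θ p.1 = 0 := image_eq_zero_of_notMem_tsupport hp
        simp [Function.uncurry, backwardTest, this]
      exact contDiffAt_const.congr_of_eventuallyEq h0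
  · exact HasCompactSupport.of_support_subset_isCompact (hθc.isCompact.prod hXc.isCompact)
      ((subset_tsupport _).trans hsub)
  · exact ⟨(hθs (hsub hq).1).trans_le ht₁, mem_univ _⟩

theorem backwardTest_testDz (hν : 0 < ν) (hθs : tsupport θ ⊆ Iio t₁) {X : ℝ → ℝ}
    (hX : ContDiff ℝ ∞ X) (t z : ℝ) :
    testDz (backwardTest ν d β σ θ X t₁ y) (t, z) =
      ((θ t * (deriv X z * kern ν d β σ (t₁ - t) z y + X z * kernDy ν d β σ (t₁ - t) z y) : ℝ) : ℂ) := by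
  by_cases ht : t ∈ tsupport θ
  · have hp : 0 < t₁ - t := by simpa using hθs ht
    have h1 := ((hX.differentiable (by simp) z).hasDerivAt.mul
      (hasDerivAt_kern hν hp d β σ z y)).const_mul (θ t)
    refine (HasDerivAt.deriv ?_)
    convert! h1.ofReal_comp using 1
    funext z
    simp [backwardTest, mul_assoc]
  · have h0 : θ t = 0 := image_eq_zero_of_notMem_tsupport ht
    have : backwardTest ν d β σ θ X t₁ y t = fun _ => 0 := by
      funext z; simp [backwardTest, h0]
    simp [testDz, this, h0]

theorem backwardTest_testDzz (hν : 0 < ν) (hθs : tsupport θ ⊆ Iio t₁) {X : ℝ → ℝ}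
    (hX : ContDiff ℝ ∞ X) (t z : ℝ) :
    testDz (fun t z => testDz (backwardTest ν d β σ θ X t₁ y) (t, z)) (t, z) =
      ((θ t * (deriv (deriv X) z * kern ν d β σ (t₁ - t) z y +
        2 * (deriv X z * kernDy ν d β σ (t₁ - t) z y) +
        X z * kernDyy ν d β σ (t₁ - t) z y) : ℝ) : ℂ) := by
  simp_rw [backwardTest_testDz hν hθs hX]
  by_cases ht : t ∈ tsupport θ
  · have hp : 0 < t₁ - t := by simpa using hθs ht
    have hX1 : ContDiff ℝ ∞ (deriv X) := ((contDiff_infty_iff_deriv).1 hX).2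
    have h1 := (((hX1.differentiable (by simp) z).hasDerivAt.mul
      (hasDerivAt_kern hν hp d β σ z y)).add ((hX.differentiable (by simp) z).hasDerivAt.mul
      (hasDerivAt_kernDy hν hp d β σ z y))).const_mul (θ t)
    have h2 := h1.ofReal_comp
    refine (HasDerivAt.deriv ?_)
    convert! h2 using 2
    ring
  · have h0 : θ t = 0 := image_eq_zero_of_notMem_tsupport ht
    simp [testDz, h0]

/-- The backward kernel is annihilated by `∂_t + ν ∂_z² - d`. Combined with the formula for the
second space derivative, only terms with a derivative on one of the cutoffs survive. -/
theorem backwardTest_testDt (hν : 0 < ν) (hθ : ContDiff ℝ ∞ θ) (hθs : tsupport θ ⊆ Iio t₁)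
    (X : ℝ → ℝ) (t z : ℝ) :
    testDt (backwardTest ν d β σ θ X t₁ y) (t, z) =
      ((X z * (deriv θ t * kern ν d β σ (t₁ - t) z y - θ t * (ν * kernDyy ν d β σ (t₁ - t) z y -
        d * kern ν d β σ (t₁ - t) z y)) : ℝ) : ℂ) := by
  by_cases ht : t ∈ tsupport θ
  · have hp : 0 < t₁ - t := by simpa using hθs ht
    have h1 := ((hθ.differentiable (by simp) t).hasDerivAt.mul
      ((hasDerivAt_kern_time hν hp d β σ z y).comp_const_sub t₁ t)).const_mul (X z)
    refine (HasDerivAt.deriv ?_)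
    convert! h1.ofReal_comp using 1
    · funext t
      simp only [backwardTest, Pi.mul_apply]
      push_cast
      ring
    · push_cast
      ring
  · have h0 : θ =ᶠ[𝓝 t] fun _ => 0 := notMem_tsupport_iff_eventuallyEq.1 ht
    have h1 : deriv θ t = 0 := by rw [h0.deriv_eq, deriv_const]
    have h2 : (fun s => backwardTest ν d β σ θ X t₁ y s z) =ᶠ[𝓝 t] fun _ => 0 := by
      filter_upwards [h0] with s hs
      simp [backwardTest, hs]
    rw [testDt, h2.deriv_eq, deriv_const, h1, h0.eq_of_nhds]
    simp

end Duality

/-! ### Pairing homogeneous solutions with the backward kernel -/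

section Duality

variable {ν d β σ T : ℝ} {u u' : ℝ → ℝ → ℂ} {c : ℝ → ℂ} {θ : ℝ → ℝ} {t₁ y : ℝ}

/-- Weak solutions of the homogeneous problem with Robin parameter `β` for `σ = 1`, with the
Dirichlet condition for `σ = -1`. -/
structure IsHomogeneousSolution (ν d β σ T : ℝ) (u u' : ℝ → ℝ → ℂ) (c : ℝ → ℂ) : Prop where
  mem : MemLOneH1 T u u' c
  dirichlet : σ = -1 → ∀ᵐ t ∂(timeInterval T), c t = 0
  form : ∀ φ, IsTest T φ → (σ = -1 → ∀ t, φ t 0 = 0) →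
    heatForm ν d T u u' φ = ν * β * ∫ t in Ioo (0 : ℝ) T, c t * φ t 0

theorem exists_pos_le_sub_of_tsupport (hθc : HasCompactSupport θ) (hθs : tsupport θ ⊆ Iio t₁) :
    ∃ δ, 0 < δ ∧ ∀ t ∈ tsupport θ, δ ≤ t₁ - t := by
  rcases (tsupport θ).eq_empty_or_nonempty with h | h
  · exact ⟨1, one_pos, fun t ht => by simp [h] at ht⟩
  · obtain ⟨m, hm, hmax⟩ := hθc.isCompact.exists_isMaxOn h continuousOn_id
    refine ⟨t₁ - m, by simpa using hθs hm, fun t ht => ?_⟩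
    have : t ≤ m := hmax ht
    linarith

/-- The solution is tested with the truncated backward kernel and both space derivatives are moved
onto the test function. The boundary contributions cancel, and the commutators with the space cutoff
disappear as it is removed. Since `θ` need not vanish at `t = 0`, the zero initial condition is
encoded as well: the pairing of `u` with the kernel is not merely constant in time but zero. -/
theorem IsHomogeneousSolution.integral_deriv_mul (h : IsHomogeneousSolution ν d β σ T u u' c)
    (hν : 0 < ν) (hd : 0 ≤ d) (hβ : 0 ≤ β) (hσ : σ = 1 ∨ σ = -1 ∧ β = 0) (ht₀ : 0 < t₁)
    (ht₁ : t₁ ≤ T) (hy : 0 ≤ y) (hθ : ContDiff ℝ ∞ θ) (hθc : HasCompactSupport θ)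
    (hθs : tsupport θ ⊆ Iio t₁) :
    ∫ q, u q.1 q.2 * ((deriv θ q.1 * kern ν d β σ (t₁ - q.1) q.2 y : ℝ) : ℂ)
      ∂(timeInterval T).prod halfLine = 0 := by
  have hσ1 : |σ| ≤ 1 := by rcases hσ with h | ⟨h, -⟩ <;> simp [h]
  obtain ⟨X, M, hM, hX⟩ := exists_cutoff
  obtain ⟨δ, hδ, hδt⟩ := exists_pos_le_sub_of_tsupport hθc hθs
  obtain ⟨B, hB, hb⟩ := exists_kern_exp_bound (ν := ν) (d := d) (β := β) (σ := σ)
    hν hd hβ hσ1 ht₀ hδ y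
  obtain ⟨M0, h0⟩ := hθc.exists_bound_of_continuous hθ.continuous
  obtain ⟨M1, h1⟩ := hθc.deriv.exists_bound_of_continuous (hθ.continuous_deriv (by simp))
  have p0 : 0 ≤ M0 := (norm_nonneg _).trans (h0 0)
  have p1 : 0 ≤ M1 := (norm_nonneg _).trans (h1 0)
  set κ : ℝ × ℝ → ℝ := fun q => kern ν d β σ (t₁ - q.1) q.2 y with hκ
  set κ' : ℝ × ℝ → ℝ := fun q => kernDy ν d β σ (t₁ - q.1) q.2 y with hκ'
  have hκm : Measurable κ := (measurable_kern hν d β σ).comp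
    (f := fun q : ℝ × ℝ => (t₁ - q.1, q.2, y)) (by fun_prop)
  have hκm' : Measurable κ' := (measurable_kernDy hν d β σ).comp
    (f := fun q : ℝ × ℝ => (t₁ - q.1, q.2, y)) (by fun_prop)
  -- What remains of the adjoint operator applied to the test function: the term with the time
  -- derivative of `θ`, and the commutator terms carrying derivatives of the cutoff.
  set F : ℕ → ℝ × ℝ → ℝ := fun n q => X n q.2 * deriv θ q.1 * κ q +
    ν * θ q.1 * (deriv (deriv (X n)) q.2 * κ q + 2 * (deriv (X n) q.2 * κ' q)) with hF
  have hFm : ∀ n, Measurable (F n) := by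
    intro n
    have m1 : Measurable (X n) := (hX n).1.continuous.measurable
    have m2 : Measurable (deriv (X n)) := measurable_deriv _
    have m3 : Measurable (deriv (deriv (X n))) := measurable_deriv _
    have m4 : Measurable θ := hθ.continuous.measurable
    have m5 : Measurable (deriv θ) := measurable_deriv _
    fun_prop
  have hzero : ∀ n, ∫ q, u q.1 q.2 * (F n q : ℂ) ∂(timeInterval T).prod halfLine = 0 := by
    intro n
    obtain ⟨x1, x2, x3, x4, -⟩ := hX n
    have htest := isTest_backwardTest (d := d) (β := β) (σ := σ) (y := y) (T := T) hν hθ hθc hθs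
      ht₁ x1 x2
    have hbt0 : ∀ t, backwardTest ν d β σ θ (X n) t₁ y t 0 =
        ((θ t * kern ν d β σ (t₁ - t) 0 y : ℝ) : ℂ) := fun t => by simp [backwardTest, x3]
    have e1 := h.form _ htest (by
      intro hs t
      rw [hbt0]
      rcases hσ with h' | ⟨-, h'⟩
      · rw [hs] at h'; norm_num at h'
      · rw [hs, h', kern_dirichlet_zero]; simp)
    rw [h.mem.heatForm_eq htest.smooth htest.compact] at e1
    -- In the Robin and Neumann cases the kernel satisfies the same boundary condition as the
    -- solution and the cutoff has zero slope at `0`. In the Dirichlet case the trace of the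
    -- solution vanishes.
    have e2 : (ν : ℂ) * ∫ t in Ioo (0 : ℝ) T, c t *
        testDz (backwardTest ν d β σ θ (X n) t₁ y) (t, 0) =
        -(ν * β * ∫ t in Ioo (0 : ℝ) T, c t * backwardTest ν d β σ θ (X n) t₁ y t 0) := by
      rw [← integral_const_mul, ← integral_const_mul, ← integral_neg]
      rcases hσ with h' | ⟨h', -⟩
      · congr 1 with t
        rw [backwardTest_testDz hν hθs x1, hbt0, x3, x4, h', kernDy_zero]
        push_cast
        ring
      · refine integral_congr_ae ?_
        filter_upwards [h.dirichlet h'] with t ht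
        simp [ht]
    rw [e2] at e1
    have e3 : ∀ q : ℝ × ℝ, testDt (backwardTest ν d β σ θ (X n) t₁ y) q +
        ν * testDz (fun t z => testDz (backwardTest ν d β σ θ (X n) t₁ y) (t, z)) q -
        d * backwardTest ν d β σ θ (X n) t₁ y q.1 q.2 = (F n q : ℂ) := by
      rintro ⟨t, z⟩
      rw [backwardTest_testDt hν hθ hθs, backwardTest_testDzz hν hθs x1, backwardTest]
      simp only [hF, hκ, hκ']
      push_cast
      ring
    simp_rw [e3] at e1
    linear_combination -e1
  set K := M * M1 * B + ν * M0 * (M * B + 2 * (M * B)) with hK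
  -- Off the support of `θ` both `θ` and its derivative vanish; on it `t₁ - t ≥ δ`, so the
  -- exponential bounds apply uniformly in `n`.
  have hbound : ∀ n, ∀ q : ℝ × ℝ, 0 < q.1 → 0 < q.2 → |F n q| ≤ K * Real.exp (-q.2) := by
    rintro n ⟨t, z⟩ ht hz
    simp only at ht hz
    obtain ⟨-, -, -, -, x5, x6, x7, -⟩ := hX n
    by_cases hts : t ∈ tsupport θ
    · obtain ⟨b1, b2⟩ := hb (t₁ - t) (hδt t hts) (by linarith) y hy le_rfl z hz.le
      have a1 : |deriv θ t| ≤ M1 := h1 t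
      have a0 : |θ t| ≤ M0 := h0 t
      have hMn : M / ((n : ℝ) + 1) ≤ M :=
        div_le_self hM (by linarith [n.cast_nonneg (α := ℝ)])
      have a6 := (x6 z).trans hMn
      have a7 := (x7 z).trans hMn
      have a5 := x5 z
      set E := Real.exp (-z)
      have hE : 0 < E := Real.exp_pos _
      calc |F n (t, z)| ≤ |X n z| * |deriv θ t| * |κ (t, z)| + ν * |θ t| *
            (|deriv (deriv (X n)) z| * |κ (t, z)| + 2 * (|deriv (X n) z| * |κ' (t, z)|)) := by
            refine (abs_add_le _ _).trans ?_
            rw [abs_mul, abs_mul, abs_mul, abs_mul, abs_of_pos hν]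
            gcongr
            refine (abs_add_le _ _).trans ?_
            rw [abs_mul, abs_mul, abs_mul, abs_two]
        _ ≤ M * M1 * (B * E) + ν * M0 * (M * (B * E) + 2 * (M * (B * E))) := by gcongr
        _ = _ := by rw [hK]; ring
    · have z0 : θ =ᶠ[𝓝 t] fun _ => 0 := notMem_tsupport_iff_eventuallyEq.1 hts
      have z1 : deriv θ t = 0 := by rw [z0.deriv_eq, deriv_const]
      simp only [hF, z1, z0.eq_of_nhds]
      simp only [mul_zero, zero_mul, add_zero, abs_zero]
      positivity
  have hlim : Tendsto (fun n => ∫ q, u q.1 q.2 * (F n q : ℂ) ∂(timeInterval T).prod halfLine) atTop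
      (𝓝 (∫ q, u q.1 q.2 * ((deriv θ q.1 * κ q : ℝ) : ℂ) ∂(timeInterval T).prod halfLine)) := by
    have hmem : ∀ᵐ q : ℝ × ℝ ∂(timeInterval T).prod halfLine, 0 < q.1 ∧ 0 < q.2 := by
      rw [Measure.prod_restrict]
      filter_upwards [ae_restrict_mem (measurableSet_Ioo.prod measurableSet_Ioi)] with q hq
      exact ⟨hq.1.1, hq.2⟩
    have hK0 : 0 ≤ K := by positivity
    have hi := (h.mem.integrable_mul (ψ := fun q => ((K * Real.exp (-q.2) : ℝ) : ℂ))
      (B := ENNReal.ofReal K) ENNReal.ofReal_ne_top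
      (Continuous.aestronglyMeasurable (by fun_prop)) (fun t _ z _ => by
        rw [enorm_complex_ofReal, Real.enorm_eq_ofReal (by positivity), ENNReal.ofReal_mul hK0])).1
    refine tendsto_integral_of_dominated_convergence _ (fun n => h.mem.meas.mul
      (Complex.measurable_ofReal.comp (hFm n)).aestronglyMeasurable) hi.norm (fun n => ?_) ?_
    · filter_upwards [hmem] with q hq
      rw [norm_mul, norm_mul, Complex.norm_real, Complex.norm_real, Real.norm_eq_abs,
        Real.norm_eq_abs, abs_of_nonneg (show 0 ≤ K * Real.exp (-q.2) by positivity)]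
      gcongr
      exact hbound n q hq.1 hq.2
    · refine ae_of_all _ fun q => Tendsto.mul tendsto_const_nhds ?_
      refine (Complex.continuous_ofReal.tendsto _).comp ?_
      have hMn : Tendsto (fun n : ℕ => M / ((n : ℝ) + 1)) atTop (𝓝 0) :=
        by
        simpa [Function.comp_def] using
          (tendsto_const_div_atTop_nhds_zero_nat M).comp (tendsto_add_atTop_nat 1)
      have l1 : Tendsto (fun n => X n q.2) atTop (𝓝 1) := by
        refine tendsto_const_nhds.congr' ?_
        filter_upwards [eventually_ge_atTop ⌈|q.2|⌉₊] with n hn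
        exact ((hX n).2.2.2.2.2.2.2 q.2 (Nat.ceil_le.1 hn)).symm
      have l2 : Tendsto (fun n => deriv (X n) q.2) atTop (𝓝 0) :=
        squeeze_zero_norm (fun n => (hX n).2.2.2.2.2.1 q.2) hMn
      have l3 : Tendsto (fun n => deriv (deriv (X n)) q.2) atTop (𝓝 0) :=
        squeeze_zero_norm (fun n => (hX n).2.2.2.2.2.2.1 q.2) hMn
      have := ((l1.mul_const (deriv θ q.1)).mul_const (κ q)).add
        (((l3.mul_const (κ q)).add ((l2.mul_const (κ' q)).const_mul 2)).const_mul (ν * θ q.1))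
      simpa [hF] using this
  simp_rw [hzero] at hlim
  exact (tendsto_nhds_unique hlim tendsto_const_nhds)

/-- The primitive that vanishes to the right of `r` may be nonzero at `t = 0`; it is made compactly
supported by a cutoff equal to one on `[-⌈T⌉, ⌈T⌉]`. Hence every such `g`, without a mean-value
condition, is an admissible derivative on `(0, T)`. -/
theorem exists_primitive_cutoff {g : ℝ → ℝ} {r : ℝ} (hg : ContDiff ℝ ∞ g)
    (hgs : tsupport g ⊆ Ioo 0 r) (T : ℝ) :
    ∃ θ : ℝ → ℝ, ContDiff ℝ ∞ θ ∧ HasCompactSupport θ ∧ tsupport θ ⊆ Iic r ∧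
      ∀ t ∈ Ioo 0 T, deriv θ t = g t := by
  obtain ⟨X, M, -, hX⟩ := exists_cutoff
  obtain ⟨x1, x2, -, -, -, -, -, x8⟩ := hX ⌈T⌉₊
  set G : ℝ → ℝ := fun t => ∫ s in r..t, g s with hG
  have hGd : ∀ t, HasDerivAt G (g t) t := fun t =>
    intervalIntegral.integral_hasDerivAt_right (hg.continuous.intervalIntegrable _ _)
      (hg.continuous.stronglyMeasurableAtFilter _ _) hg.continuous.continuousAt
  have hGs : ContDiff ℝ ∞ G := by
    refine (contDiff_infty_iff_deriv).2 ⟨fun t => (hGd t).differentiableAt, ?_⟩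
    rwa [show deriv G = g from funext fun t => (hGd t).deriv]
  have hG0 : ∀ t, r < t → G t = 0 := by
    intro t ht
    rw [hG]
    simp only
    rw [intervalIntegral.integral_congr (g := fun _ => 0) fun s hs => ?_]
    · simp
    · rw [uIcc_of_le ht.le] at hs
      exact image_eq_zero_of_notMem_tsupport fun hmem => (hgs hmem).2.not_ge hs.1
  refine ⟨fun t => X ⌈T⌉₊ t * G t, x1.mul hGs, x2.mul_right, ?_, ?_⟩
  · refine closure_minimal (fun t ht => ?_) isClosed_Iic
    by_contra hlt
    exact ht (by simp [hG0 t (not_le.1 hlt)])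
  · intro t ht
    have he : (fun t => X ⌈T⌉₊ t * G t) =ᶠ[𝓝 t] G := by
      filter_upwards [Ioo_mem_nhds ht.1 ht.2] with s hs
      rw [x8 s, one_mul]
      rw [abs_of_pos hs.1]
      exact hs.2.le.trans (Nat.le_ceil T)
    rw [he.deriv_eq, (hGd t).deriv]

/-- The pairing integrates to zero against every smooth function supported in `(0, r)`, so it
vanishes almost everywhere there. The gap between `r` and `t₁` keeps the kernel away from its
singularity. The null set depends on `t₁`, `r` and `y`. -/
theorem IsHomogeneousSolution.ae_integral_kern (h : IsHomogeneousSolution ν d β σ T u u' c)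
    (hν : 0 < ν) (hd : 0 ≤ d) (hβ : 0 ≤ β) (hσ : σ = 1 ∨ σ = -1 ∧ β = 0) (ht₀ : 0 < t₁)
    (ht₁ : t₁ ≤ T) (hy : 0 ≤ y) {r : ℝ} (hr : r < t₁) :
    ∀ᵐ t, t ∈ Ioo 0 r →
      ∫ z in Ioi (0 : ℝ), u t z * (kern ν d β σ (t₁ - t) z y : ℂ) = 0 := by
  have hσ1 : |σ| ≤ 1 := by rcases hσ with h | ⟨h, -⟩ <;> simp [h]
  obtain ⟨B, hB, hb⟩ := exists_kern_exp_bound (ν := ν) (d := d) (β := β) (σ := σ)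
    hν hd hβ hσ1 ht₀ (sub_pos.2 hr) y
  set ψ : ℝ × ℝ → ℂ := fun q => (((Iio r).indicator 1 q.1 * kern ν d β σ (t₁ - q.1) q.2 y : ℝ) : ℂ)
    with hψ
  have hψm : Measurable ψ := by
    have m1 : Measurable ((Iio r).indicator (1 : ℝ → ℝ)) :=
      measurable_one.indicator measurableSet_Iio
    exact Complex.measurable_ofReal.comp ((m1.comp measurable_fst).mul
      ((measurable_kern hν d β σ).comp (f := fun q : ℝ × ℝ => (t₁ - q.1, q.2, y)) (by fun_prop)))
  have hint := (h.mem.integrable_mul (ψ := ψ) (B := ENNReal.ofReal B) ENNReal.ofReal_ne_top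
    hψm.aestronglyMeasurable (fun t ht z hz => by
      rw [hψ, enorm_complex_ofReal, Real.enorm_eq_ofReal_abs, ← ENNReal.ofReal_mul hB]
      refine ENNReal.ofReal_le_ofReal ?_
      by_cases htr : t < r
      · have := (hb (t₁ - t) (by linarith) (by linarith [ht.1]) y hy le_rfl z hz.le).1
        simpa [htr] using this
      · simp only [htr, mem_Iio, not_false_eq_true, indicator_of_notMem, zero_mul, abs_zero]
        positivity)).1
  have hm : IntegrableOn (fun t => ∫ z in Ioi (0 : ℝ), u t z * (kern ν d β σ (t₁ - t) z y : ℂ))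
      (Ioo 0 r) := by
    have h1 := hint.integral_prod_left
    have h2 : IntegrableOn (fun t => ∫ z in Ioi (0 : ℝ), u t z * ψ (t, z)) (Ioo 0 r) :=
      IntegrableOn.mono_set (t := Ioo 0 T) h1 (Ioo_subset_Ioo_right (hr.le.trans ht₁))
    refine h2.congr_fun (fun t ht => ?_) measurableSet_Ioo
    simp [hψ, ht.2]
  refine isOpen_Ioo.ae_eq_zero_of_integral_contDiff_smul_eq_zero hm.locallyIntegrableOn
    fun g hg hgc hgs => ?_
  obtain ⟨θ, hθ, hθc, hθs, hθd⟩ := exists_primitive_cutoff hg hgs T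
  have h0 := h.integral_deriv_mul hν hd hβ hσ ht₀ ht₁ hy hθ hθc
    (hθs.trans fun t (ht : t ≤ r) => ht.trans_lt hr)
  have hg0 : ∀ t, r ≤ t → g t = 0 := fun t ht =>
    image_eq_zero_of_notMem_tsupport fun hmem => (hgs hmem).2.not_ge ht
  obtain ⟨M, hM⟩ := hgc.exists_bound_of_continuous hg.continuous
  have hint2 : Integrable (fun q : ℝ × ℝ => (g q.1 : ℂ) * (u q.1 q.2 * ψ q))
      ((timeInterval T).prod halfLine) :=
    hint.bdd_mul (c := M) (Complex.continuous_ofReal.comp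
      (hg.continuous.comp continuous_fst)).aestronglyMeasurable (ae_of_all _ fun q => by
        rw [Complex.norm_real]; exact hM _)
  have h3 : ∫ q, u q.1 q.2 * ((deriv θ q.1 * kern ν d β σ (t₁ - q.1) q.2 y : ℝ) : ℂ)
      ∂(timeInterval T).prod halfLine =
      ∫ q, (g q.1 : ℂ) * (u q.1 q.2 * ψ q) ∂(timeInterval T).prod halfLine := by
    refine integral_congr_ae ?_
    rw [Measure.prod_restrict]
    filter_upwards [ae_restrict_mem (measurableSet_Ioo.prod measurableSet_Ioi)] with q hq
    rw [hθd q.1 hq.1]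
    by_cases htr : q.1 < r
    · simp [hψ, htr]; ring
    · simp [hg0 _ (not_lt.1 htr)]
  rw [h3, integral_prod _ hint2] at h0
  have h4 : ∫ t, g t • ∫ z in Ioi (0 : ℝ), u t z * (kern ν d β σ (t₁ - t) z y : ℂ) =
      ∫ t in Ioo (0 : ℝ) T, g t • ∫ z in Ioi (0 : ℝ), u t z * (kern ν d β σ (t₁ - t) z y : ℂ) := by
    refine (setIntegral_eq_integral_of_forall_compl_eq_zero fun t ht => ?_).symm
    rw [image_eq_zero_of_notMem_tsupport (f := g)
      fun hmem => ht ⟨(hgs hmem).1, (hgs hmem).2.trans (hr.trans_le ht₁)⟩, zero_smul]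
  rw [h4, ← h0]
  refine integral_congr_ae (ae_of_all _ fun t => ?_)
  simp only
  rw [integral_const_mul, Complex.real_smul]
  by_cases htr : t < r
  · simp [hψ, htr]
  · simp [hg0 _ (not_lt.1 htr)]

end Duality

theorem frequently_rat_nhdsGT (x : ℝ) : ∃ᶠ y in 𝓝[>] x, ∃ q : ℚ, (q : ℝ) = y := by
  rw [frequently_iff]
  intro U hU
  obtain ⟨b, hb, hsub⟩ := mem_nhdsGT_iff_exists_Ioo_subset.1 hU
  obtain ⟨q, hq1, hq2⟩ := exists_rat_btwn (mem_Ioi.1 hb)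
  exact ⟨q, hsub ⟨hq1, hq2⟩, q, rfl⟩

/-- Completing the square: an exponential tilt of a Gaussian is a shift. This lets the heat
evolution inherit exponential decay from its datum. -/
theorem heat_mul_exp {ν t : ℝ} (hν : 0 < ν) (ht : 0 < t) (x : ℝ) :
    heat ν t x * Real.exp (-x) = Real.exp (ν * t) * heat ν t (x + 2 * ν * t) := by
  rw [heat, heat, mul_assoc, ← Real.exp_add, mul_left_comm, ← Real.exp_add]
  congr 2
  field_simp
  ring

/-- Uniform exponential decay of heat evolutions of exponentially decaying functions. -/
theorem exists_integral_kern_le {ν d β σ : ℝ} (hν : 0 < ν) (hd : 0 ≤ d) (hβ : 0 ≤ β)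
    (hσ : |σ| ≤ 1) {g : ℝ → ℝ} {B : ℝ} (hg : ∀ y, 0 < y → |g y| ≤ B * Real.exp (-y)) :
    ∃ C, 0 ≤ C ∧ ∀ ε, 0 < ε → ε ≤ 1 → ∀ z, 0 ≤ z →
      ‖∫ y in Ioi (0 : ℝ), (kern ν d β σ ε y z : ℂ) * (g y : ℂ)‖ ≤ C * Real.exp (-z) := by
  have hB : 0 ≤ B := by
    have := (abs_nonneg _).trans (hg 1 one_pos)
    exact nonneg_of_mul_nonneg_left this (Real.exp_pos _)
  obtain ⟨C, hC, h⟩ := exists_kern_le (ν := ν) (d := d) (β := β) (σ := σ) hν hd hβ hσ one_pos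
  refine ⟨C * B * Real.exp (2 * ν), by positivity, fun ε hε hε1 z hz => ?_⟩
  have h2ε : 0 < 2 * ε := by linarith
  have hi : Integrable fun y => heat ν (2 * ε) (y - z + 2 * ν * (2 * ε)) :=
    ((integrable_heat hν h2ε).comp_add_right (2 * ν * (2 * ε))).comp_sub_right z
  set K := C * B * Real.exp (ν * (2 * ε)) * Real.exp (-z)
  have hb : ∀ y ∈ Ioi (0 : ℝ), ‖(kern ν d β σ ε y z : ℂ) * (g y : ℂ)‖ ≤
      K * heat ν (2 * ε) (y - z + 2 * ν * (2 * ε)) := by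
    intro y hy
    rw [norm_mul, Complex.norm_real, Complex.norm_real, Real.norm_eq_abs, Real.norm_eq_abs]
    have h1 := (h ε hε hε1 y (mem_Ioi.1 hy).le z hz).1
    have h2 := hg y hy
    have h3 := heat_nonneg ν (2 * ε) (y - z)
    calc _ ≤ (C * heat ν (2 * ε) (y - z)) * (B * Real.exp (-y)) := by gcongr
      _ = C * B * Real.exp (-z) * (heat ν (2 * ε) (y - z) * Real.exp (-(y - z))) := by
          rw [show -y = -z + -(y - z) by ring, Real.exp_add]; ring
      _ = _ := by rw [heat_mul_exp hν h2ε]; ring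
  refine (norm_integral_le_of_norm_le (hi.const_mul K).integrableOn
    ((ae_restrict_iff' measurableSet_Ioi).2 (ae_of_all _ hb))).trans ?_
  rw [integral_const_mul]
  have h1 : ∫ y in Ioi (0 : ℝ), heat ν (2 * ε) (y - z + 2 * ν * (2 * ε)) ≤ 1 := by
    refine (setIntegral_le_integral hi (ae_of_all _ fun y => heat_nonneg _ _ _)).trans ?_
    rw [integral_sub_right_eq_self (fun y => heat ν (2 * ε) (y + 2 * ν * (2 * ε))) z,
      integral_add_right_eq_self (heat ν (2 * ε)), integral_heat hν h2ε]
  have hK : 0 ≤ K := by positivity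
  calc _ ≤ K * 1 := by gcongr
    _ ≤ C * B * Real.exp (2 * ν) * Real.exp (-z) := by
      rw [mul_one]
      have h2 : Real.exp (ν * (2 * ε)) ≤ Real.exp (2 * ν) := Real.exp_le_exp.2 (by nlinarith)
      have h3 : 0 ≤ C * B := by positivity
      exact mul_le_mul_of_nonneg_right (mul_le_mul_of_nonneg_left h2 h3) (Real.exp_pos _).le

/-! ### From vanishing pairings to vanishing solutions -/

section Uniqueness

variable {ν d β σ T : ℝ} {u u' : ℝ → ℝ → ℂ} {c : ℝ → ℂ}

theorem MemLp.integrable_mul_exp {v : ℝ → ℂ} (hv : MemLp v 2 halfLine) (C : ℝ) :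
    Integrable (fun z => ‖v z‖ * (C * Real.exp (-z))) halfLine := by
  have h2 : MemLp (fun z : ℝ => ((Real.exp (-z) : ℝ) : ℂ)) 2 halfLine := by
    refine ⟨Continuous.aestronglyMeasurable (by fun_prop), ?_⟩
    refine (eLpNorm_exp_neg_le 1 fun z _ => ?_).trans_lt ENNReal.one_lt_top
    rw [enorm_complex_ofReal, Real.enorm_eq_ofReal_abs, Real.abs_exp, one_mul]
  refine ((hv.norm.integrable_mul h2.norm).const_mul C).congr (ae_of_all _ fun z => ?_)
  simp only [Pi.mul_apply, Complex.norm_real, Real.norm_eq_abs, Real.abs_exp]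
  ring

/-- For a test function `g`, the pairing of `v` with the evolution of `g` equals, by symmetry of the
kernel and Fubini, an integral of the vanishing pairings. As `ε → 0` the evolution tends to `g`
under an exponential majorant, so `v` is orthogonal to `g`. It suffices that the hypothesis holds
along some sequence of times and at rational sources. -/
theorem eq_zero_of_integral_kern {v : ℝ → ℂ} (hv : MemLp v 2 halfLine) (hν : 0 < ν) (hd : 0 ≤ d)
    (hβ : 0 ≤ β) (hσ : σ = 1 ∨ σ = -1 ∧ β = 0)
    (h0 : ∃ᶠ ε in 𝓝[>] (0 : ℝ), ∀ q : ℚ, 0 < (q : ℝ) →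
      ∫ z in Ioi (0 : ℝ), v z * (kern ν d β σ ε z q : ℂ) = 0) :
    ∀ᵐ z ∂halfLine, v z = 0 := by
  have hσ1 : |σ| ≤ 1 := by rcases hσ with h | ⟨h, -⟩ <;> simp [h]
  have hloc : LocallyIntegrableOn v (Ioi 0) := by
    refine (locallyIntegrableOn_iff isOpen_Ioi.isLocallyClosed).2 fun K hK hKc => ?_
    have h1 := hv.restrict K
    rw [Measure.restrict_restrict hKc.measurableSet, inter_eq_left.2 hK] at h1
    have : Fact (volume K < ⊤) := ⟨hKc.measure_lt_top⟩
    exact h1.integrable (by norm_num)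
  refine (ae_restrict_iff' measurableSet_Ioi).2
    (isOpen_Ioi.ae_eq_zero_of_integral_contDiff_smul_eq_zero hloc fun g hg hgc hgs => ?_)
  have hgC : HasCompactSupport fun y => (g y : ℂ) :=
    hgc.comp_left (g := fun r : ℝ => (r : ℂ)) Complex.ofReal_zero
  have hg0 : ∀ y, y ≤ 0 → g y = 0 := fun y hy =>
    image_eq_zero_of_notMem_tsupport fun hmem => (mem_Ioi.1 (hgs hmem)).not_ge hy
  obtain ⟨R, hR⟩ := hgc.isBounded.subset_closedBall (0 : ℝ)
  have hgR : ∀ y, R < y → g y = 0 := fun y hy => image_eq_zero_of_notMem_tsupport fun hmem => by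
    have := hR hmem
    rw [mem_closedBall_zero_iff, Real.norm_eq_abs] at this
    linarith [le_abs_self y]
  obtain ⟨M, hM⟩ := hgc.exists_bound_of_continuous hg.continuous
  have hM0 : 0 ≤ M := (norm_nonneg _).trans (hM 0)
  have hgexp : ∀ y, 0 < y → |g y| ≤ M * Real.exp R * Real.exp (-y) := by
    intro y hy
    rcases le_or_gt y R with h | h
    · rw [mul_assoc, ← Real.exp_add]
      exact (hM y).trans (le_mul_of_one_le_right hM0 (Real.one_le_exp (by linarith)))
    · rw [hgR y h, abs_zero]; positivity
  obtain ⟨C, hC, hJ⟩ := exists_integral_kern_le (d := d) (β := β) (σ := σ) hν hd hβ hσ1 hgexp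
  -- the pairing with the evolution of `g` vanishes
  have hzero : ∃ᶠ ε in 𝓝[>] (0 : ℝ), ∫ z in Ioi (0 : ℝ),
      v z * ∫ y in Ioi (0 : ℝ), (kern ν d β σ ε y z : ℂ) * (g y : ℂ) = 0 := by
    refine (h0.and_eventually (Ioo_mem_nhdsGT one_pos)).mono ?_
    rintro ε ⟨hq, hε⟩
    obtain ⟨B, hB, hb⟩ := exists_kern_exp_bound (ν := ν) (d := d) (β := β) (σ := σ)
      hν hd hβ hσ1 one_pos hε.1 (|R| + 1)
    have hkc : ∀ z, Continuous fun y => kern ν d β σ ε z y := fun z => by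
      simp_rw [kern_symm ν d β σ ε z]
      exact continuous_iff_continuousAt.2 fun y => (hasDerivAt_kern hν hε.1 d β σ y z).continuousAt
    have hkc' : ∀ y, Continuous fun z => kern ν d β σ ε z y := fun y =>
      continuous_iff_continuousAt.2 fun z => (hasDerivAt_kern hν hε.1 d β σ z y).continuousAt
    -- Continuity in the source point extends the vanishing from rational to real points. The range
    -- goes slightly beyond the support of `g`.
    have hF : ∀ y, 0 < y → y < |R| + 1 →
        ∫ z in Ioi (0 : ℝ), v z * (kern ν d β σ ε z y : ℂ) = 0 := by
      intro y hy hyR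
      have hcont : ContinuousAt
          (fun y => ∫ z in Ioi (0 : ℝ), v z * (kern ν d β σ ε z y : ℂ)) y := by
        refine continuousAt_of_dominated (bound := fun z => ‖v z‖ * (B * Real.exp (-z))) ?_ ?_
          (MemLp.integrable_mul_exp hv B) ?_
        · exact Eventually.of_forall fun y => hv.1.mul
            (Complex.continuous_ofReal.comp (hkc' y)).aestronglyMeasurable
        · filter_upwards [Ioo_mem_nhds hy hyR] with x hx
          filter_upwards [ae_restrict_mem measurableSet_Ioi] with z hz
          rw [norm_mul, Complex.norm_real, Real.norm_eq_abs]
          gcongr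
          exact (hb ε le_rfl hε.2.le x hx.1.le hx.2.le z (mem_Ioi.1 hz).le).1
        · exact ae_of_all _ fun z => (continuous_const.mul
            (Complex.continuous_ofReal.comp (hkc z))).continuousAt
      refine tendsto_nhds_unique_of_frequently_eq
        (hcont.tendsto.mono_left (nhdsWithin_le_nhds (s := Ioi y))) tendsto_const_nhds ?_
      refine ((frequently_rat_nhdsGT y).and_eventually self_mem_nhdsWithin).mono ?_
      rintro x ⟨⟨q, rfl⟩, hx⟩
      exact hq q (hy.trans hx)
    have hprod : Integrable (fun p : ℝ × ℝ => v p.1 * ((kern ν d β σ ε p.2 p.1 : ℂ) * (g p.2 : ℂ)))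
        (halfLine.prod halfLine) := by
      have hgi : Integrable (fun y => ‖g y‖) halfLine :=
        (hg.continuous.integrable_of_hasCompactSupport hgc).norm.integrableOn
      refine Integrable.mono' ((MemLp.integrable_mul_exp hv B).mul_prod hgi) ?_ ?_
      · refine hv.1.comp_fst.mul (Measurable.aestronglyMeasurable ?_)
        have m1 : Measurable fun p : ℝ × ℝ => kern ν d β σ ε p.2 p.1 :=
          (measurable_kern hν d β σ).comp (f := fun p : ℝ × ℝ => (ε, p.2, p.1)) (by fun_prop)
        have m2 := hg.continuous.measurable
        fun_prop
      · rw [Measure.prod_restrict]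
        filter_upwards [ae_restrict_mem (measurableSet_Ioi.prod measurableSet_Ioi)] with p hp
        rw [norm_mul, norm_mul, Complex.norm_real, Complex.norm_real, ← mul_assoc]
        rcases le_or_gt p.2 R with h | h
        · gcongr
          rw [kern_symm, Real.norm_eq_abs]
          exact (hb ε le_rfl hε.2.le p.2 (mem_Ioi.1 hp.2).le (by linarith [le_abs_self R]) p.1
            (mem_Ioi.1 hp.1).le).1
        · simp [hgR _ h]
    have e1 : ∀ z, v z * ∫ y in Ioi (0 : ℝ), (kern ν d β σ ε y z : ℂ) * (g y : ℂ) =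
        ∫ y in Ioi (0 : ℝ), v z * ((kern ν d β σ ε y z : ℂ) * (g y : ℂ)) := fun z =>
      (integral_const_mul _ _).symm
    simp_rw [e1]
    rw [integral_integral_swap hprod]
    refine integral_eq_zero_of_ae ?_
    filter_upwards [ae_restrict_mem measurableSet_Ioi] with y hy
    have e2 : ∀ z, v z * ((kern ν d β σ ε y z : ℂ) * (g y : ℂ)) =
        (v z * (kern ν d β σ ε z y : ℂ)) * (g y : ℂ) := fun z => by
      rw [kern_symm]; ring
    simp_rw [e2]
    rw [integral_mul_const]
    rcases le_or_gt y R with h | h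
    · rw [hF y hy (by linarith [le_abs_self R])]; simp
    · simp [hgR _ h]
  have hlim : Tendsto (fun ε => ∫ z in Ioi (0 : ℝ),
      v z * ∫ y in Ioi (0 : ℝ), (kern ν d β σ ε y z : ℂ) * (g y : ℂ)) (𝓝[>] 0)
      (𝓝 (∫ z in Ioi (0 : ℝ), v z * (g z : ℂ))) := by
    refine tendsto_integral_filter_of_dominated_convergence
      (fun z => ‖v z‖ * (C * Real.exp (-z))) ?_ ?_ (MemLp.integrable_mul_exp hv C) ?_
    · refine Eventually.of_forall fun ε => hv.1.mul ?_
      refine StronglyMeasurable.aestronglyMeasurable ?_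
      refine StronglyMeasurable.integral_prod_right
        (f := fun z y => (kern ν d β σ ε y z : ℂ) * (g y : ℂ)) (Measurable.stronglyMeasurable ?_)
      have m1 : Measurable fun p : ℝ × ℝ => kern ν d β σ ε p.2 p.1 :=
        (measurable_kern hν d β σ).comp (f := fun p : ℝ × ℝ => (ε, p.2, p.1)) (by fun_prop)
      have m2 := hg.continuous.measurable
      change Measurable fun p : ℝ × ℝ => (kern ν d β σ ε p.2 p.1 : ℂ) * (g p.2 : ℂ)
      fun_prop
    · filter_upwards [Ioo_mem_nhdsGT one_pos] with ε hε
      filter_upwards [ae_restrict_mem measurableSet_Ioi] with z hz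
      rw [norm_mul]
      gcongr
      exact hJ ε hε.1 hε.2.le z (mem_Ioi.1 hz).le
    · filter_upwards [ae_restrict_mem measurableSet_Ioi] with z hz
      refine Tendsto.mul tendsto_const_nhds ?_
      exact tendsto_integral_kern (d := d) (σ := σ) hν hβ (Φ := fun q : ℝ × ℝ => (g q.2 : ℂ))
        (B := M) (Complex.continuous_ofReal.comp (hg.continuous.comp continuous_snd))
        (fun q => by rw [Complex.norm_real]; exact hM _)
        (hσ.imp id fun h => ⟨h.1, fun ε => by simp [hg0 0 le_rfl]⟩) (mem_Ioi.1 hz).le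
  have hres := tendsto_nhds_unique_of_frequently_eq hlim tendsto_const_nhds hzero
  rw [← hres, ← setIntegral_eq_integral_of_forall_compl_eq_zero (s := Ioi (0 : ℝ)) fun z hz => by
    rw [hg0 z (not_lt.1 hz), zero_smul]]
  congr 1 with z
  rw [Complex.real_smul, mul_comm]

/-- Homogeneous weak solutions vanish. -/
theorem IsHomogeneousSolution.eq_zero (h : IsHomogeneousSolution ν d β σ T u u' c)
    (hν : 0 < ν) (hd : 0 ≤ d) (hβ : 0 ≤ β) (hσ : σ = 1 ∨ σ = -1 ∧ β = 0) :
    ∀ᵐ q ∂(timeInterval T).prod halfLine, u q.1 q.2 = 0 := by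
  -- Restricting the three parameters to rationals yields a single null set of times; rational `t₁`
  -- still accumulate at every `t` from the right.
  have h1 : ∀ᵐ t, ∀ t₁ r y : ℚ, 0 < (t₁ : ℝ) → (t₁ : ℝ) ≤ T → 0 < (y : ℝ) → (r : ℝ) < t₁ →
      t ∈ Ioo 0 (r : ℝ) → ∫ z in Ioi (0 : ℝ), u t z * (kern ν d β σ (t₁ - t) z y : ℂ) = 0 := by
    refine ae_all_iff.2 fun t₁ => ae_all_iff.2 fun r => ae_all_iff.2 fun y => ?_
    by_cases hc : 0 < (t₁ : ℝ) ∧ (t₁ : ℝ) ≤ T ∧ 0 < (y : ℝ) ∧ (r : ℝ) < t₁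
    · filter_upwards [h.ae_integral_kern hν hd hβ hσ hc.1 hc.2.1 hc.2.2.1.le hc.2.2.2] with t ht
      exact fun _ _ _ _ => ht
    · exact ae_of_all _ fun t a1 a2 a3 a4 => absurd ⟨a1, a2, a3, a4⟩ hc
  have h2 : ∀ᵐ t ∂(timeInterval T), ∀ᵐ z ∂halfLine, u t z = 0 := by
    filter_upwards [ae_restrict_of_ae h1, h.mem.isH1, ae_restrict_mem measurableSet_Ioo]
      with t ht1 htH ht
    refine eq_zero_of_integral_kern htH.memLp hν hd hβ hσ ?_
    have hmap : Tendsto (fun x : ℝ => x - t) (𝓝[>] t) (𝓝[>] 0) := by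
      refine tendsto_nhdsWithin_iff.2 ⟨?_, ?_⟩
      · refine Tendsto.mono_left ?_ nhdsWithin_le_nhds
        have : Continuous fun x : ℝ => x - t := by fun_prop
        simpa using this.tendsto t
      · filter_upwards [self_mem_nhdsWithin] with x hx
        simpa using hx
    refine hmap.frequently (((frequently_rat_nhdsGT t).and_eventually
      (Ioo_mem_nhdsGT ht.2)).mono ?_)
    rintro x ⟨⟨t₁, rfl⟩, hx⟩ y hy
    obtain ⟨r, hr1, hr2⟩ := exists_rat_btwn hx.1
    exact ht1 t₁ r y (ht.1.trans hx.1) hx.2.le hy hr2 ⟨ht.1, hr1⟩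
  have h3 : ∫⁻ q, ‖Function.uncurry u q‖ₑ ∂(timeInterval T).prod halfLine = 0 := by
    rw [lintegral_prod _ h.mem.meas.enorm]
    rw [lintegral_congr_ae (g := fun _ => 0)]
    · simp
    · filter_upwards [h2] with t ht
      rw [lintegral_congr_ae (g := fun _ => 0)]
      · simp
      · filter_upwards [ht] with z hz
        simp [Function.uncurry, hz]
  have h4 := (lintegral_eq_zero_iff' h.mem.meas.enorm).1 h3
  filter_upwards [h4] with q hq
  simpa [Function.uncurry] using hq

end Uniqueness

/-! ### The sources of the Duhamel formula -/

/-- The measure carrying the initial datum. -/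
def initMeasure : Measure (ℝ × ℝ) := halfLine.map (Prod.mk (0 : ℝ))

/-- The measure carrying the boundary datum. -/
def bdryMeasure (T : ℝ) : Measure (ℝ × ℝ) := (timeInterval T).map fun s => (s, (0 : ℝ))

theorem measurableEmbedding_init : MeasurableEmbedding (Prod.mk (0 : ℝ) : ℝ → ℝ × ℝ) :=
  measurableEmbedding_prodMk_left 0

theorem measurableEmbedding_bdry : MeasurableEmbedding (fun s : ℝ => (s, (0 : ℝ))) :=
  MeasurableEmbedding.id.prodMk_right 0

instance : SFinite initMeasure := inferInstanceAs (SFinite (Measure.map _ _))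

instance (T : ℝ) : SFinite (bdryMeasure T) := inferInstanceAs (SFinite (Measure.map _ _))

section Sources

variable {ν T : ℝ}

theorem pot_init (k : ℝ → ℝ → ℝ → ℝ) (u : ℝ → ℂ) (t y : ℝ) :
    pot k initMeasure (fun p => u p.2) t y = ∫ z in Ioi (0 : ℝ), (k t y z : ℂ) * u z := by
  rw [pot, initMeasure, measurableEmbedding_init.integral_map]
  simp

theorem pot_bdry (k : ℝ → ℝ → ℝ → ℝ) (q : ℝ → ℂ) (t y : ℝ) :
    pot k (bdryMeasure T) (fun p => q p.1) t y =
      ∫ s in Ioo (0 : ℝ) T, (k (t - s) y 0 : ℂ) * q s := by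
  rw [pot, bdryMeasure, measurableEmbedding_bdry.integral_map]

theorem potMajZero_init_le (hν : 0 < ν) (u : ℝ → ℂ) (t y : ℝ) :
    potMajZero ν initMeasure (fun p => u p.2) t y ≤
      ENNReal.ofReal ((Real.sqrt (8 * Real.pi * ν))⁻¹) * tpow (1 / 2) t *
        ∫⁻ z in Ioi (0 : ℝ), ‖u z‖ₑ := by
  rw [potMajZero, initMeasure, measurableEmbedding_init.lintegral_map,
    ← lintegral_const_mul' _ _ (ENNReal.mul_ne_top ENNReal.ofReal_ne_top (tpow_ne_top _ _))]
  refine lintegral_mono fun z => ?_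
  simp only [sub_zero]
  gcongr
  exact eheat_le hν _ _

/-- Minkowski's inequality combines the factor `t ^ (-1/2)` of the derivative with the `L²` norm `t
^ (-1/4)` of the Gaussian. Since `3/4 < 1`, integrable initial data suffice for `L¹(0, T; H¹)`. -/
theorem eLpNorm_potMaj_init_le (hν : 0 < ν) {u : ℝ → ℂ} (hu : AEStronglyMeasurable u halfLine)
    (t : ℝ) :
    eLpNorm (potMaj ν initMeasure (fun p => u p.2) t) 2 halfLine ≤
      heatConst ν * tpow (3 / 4) t * ∫⁻ z in Ioi (0 : ℝ), ‖u z‖ₑ := by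
  have e : potMaj ν initMeasure (fun p => u p.2) t = fun y =>
      ∫⁻ z in Ioi (0 : ℝ), (tpow (1 / 2) t * ‖u z‖ₑ) * eheat ν (2 * t) (y - z) := by
    funext y
    rw [potMaj, initMeasure, measurableEmbedding_init.lintegral_map]
    simp only [sub_zero]
    congr 1 with z
    ring
  have hm : AEMeasurable (Function.uncurry fun y z : ℝ =>
      (tpow (1 / 2) t * ‖u z‖ₑ) * eheat ν (2 * t) (y - z)) (halfLine.prod halfLine) :=
    (hu.enorm.const_mul (tpow (1 / 2) t)).comp_snd.mul
      ((measurable_eheat ν).comp (f := fun p : ℝ × ℝ => (2 * t, p.1 - p.2)) (by fun_prop)).aemeasurable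
  rw [e, ← lintegral_const_mul' _ _ (ENNReal.mul_ne_top (heatConst_lt_top ν).ne (tpow_ne_top _ _))]
  refine (eLpNorm_lintegral_le hm).trans (lintegral_mono fun z => ?_)
  refine (eLpNorm_const_mul_le (ENNReal.mul_ne_top (tpow_ne_top _ _) enorm_ne_top) _ _).trans ?_
  calc _ ≤ tpow (1 / 2) t * ‖u z‖ₑ * (heatConst ν * tpow (1 / 4) t) := by
        gcongr
        exact eLpNorm_eheat_le hν t z _
    _ = heatConst ν * (tpow (1 / 2) t * tpow (1 / 4) t) * ‖u z‖ₑ := by ring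
    _ = _ := by rw [tpow_mul]; norm_num

theorem isSource_init (hν : 0 < ν) (hT : 0 < T) {u : ℝ → ℂ} (hu : Integrable u halfLine) :
    IsSource ν T initMeasure fun p => u p.2 := by
  have h0 := hu.2
  rw [HasFiniteIntegral] at h0
  refine ⟨?_, ?_, ?_, ?_⟩
  · exact measurableEmbedding_init.aestronglyMeasurable_map_iff.2 hu.1
  · rw [initMeasure, measurableEmbedding_init.ae_map_iff]
    filter_upwards [ae_restrict_mem measurableSet_Ioi] with z hz
    exact ⟨le_rfl, hT, (mem_Ioi.1 hz).le⟩
  · refine (lintegral_mono fun t => eLpNorm_potMaj_init_le hν hu.1 t).trans_lt ?_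
    rw [lintegral_mul_const' _ _ h0.ne, lintegral_const_mul' _ _ (heatConst_lt_top ν).ne]
    exact ENNReal.mul_lt_top (ENNReal.mul_lt_top (heatConst_lt_top ν)
      (lintegral_tpow_lt_top (by norm_num) T)) h0
  · refine (lintegral_mono fun t => potMajZero_init_le hν u t 0).trans_lt ?_
    rw [lintegral_mul_const' _ _ h0.ne, lintegral_const_mul' _ _ ENNReal.ofReal_ne_top]
    exact ENNReal.mul_lt_top (ENNReal.mul_lt_top ENNReal.ofReal_lt_top
      (lintegral_tpow_lt_top (by norm_num) T)) h0

/-- Sources with bounded majorants. -/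
structure IsBddSource (ν T : ℝ) (ρ : Measure (ℝ × ℝ)) (a : ℝ × ℝ → ℂ) : Prop where
  meas : AEStronglyMeasurable a ρ
  supp : ∀ᵐ p ∂ρ, 0 ≤ p.1 ∧ p.1 < T ∧ 0 ≤ p.2
  bdd : ∃ M : ℝ≥0∞, M ≠ ⊤ ∧ ∀ t ≤ T, eLpNorm (potMaj ν ρ a t) 2 halfLine ≤ M ∧
    ∀ y, potMajZero ν ρ a t y ≤ M

theorem IsBddSource.isSource {ρ : Measure (ℝ × ℝ)} {a : ℝ × ℝ → ℂ} (h : IsBddSource ν T ρ a) :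
    IsSource ν T ρ a := by
  obtain ⟨M, hM, hb⟩ := h.bdd
  have hfin : ∫⁻ _ in Ioo (0 : ℝ) T, M < ⊤ := by
    rw [setLIntegral_const]
    exact ENNReal.mul_lt_top hM.lt_top measure_Ioo_lt_top
  refine ⟨h.meas, h.supp, ?_, ?_⟩
  · exact (setLIntegral_mono' measurableSet_Ioo fun t ht => (hb t ht.2.le).1).trans_lt hfin
  · exact (setLIntegral_mono' measurableSet_Ioo fun t ht => (hb t ht.2.le).2 0).trans_lt hfin

theorem lintegral_mul_tpow_mul_le (b : ℝ) {C M : ℝ≥0∞} (hC : C ≠ ⊤) (hM : M ≠ ⊤) {t : ℝ}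
    (ht : t ≤ T) : ∫⁻ s in Ioo (0 : ℝ) T, C * tpow b (t - s) * M ≤
      C * (∫⁻ s in Ioo (0 : ℝ) T, tpow b s) * M := by
  rw [lintegral_mul_const' _ _ hM, lintegral_const_mul' _ _ hC]
  gcongr C * ?_ * M
  exact lintegral_tpow_sub_le b ht

/-- In `L²`, Schur's test in space leaves only the integrable factor `(t - s) ^ (-1/2)`. Pointwise,
Cauchy–Schwarz in space leaves `(t - s) ^ (-1/4)`. -/
theorem isBddSource_force (hν : 0 < ν) {F : ℝ → ℝ → ℂ}
    (hF : AEStronglyMeasurable (Function.uncurry F) ((timeInterval T).prod halfLine))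
    {M : ℝ≥0∞} (hM : M ≠ ⊤) (hFM : ∀ᵐ t ∂(timeInterval T), eLpNorm (F t) 2 halfLine ≤ M) :
    IsBddSource ν T ((timeInterval T).prod halfLine) (Function.uncurry F) := by
  have h1 : ∀ᵐ t ∂(timeInterval T), AEStronglyMeasurable (F t) halfLine := hF.prodMk_left
  refine ⟨hF, ?_, heatConst ν * (∫⁻ s in Ioo (0 : ℝ) T, tpow (1 / 4) s) * M +
    1 * (∫⁻ s in Ioo (0 : ℝ) T, tpow (1 / 2) s) * M, ?_, fun t ht => ⟨?_, fun y => ?_⟩⟩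
  · rw [Measure.prod_restrict]
    filter_upwards [ae_restrict_mem (measurableSet_Ioo.prod measurableSet_Ioi)] with p hp
    exact ⟨hp.1.1.le, hp.1.2, (mem_Ioi.1 hp.2).le⟩
  · exact ENNReal.add_ne_top.2 ⟨ENNReal.mul_ne_top (ENNReal.mul_ne_top (heatConst_lt_top ν).ne
      (lintegral_tpow_lt_top (by norm_num) T).ne) hM, ENNReal.mul_ne_top (ENNReal.mul_ne_top
      ENNReal.one_ne_top (lintegral_tpow_lt_top (by norm_num) T).ne) hM⟩
  · have hkm : ∀ s : ℝ, Measurable (Function.uncurry fun y z : ℝ => eheat ν (2 * (t - s)) (y - z)) :=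
      fun s => (measurable_eheat ν).comp (f := fun p : ℝ × ℝ => (2 * (t - s), p.1 - p.2)) (by fun_prop)
    have hm3 : AEMeasurable (fun p : ℝ × (ℝ × ℝ) => tpow (1 / 2) (t - p.2.1) *
        eheat ν (2 * (t - p.2.1)) (p.1 - p.2.2) * ‖Function.uncurry F p.2‖ₑ)
        (halfLine.prod ((timeInterval T).prod halfLine)) := by
      have hk1 : Measurable fun p : ℝ × (ℝ × ℝ) => tpow (1 / 2) (t - p.2.1) :=
        (measurable_tpow _).comp (by fun_prop)
      have hk2 : Measurable fun p : ℝ × (ℝ × ℝ) => eheat ν (2 * (t - p.2.1)) (p.1 - p.2.2) :=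
        (measurable_eheat ν).comp (f := fun p : ℝ × (ℝ × ℝ) => (2 * (t - p.2.1), p.1 - p.2.2))
          (by fun_prop)
      exact (hk1.mul hk2).aemeasurable.mul hF.enorm.comp_snd
    have e : potMaj ν ((timeInterval T).prod halfLine) (Function.uncurry F) t =ᵐ[halfLine]
        fun y => ∫⁻ s in Ioo (0 : ℝ) T, ∫⁻ z in Ioi (0 : ℝ),
          tpow (1 / 2) (t - s) * eheat ν (2 * (t - s)) (y - z) * ‖F s z‖ₑ := by
      have := hm3.aestronglyMeasurable.prodMk_left
      filter_upwards [this] with y hy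
      rw [potMaj, lintegral_prod _ hy.aemeasurable]
      rfl
    have hm4 : AEMeasurable (Function.uncurry fun y s => ∫⁻ z in Ioi (0 : ℝ),
        tpow (1 / 2) (t - s) * eheat ν (2 * (t - s)) (y - z) * ‖F s z‖ₑ)
        (halfLine.prod (timeInterval T)) := by
      have hq : Measure.QuasiMeasurePreserving (MeasurableEquiv.prodAssoc (α := ℝ) (β := ℝ) (γ := ℝ))
          ((halfLine.prod (timeInterval T)).prod halfLine)
          (halfLine.prod ((timeInterval T).prod halfLine)) :=
        (measurePreserving_prodAssoc _ _ _).quasiMeasurePreserving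
      exact (hm3.comp_quasiMeasurePreserving hq).lintegral_prod_right'
    rw [eLpNorm_congr_ae e]
    refine (eLpNorm_lintegral_le hm4).trans (le_trans ?_ ((lintegral_mul_tpow_mul_le (1 / 2)
      ENNReal.one_ne_top hM ht).trans le_add_self))
    refine lintegral_mono_ae ?_
    filter_upwards [h1, hFM] with s hs1 hs2
    simp_rw [mul_assoc]
    simp_rw [lintegral_const_mul' _ _ (tpow_ne_top (1 / 2) (t - s))]
    refine (eLpNorm_const_mul_le (tpow_ne_top _ _) _ _).trans ?_
    rw [one_mul]
    gcongr
    refine (eLpNorm_lintegral_mul_le (hkm s) hs1.enorm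
      (fun y => lintegral_eheat_sub_le' hν _ y _) (fun z => lintegral_eheat_sub_le hν _ z _)).trans ?_
    rwa [eLpNorm_enorm]
  · refine (le_trans ?_ (lintegral_mul_tpow_mul_le (1 / 4) (heatConst_lt_top ν).ne hM ht)).trans
      le_self_add
    have hk2 : Measurable fun p : ℝ × ℝ => eheat ν (2 * (t - p.1)) (y - p.2) :=
      (measurable_eheat ν).comp (f := fun p : ℝ × ℝ => (2 * (t - p.1), y - p.2)) (by fun_prop)
    rw [potMajZero, lintegral_prod (fun p : ℝ × ℝ => eheat ν (2 * (t - p.1)) (y - p.2) *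
      ‖Function.uncurry F p‖ₑ) (hk2.aemeasurable.mul hF.enorm)]
    refine lintegral_mono_ae ?_
    filter_upwards [h1, hFM] with s hs1 hs2
    refine (lintegral_mul_le_eLpNorm (hk2.comp measurable_prodMk_left).aemeasurable
      hs1.enorm).trans ?_
    gcongr
    · exact eLpNorm_eheat_le' hν (t - s) y _
    · rwa [eLpNorm_enorm]

/-- A source concentrated at `z = 0` cannot use smoothing by the spatial integral, so the exponents
are `3/4` in `L²` and `1/2` pointwise, both still integrable in time. -/
theorem isBddSource_bdry (hν : 0 < ν) {q : ℝ → ℂ} (hq : AEStronglyMeasurable q (timeInterval T))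
    {M : ℝ≥0∞} (hM : M ≠ ⊤) (hqM : ∀ᵐ t ∂(timeInterval T), ‖q t‖ₑ ≤ M) :
    IsBddSource ν T (bdryMeasure T) fun p => q p.1 := by
  set C₀ : ℝ≥0∞ := ENNReal.ofReal ((Real.sqrt (8 * Real.pi * ν))⁻¹)
  have hC₀ : C₀ ≠ ⊤ := ENNReal.ofReal_ne_top
  refine ⟨measurableEmbedding_bdry.aestronglyMeasurable_map_iff.2 hq, ?_,
    C₀ * (∫⁻ s in Ioo (0 : ℝ) T, tpow (1 / 2) s) * M +
    heatConst ν * (∫⁻ s in Ioo (0 : ℝ) T, tpow (3 / 4) s) * M, ?_, fun t ht => ⟨?_, fun y => ?_⟩⟩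
  · rw [bdryMeasure, measurableEmbedding_bdry.ae_map_iff]
    filter_upwards [ae_restrict_mem measurableSet_Ioo] with s hs
    exact ⟨hs.1.le, hs.2, le_rfl⟩
  · exact ENNReal.add_ne_top.2 ⟨ENNReal.mul_ne_top (ENNReal.mul_ne_top hC₀
      (lintegral_tpow_lt_top (by norm_num) T).ne) hM, ENNReal.mul_ne_top (ENNReal.mul_ne_top
      (heatConst_lt_top ν).ne (lintegral_tpow_lt_top (by norm_num) T).ne) hM⟩
  · have e : potMaj ν (bdryMeasure T) (fun p => q p.1) t = fun y =>
        ∫⁻ s in Ioo (0 : ℝ) T, (tpow (1 / 2) (t - s) * ‖q s‖ₑ) * eheat ν (2 * (t - s)) (y - 0) := by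
      funext y
      rw [potMaj, bdryMeasure, measurableEmbedding_bdry.lintegral_map]
      congr 1 with z
      ring
    have hm : AEMeasurable (Function.uncurry fun y s : ℝ =>
        (tpow (1 / 2) (t - s) * ‖q s‖ₑ) * eheat ν (2 * (t - s)) (y - 0))
        (halfLine.prod (timeInterval T)) := by
      have m1 : AEMeasurable (fun s => tpow (1 / 2) (t - s) * ‖q s‖ₑ) (timeInterval T) :=
        ((measurable_tpow _).comp (by fun_prop : Measurable fun s : ℝ => t - s)).aemeasurable.mul
          hq.enorm
      exact m1.comp_snd.mul ((measurable_eheat ν).comp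
        (f := fun p : ℝ × ℝ => (2 * (t - p.2), p.1 - 0)) (by fun_prop)).aemeasurable
    rw [e]
    refine (eLpNorm_lintegral_le hm).trans (le_trans ?_ ((lintegral_mul_tpow_mul_le (3 / 4)
      (heatConst_lt_top ν).ne hM ht).trans le_add_self))
    refine lintegral_mono_ae ?_
    filter_upwards [hqM] with s hs
    refine (eLpNorm_const_mul_le (ENNReal.mul_ne_top (tpow_ne_top _ _) enorm_ne_top) _ _).trans ?_
    calc _ ≤ tpow (1 / 2) (t - s) * M * (heatConst ν * tpow (1 / 4) (t - s)) := by
          gcongr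
          exact eLpNorm_eheat_le hν _ _ _
      _ = heatConst ν * (tpow (1 / 2) (t - s) * tpow (1 / 4) (t - s)) * M := by ring
      _ = _ := by rw [tpow_mul]; norm_num
  · refine (le_trans ?_ (lintegral_mul_tpow_mul_le (1 / 2) hC₀ hM ht)).trans le_self_add
    rw [potMajZero, bdryMeasure, measurableEmbedding_bdry.lintegral_map]
    refine lintegral_mono_ae ?_
    filter_upwards [hqM] with s hs
    gcongr
    exact eheat_le hν _ _

end Sources

/-! ### The energy estimate -/

section Gaussian

variable {ν t : ℝ}

theorem integrable_sq_mul_heat (hν : 0 < ν) (ht : 0 < t) :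
    Integrable fun x => x ^ 2 * heat ν t x := by
  have := (integrable_rpow_mul_exp_neg_mul_sq (b := (4 * ν * t)⁻¹) (s := 2) (by positivity)
    (by norm_num)).const_mul (Real.sqrt (4 * Real.pi * ν * t))⁻¹
  refine this.congr (ae_of_all _ fun x => ?_)
  simp only [heat, Real.rpow_two]
  rw [show -(x ^ 2 / (4 * ν * t)) = -(4 * ν * t)⁻¹ * x ^ 2 by field_simp]
  ring

theorem integrable_heatDx (hν : 0 < ν) (ht : 0 < t) : Integrable (heatDx ν t) := by
  have := (integrable_mul_exp_neg_mul_sq (b := (4 * ν * t)⁻¹) (by positivity)).const_mul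
    (-(2 * ν * t)⁻¹ * (Real.sqrt (4 * Real.pi * ν * t))⁻¹)
  refine this.congr (ae_of_all _ fun x => ?_)
  simp only [heatDx, heat]
  rw [show -(x ^ 2 / (4 * ν * t)) = -(4 * ν * t)⁻¹ * x ^ 2 by field_simp]
  ring

theorem integrable_heatDxx (hν : 0 < ν) (ht : 0 < t) : Integrable (heatDxx ν t) := by
  refine (((integrable_sq_mul_heat hν ht).const_mul (4 * ν ^ 2 * t ^ 2)⁻¹).sub
    ((integrable_heat hν ht).const_mul (1 / (2 * ν * t)))).congr (ae_of_all _ fun x => ?_)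
  simp only [heatDxx, Pi.sub_apply]
  ring

theorem integral_heatDxx (hν : 0 < ν) (ht : 0 < t) : ∫ x, heatDxx ν t x = 0 :=
  integral_eq_zero_of_hasDerivAt_of_integrable (fun x => hasDerivAt_heatDx hν ht x)
    (integrable_heatDxx hν ht) (integrable_heatDx hν ht)

/-- The product of two Gaussians. -/
theorem heat_mul_heat (hν : 0 < ν) (ht : 0 < t) (y z w : ℝ) :
    heat ν t (y - z) * heat ν t (y - w) =
      heat ν (2 * t) (z - w) * heat ν (t / 2) (y - (z + w) / 2) := by
  simp only [heat]
  rw [mul_mul_mul_comm, mul_mul_mul_comm (Real.sqrt (4 * Real.pi * ν * (2 * t)))⁻¹, ← mul_inv, ← mul_inv, ← Real.exp_add, ← Real.exp_add,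
    ← Real.sqrt_mul (by positivity), ← Real.sqrt_mul (by positivity)]
  congr 1
  · congr 2; ring
  · congr 1
    field_simp
    ring

/-- This is `∂_z ∂_w` applied to the product formula: in the difference `D = z - w` and the midpoint
`m = (z + w)/2` one has `∂_z ∂_w = -∂_D² + ¼ ∂_m²`. -/
theorem heatDx_mul_heatDx (hν : 0 < ν) (ht : 0 < t) (y z w : ℝ) :
    heatDx ν t (y - z) * heatDx ν t (y - w) =
      -(heatDxx ν (2 * t) (z - w) * heat ν (t / 2) (y - (z + w) / 2)) +
      1 / 4 * heat ν (2 * t) (z - w) * heatDxx ν (t / 2) (y - (z + w) / 2) := by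
  have h := heat_mul_heat hν ht y z w
  have e : heatDx ν t (y - z) * heatDx ν t (y - w) =
      (y - z) * (y - w) / (4 * ν ^ 2 * t ^ 2) * (heat ν t (y - z) * heat ν t (y - w)) := by
    simp only [heatDx]
    field_simp
    ring
  rw [e, h, heatDxx, heatDxx]
  field_simp
  ring

/-- Integrating over `y` removes the midpoint: the heat kernel has mass one and its second
derivative has mass zero. -/
theorem integral_heatDx_mul_heatDx (hν : 0 < ν) (ht : 0 < t) (z w : ℝ) :
    ∫ y, heatDx ν t (y - z) * heatDx ν t (y - w) = -heatDxx ν (2 * t) (z - w) := by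
  have ht2 : 0 < t / 2 := by linarith
  simp_rw [heatDx_mul_heatDx hν ht]
  rw [integral_add, integral_neg, integral_const_mul, integral_const_mul,
    integral_sub_right_eq_self (heat ν (t / 2)), integral_sub_right_eq_self (heatDxx ν (t / 2)),
    integral_heat hν ht2, integral_heatDxx hν ht2]
  · ring
  · exact (((integrable_heat hν ht2).comp_sub_right _).const_mul _).neg
  · exact ((integrable_heatDxx hν ht2).comp_sub_right _).const_mul _

/-- By the heat equation the integrand is, up to the factor `2ν`, a time derivative, so the integral
telescopes. -/
theorem integral_heatDxx_time (hν : 0 < ν) {ε T : ℝ} (hε : 0 < ε) (hεT : ε ≤ T) (x : ℝ) :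
    ∫ t in Ioo ε T, -heatDxx ν (2 * t) x =
      (2 * ν)⁻¹ * (heat ν (2 * ε) x - heat ν (2 * T) x) := by
  have hd : ∀ t, 0 < t → HasDerivAt (fun t => (2 * ν)⁻¹ * heat ν (2 * t) x)
      (heatDxx ν (2 * t) x) t := by
    intro t ht
    have h2 : HasDerivAt (fun t : ℝ => 2 * t) 2 t := by simpa using (hasDerivAt_id t).const_mul 2
    convert! (((hasDerivAt_heat_time hν (show 0 < 2 * t by linarith) x).comp t h2).const_mul
      (2 * ν)⁻¹) using 1
    field_simp
  have hc : ContinuousOn (fun t => heatDxx ν (2 * t) x) (uIcc ε T) := by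
    rw [uIcc_of_le hεT]
    intro t ht
    have h0 : 0 < t := hε.trans_le ht.1
    have h1 : 4 * ν ^ 2 * (2 * t) ^ 2 ≠ 0 := by positivity
    have h2 : 2 * ν * (2 * t) ≠ 0 := by positivity
    have h3 : ContinuousAt (fun t => heat ν (2 * t) x) t :=
      (contDiffAt_heat hν (p := (2 * t, x)) (by simpa)).continuousAt.comp
        (f := fun t : ℝ => (2 * t, x)) (by fun_prop)
    exact ((ContinuousAt.sub (ContinuousAt.div (f := fun _ : ℝ => x ^ 2)
      (g := fun t : ℝ => 4 * ν ^ 2 * (2 * t) ^ 2) (by fun_prop) (by fun_prop) h1)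
      (ContinuousAt.div (f := fun _ : ℝ => (1 : ℝ)) (g := fun t : ℝ => 2 * ν * (2 * t))
        (by fun_prop) (by fun_prop) h2)).mul h3).continuousWithinAt
  rw [integral_neg, ← integral_Ioc_eq_integral_Ioo, ← intervalIntegral.integral_of_le hεT,
    intervalIntegral.integral_eq_sub_of_hasDerivAt
      (fun t ht => hd t (by rw [uIcc_of_le hεT] at ht; exact hε.trans_le ht.1))
      hc.intervalIntegrable]
  ring

theorem measurable_heatDx (ν : ℝ) : Measurable fun q : ℝ × ℝ => heatDx ν q.1 q.2 := by
  unfold heatDx heat; fun_prop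

theorem enorm_heatDx_le (hν : 0 < ν) (t x : ℝ) :
    ‖heatDx ν t x‖ₑ ≤
      ENNReal.ofReal (2 * (Real.sqrt ν)⁻¹) * (tpow (1 / 2) t * eheat ν (2 * t) x) := by
  rcases le_or_gt t 0 with ht | ht
  · simp [heatDx, heat_of_nonpos hν ht]
  rw [tpow_of_pos _ ht, eheat, ← ENNReal.ofReal_mul (by positivity),
    ← ENNReal.ofReal_mul (by positivity), Real.rpow_neg ht.le, ← Real.sqrt_eq_rpow,
    Real.enorm_eq_ofReal_abs]
  exact ENNReal.ofReal_le_ofReal (abs_heatDx_le hν ht)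

theorem enorm_heatDx_le_tpow (hν : 0 < ν) (t x : ℝ) :
    ‖heatDx ν t x‖ₑ ≤ ENNReal.ofReal (2 * (Real.sqrt ν)⁻¹) *
      ENNReal.ofReal ((Real.sqrt (8 * Real.pi * ν))⁻¹) * tpow 1 t := by
  refine (enorm_heatDx_le hν t x).trans ?_
  calc _ ≤ ENNReal.ofReal (2 * (Real.sqrt ν)⁻¹) * (tpow (1 / 2) t *
        (ENNReal.ofReal ((Real.sqrt (8 * Real.pi * ν))⁻¹) * tpow (1 / 2) t)) := by
        gcongr; exact eheat_le hν t x
    _ = ENNReal.ofReal (2 * (Real.sqrt ν)⁻¹) * ENNReal.ofReal ((Real.sqrt (8 * Real.pi * ν))⁻¹) *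
        (tpow (1 / 2) t * tpow (1 / 2) t) := by ring
    _ = _ := by rw [tpow_mul]; norm_num

end Gaussian

/-! ### The space-time norm of the differentiated heat evolution -/

section Evolution

variable {ν T : ℝ}

theorem tpow_anti {a : ℝ} (ha : 0 ≤ a) {ε t : ℝ} (hε : 0 < ε) (h : ε ≤ t) : tpow a t ≤ tpow a ε := by
  rw [tpow_of_pos _ hε, tpow_of_pos _ (hε.trans_le h)]
  exact ENNReal.ofReal_le_ofReal (Real.rpow_le_rpow_of_nonpos hε h (by linarith))

/-- The derivative of the heat evolution of an integrable function. -/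
theorem lintegral_sq_heatDx_le (hν : 0 < ν) {ε : ℝ} (hε : 0 < ε) (hεT : ε ≤ T) {w : ℝ → ℝ}
    (hw : Integrable w halfLine) :
    ∫⁻ q, ‖∫ z in Ioi (0 : ℝ), heatDx ν q.1 (q.2 - z) * w z‖ₑ ^ 2
      ∂((volume.restrict (Ioo ε T)).prod volume) ≤
      ENNReal.ofReal ν⁻¹ * eLpNorm w 2 halfLine ^ 2 := by
  set m := (volume.restrict (Ioo ε T)).prod (volume : Measure ℝ)
  set μ2 := halfLine.prod halfLine
  -- The square of the evolution is a double integral over pairs `(z, z')`. Exchanging it with the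
  -- space-time integral reduces the estimate to the exact kernel computed above.
  set G : (ℝ × ℝ) × (ℝ × ℝ) → ℝ := fun p => (heatDx ν p.1.1 (p.1.2 - p.2.1) *
    heatDx ν p.1.1 (p.1.2 - p.2.2)) * (w p.2.1 * w p.2.2)
  have hkm : Measurable fun p : (ℝ × ℝ) × (ℝ × ℝ) => heatDx ν p.1.1 (p.1.2 - p.2.1) *
      heatDx ν p.1.1 (p.1.2 - p.2.2) :=
    ((measurable_heatDx ν).comp
      (f := fun p : (ℝ × ℝ) × (ℝ × ℝ) => (p.1.1, p.1.2 - p.2.1)) (by fun_prop)).mul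
    ((measurable_heatDx ν).comp
      (f := fun p : (ℝ × ℝ) × (ℝ × ℝ) => (p.1.1, p.1.2 - p.2.2)) (by fun_prop))
  have hww : Integrable (fun p : ℝ × ℝ => w p.1 * w p.2) μ2 := hw.mul_prod hw
  have hGm : AEStronglyMeasurable G (m.prod μ2) :=
    hkm.aestronglyMeasurable.mul hww.1.comp_snd
  set C : ℝ≥0∞ := ENNReal.ofReal (2 * (Real.sqrt ν)⁻¹) with hC
  set C' : ℝ≥0∞ := C * ENNReal.ofReal ((Real.sqrt (8 * Real.pi * ν))⁻¹) with hC'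
  set K : ℝ≥0∞ := (C' * tpow 1 ε) * (C * tpow (1 / 2) ε) with hK
  have hKfin : K ≠ ⊤ := by finiteness [tpow_ne_top 1 ε, tpow_ne_top (1 / 2) ε]
  -- Absolute convergence for Fubini: one factor is bounded uniformly, the other is integrated in
  -- space. This is the step that needs times bounded below by `ε`; the resulting constant does not
  -- enter the final estimate.
  have hker : ∀ z z' : ℝ, ∫⁻ q, ‖heatDx ν q.1 (q.2 - z) * heatDx ν q.1 (q.2 - z')‖ₑ ∂m ≤
      volume (Ioo ε T) * K := by
    intro z z'
    have hmm : Measurable fun q : ℝ × ℝ => heatDx ν q.1 (q.2 - z) * heatDx ν q.1 (q.2 - z') :=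
      hkm.comp (f := fun q : ℝ × ℝ => (q, (z, z'))) (by fun_prop)
    rw [lintegral_prod _ hmm.enorm.aemeasurable]
    calc _ ≤ ∫⁻ t in Ioo ε T, K := by
          refine setLIntegral_mono' measurableSet_Ioo fun t ht => ?_
          calc _ ≤ ∫⁻ y, (C' * tpow 1 ε) * ((C * tpow (1 / 2) ε) * eheat ν (2 * t) (y - z')) := by
                refine lintegral_mono fun y => ?_
                rw [enorm_mul]
                gcongr
                · exact (enorm_heatDx_le_tpow hν _ _).trans
                    (by gcongr; exact tpow_anti (by norm_num) hε ht.1.le)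
                · refine (enorm_heatDx_le hν _ _).trans ?_
                  rw [mul_assoc]
                  gcongr
                  exact tpow_anti (by norm_num) hε ht.1.le
            _ = (C' * tpow 1 ε) * ((C * tpow (1 / 2) ε) * ∫⁻ y, eheat ν (2 * t) (y - z')) := by
                rw [lintegral_const_mul' _ _ (by finiteness [tpow_ne_top 1 ε]),
                  lintegral_const_mul' _ _ (by finiteness [tpow_ne_top (1 / 2) ε])]
            _ ≤ (C' * tpow 1 ε) * ((C * tpow (1 / 2) ε) * 1) := by
                gcongr
                simpa using lintegral_eheat_sub_le hν (2 * t) z' univ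
            _ = K := by rw [mul_one]
      _ = _ := by rw [setLIntegral_const, mul_comm]
  have hG : Integrable G (m.prod μ2) := by
    refine ⟨hGm, ?_⟩
    rw [HasFiniteIntegral, lintegral_prod_symm _ hGm.enorm]
    calc _ ≤ ∫⁻ p, (volume (Ioo ε T) * K) * ‖w p.1 * w p.2‖ₑ ∂μ2 := by
          refine lintegral_mono fun p => ?_
          simp only [G, enorm_mul (_ * _ : ℝ)]
          rw [lintegral_mul_const' _ _ enorm_ne_top]
          gcongr
          exact hker p.1 p.2
      _ = (volume (Ioo ε T) * K) * ∫⁻ p, ‖w p.1 * w p.2‖ₑ ∂μ2 :=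
          lintegral_const_mul' _ _ (ENNReal.mul_ne_top measure_Ioo_lt_top.ne hKfin)
      _ < ⊤ := ENNReal.mul_lt_top (ENNReal.mul_lt_top measure_Ioo_lt_top hKfin.lt_top) hww.2
  have hV : ∀ q : ℝ × ℝ, ∫ p, G (q, p) ∂μ2 =
      (∫ z in Ioi (0 : ℝ), heatDx ν q.1 (q.2 - z) * w z) ^ 2 := by
    intro q
    rw [sq, ← integral_prod_mul]
    congr 1 with p
    simp only [G]
    ring
  have hQ : ∀ z z' : ℝ, ∫ q, heatDx ν q.1 (q.2 - z) * heatDx ν q.1 (q.2 - z') ∂m =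
      (2 * ν)⁻¹ * (heat ν (2 * ε) (z - z') - heat ν (2 * T) (z - z')) := by
    intro z z'
    rw [integral_prod, ← integral_heatDxx_time hν hε hεT]
    · refine setIntegral_congr_fun measurableSet_Ioo fun t ht => ?_
      exact integral_heatDx_mul_heatDx hν (hε.trans ht.1) z z'
    · refine ⟨(hkm.comp (f := fun q : ℝ × ℝ => (q, (z, z')))
        (by fun_prop)).aestronglyMeasurable, ?_⟩
      exact (hker z z').trans_lt (ENNReal.mul_lt_top measure_Ioo_lt_top hKfin.lt_top)
  have hGq := hG.integral_prod_left
  simp_rw [hV] at hGq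
  have hswap := integral_integral_swap (f := fun q p => G (q, p)) hG
  simp_rw [hV] at hswap
  -- Cauchy–Schwarz and Schur's test bound the quadratic form of each of the two heat kernels. With
  -- the coefficient `(2ν)⁻¹`, their sum gives `ν⁻¹`.
  have hB : ∀ r : ℝ, ∫⁻ p, eheat ν r (p.1 - p.2) * (‖w p.1‖ₑ * ‖w p.2‖ₑ) ∂μ2 ≤
      eLpNorm w 2 halfLine ^ 2 := by
    intro r
    have hk : Measurable (Function.uncurry fun y z : ℝ => eheat ν r (y - z)) :=
      (measurable_eheat ν).comp (f := fun p : ℝ × ℝ => (r, p.1 - p.2)) (by fun_prop)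
    have hme : AEMeasurable (fun p : ℝ × ℝ => eheat ν r (p.1 - p.2) * (‖w p.1‖ₑ * ‖w p.2‖ₑ)) μ2 :=
      hk.aemeasurable.mul (hw.1.enorm.comp_fst.mul hw.1.enorm.comp_snd)
    have hme2 : AEMeasurable (fun p : ℝ × ℝ => eheat ν r (p.1 - p.2) * ‖w p.2‖ₑ) μ2 :=
      hk.aemeasurable.mul hw.1.enorm.comp_snd
    rw [lintegral_prod _ hme]
    calc _ = ∫⁻ y in Ioi (0 : ℝ), ‖w y‖ₑ * ∫⁻ z in Ioi (0 : ℝ), eheat ν r (y - z) * ‖w z‖ₑ := by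
          congr 1 with y
          rw [← lintegral_const_mul' _ _ enorm_ne_top]
          congr 1 with z
          ring
      _ ≤ eLpNorm (fun y => ‖w y‖ₑ) 2 halfLine * eLpNorm (fun y => ∫⁻ z in Ioi (0 : ℝ),
          eheat ν r (y - z) * ‖w z‖ₑ) 2 halfLine :=
          lintegral_mul_le_eLpNorm hw.1.enorm hme2.lintegral_prod_right'
      _ ≤ eLpNorm (fun y => ‖w y‖ₑ) 2 halfLine * eLpNorm (fun y => ‖w y‖ₑ) 2 halfLine := by
          gcongr
          exact eLpNorm_lintegral_mul_le hk hw.1.enorm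
            (fun y => lintegral_eheat_sub_le' hν _ y _) (fun z => lintegral_eheat_sub_le hν _ z _)
      _ = _ := by rw [eLpNorm_enorm, sq]
  calc _ = ∫⁻ q, ENNReal.ofReal ((∫ z in Ioi (0 : ℝ), heatDx ν q.1 (q.2 - z) * w z) ^ 2) ∂m := by
        congr 1 with q
        rw [Real.enorm_eq_ofReal_abs, ← ENNReal.ofReal_pow (abs_nonneg _), sq_abs]
    _ = ENNReal.ofReal (∫ q, (∫ z in Ioi (0 : ℝ), heatDx ν q.1 (q.2 - z) * w z) ^ 2 ∂m) :=
        (ofReal_integral_eq_lintegral_ofReal hGq (ae_of_all _ fun q => sq_nonneg _)).symm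
    _ ≤ ‖∫ q, (∫ z in Ioi (0 : ℝ), heatDx ν q.1 (q.2 - z) * w z) ^ 2 ∂m‖ₑ := by
        rw [Real.enorm_eq_ofReal_abs]
        exact ENNReal.ofReal_le_ofReal (le_abs_self _)
    _ ≤ ∫⁻ p, ‖∫ q, G (q, p) ∂m‖ₑ ∂μ2 := by
        rw [hswap]
        exact enorm_integral_le_lintegral_enorm _
    _ ≤ ∫⁻ p, (ENNReal.ofReal (2 * ν)⁻¹ * (eheat ν (2 * ε) (p.1 - p.2) * (‖w p.1‖ₑ * ‖w p.2‖ₑ)) +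
          ENNReal.ofReal (2 * ν)⁻¹ * (eheat ν (2 * T) (p.1 - p.2) * (‖w p.1‖ₑ * ‖w p.2‖ₑ))) ∂μ2 := by
        refine lintegral_mono fun p => ?_
        simp only [G]
        rw [integral_mul_const, hQ, enorm_mul, enorm_mul, enorm_mul,
          Real.enorm_eq_ofReal (show 0 ≤ (2 * ν)⁻¹ by positivity), ← mul_add, ← add_mul, mul_assoc]
        gcongr
        refine (enorm_sub_le).trans ?_
        rw [Real.enorm_eq_ofReal (heat_nonneg _ _ _), Real.enorm_eq_ofReal (heat_nonneg _ _ _)]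
        rfl
    _ ≤ ENNReal.ofReal (2 * ν)⁻¹ * eLpNorm w 2 halfLine ^ 2 +
          ENNReal.ofReal (2 * ν)⁻¹ * eLpNorm w 2 halfLine ^ 2 := by
        rw [lintegral_add_left', lintegral_const_mul' _ _ ENNReal.ofReal_ne_top,
          lintegral_const_mul' _ _ ENNReal.ofReal_ne_top]
        · gcongr
          · exact hB _
          · exact hB _
        · refine AEMeasurable.const_mul (AEMeasurable.mul ?_ (hw.1.enorm.comp_fst.mul
            hw.1.enorm.comp_snd)) _
          exact ((measurable_eheat ν).comp
            (f := fun p : ℝ × ℝ => (2 * ε, p.1 - p.2)) (by fun_prop)).aemeasurable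
    _ = _ := by
        rw [← add_mul, ← ENNReal.ofReal_add (by positivity) (by positivity)]
        congr 2
        field_simp
        norm_num

end Evolution

/-! ### Square integrability in time of the derivative for initial data in `L²` -/

section Energy

variable {ν d β σ T : ℝ}

theorem add_sq_le_four_mul (a b : ℝ≥0∞) : (a + b) ^ 2 ≤ 4 * (a ^ 2 + b ^ 2) := by
  rcases le_total a b with h | h
  · calc (a + b) ^ 2 ≤ (b + b) ^ 2 := by gcongr
      _ = 4 * b ^ 2 := by ring
      _ ≤ _ := by gcongr; exact le_add_self
  · calc (a + b) ^ 2 ≤ (a + a) ^ 2 := by gcongr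
      _ = 4 * a ^ 2 := by ring
      _ ≤ _ := by gcongr; exact le_self_add

/-- The bound on `(ε, T)` does not depend on `ε`, so it passes to the increasing union of these
intervals. -/
theorem lintegral_sq_heatDx_le_real (hν : 0 < ν) {w : ℝ → ℝ} (hw : Integrable w halfLine) :
    ∫⁻ q, ‖∫ z in Ioi (0 : ℝ), heatDx ν q.1 (q.2 - z) * w z‖ₑ ^ 2
      ∂((timeInterval T).prod volume) ≤ ENNReal.ofReal ν⁻¹ * eLpNorm w 2 halfLine ^ 2 := by
  have hu : Ioo (0 : ℝ) T ×ˢ (univ : Set ℝ) =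
      ⋃ n : ℕ, Ioo (1 / ((n : ℝ) + 1)) T ×ˢ (univ : Set ℝ) := by
    ext ⟨t, y⟩
    simp only [mem_prod, mem_Ioo, mem_univ, and_true, mem_iUnion]
    constructor
    · rintro ⟨h1, h2⟩
      obtain ⟨n, hn⟩ := exists_nat_one_div_lt h1
      exact ⟨n, hn, h2⟩
    · rintro ⟨n, h1, h2⟩
      exact ⟨(by positivity : (0 : ℝ) < 1 / ((n : ℝ) + 1)).trans h1, h2⟩
  have hmono : Monotone fun n : ℕ => Ioo (1 / ((n : ℝ) + 1)) T ×ˢ (univ : Set ℝ) := by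
    intro n m hnm
    refine prod_mono (Ioo_subset_Ioo_left ?_) le_rfl
    exact Nat.one_div_le_one_div hnm
  have hr : ∀ s : Set ℝ, (volume.restrict s).prod (volume : Measure ℝ) =
      ((volume : Measure ℝ).prod volume).restrict (s ×ˢ univ) := fun s => by
    rw [← Measure.prod_restrict, Measure.restrict_univ]
  rw [hr, hu, setLIntegral_iUnion_of_directed _ hmono.directed_le]
  refine iSup_le fun n => ?_
  rw [← hr]
  rcases le_or_gt (1 / ((n : ℝ) + 1)) T with h | h
  · exact lintegral_sq_heatDx_le hν (by positivity) h hw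
  · rw [Ioo_eq_empty (not_lt.2 h.le)]; simp

theorem integrable_heatDx_mul (hν : 0 < ν) {u : ℝ → ℂ} (hu : Integrable u halfLine) (t y : ℝ) :
    Integrable (fun z => (heatDx ν t (y - z) : ℂ) * u z) halfLine := by
  set C := ENNReal.ofReal (2 * (Real.sqrt ν)⁻¹) *
      ENNReal.ofReal ((Real.sqrt (8 * Real.pi * ν))⁻¹) * tpow 1 t
  have hC : C ≠ ⊤ := by finiteness [tpow_ne_top 1 t]
  have hm : Measurable fun z => (heatDx ν t (y - z) : ℂ) := Complex.measurable_ofReal.comp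
    ((measurable_heatDx ν).comp (f := fun z : ℝ => (t, y - z)) (by fun_prop))
  refine hu.bdd_mul (c := C.toReal) hm.aestronglyMeasurable (ae_of_all _ fun z => ?_)
  rw [← toReal_enorm, enorm_complex_ofReal]
  exact ENNReal.toReal_mono hC (enorm_heatDx_le_tpow hν t (y - z))

theorem lintegral_sq_heatDx_le_complex (hν : 0 < ν) {u : ℝ → ℂ} (hu : Integrable u halfLine) :
    ∫⁻ q, ‖∫ z in Ioi (0 : ℝ), (heatDx ν q.1 (q.2 - z) : ℂ) * u z‖ₑ ^ 2
      ∂((timeInterval T).prod volume) ≤ 8 * (ENNReal.ofReal ν⁻¹ * eLpNorm u 2 halfLine ^ 2) := by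
  have hpart : ∀ f : ℝ → ℝ, (∀ z, ‖f z‖ ≤ ‖u z‖) → eLpNorm f 2 halfLine ≤ eLpNorm u 2 halfLine :=
    fun f hf => eLpNorm_mono hf
  have hre : Integrable (fun z => (u z).re) halfLine := hu.re
  have him : Integrable (fun z => (u z).im) halfLine := hu.im
  have hm : ∀ w : ℝ → ℝ, Integrable w halfLine → AEMeasurable (fun q : ℝ × ℝ =>
      ‖∫ z in Ioi (0 : ℝ), heatDx ν q.1 (q.2 - z) * w z‖ₑ ^ 2) ((timeInterval T).prod volume) := by
    intro w hw
    have h1 : Measurable fun p : (ℝ × ℝ) × ℝ => heatDx ν p.1.1 (p.1.2 - p.2) :=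
      (measurable_heatDx ν).comp (f := fun p : (ℝ × ℝ) × ℝ => (p.1.1, p.1.2 - p.2)) (by fun_prop)
    have h2 : AEStronglyMeasurable (fun p : (ℝ × ℝ) × ℝ => heatDx ν p.1.1 (p.1.2 - p.2) * w p.2)
      (((timeInterval T).prod volume).prod halfLine) := h1.aestronglyMeasurable.mul hw.1.comp_snd
    exact h2.integral_prod_right'.enorm.pow_const 2
  calc _ ≤ ∫⁻ q, 4 * (‖∫ z in Ioi (0 : ℝ), heatDx ν q.1 (q.2 - z) * (u z).re‖ₑ ^ 2 +
        ‖∫ z in Ioi (0 : ℝ), heatDx ν q.1 (q.2 - z) * (u z).im‖ₑ ^ 2)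
          ∂((timeInterval T).prod volume) := by
        refine lintegral_mono fun q => ?_
        have hi := integrable_heatDx_mul hν hu q.1 q.2
        refine le_trans ?_ (add_sq_le_four_mul _ _)
        gcongr
        have e : ∫ z in Ioi (0 : ℝ), (heatDx ν q.1 (q.2 - z) : ℂ) * u z =
            ((∫ z in Ioi (0 : ℝ), heatDx ν q.1 (q.2 - z) * (u z).re : ℝ) : ℂ) +
            ((∫ z in Ioi (0 : ℝ), heatDx ν q.1 (q.2 - z) * (u z).im : ℝ) : ℂ) * Complex.I := by
          rw [← integral_re_add_im hi]
          simp
        rw [e]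
        refine (enorm_add_le _ _).trans ?_
        rw [enorm_mul, enorm_complex_ofReal, enorm_complex_ofReal]
        simp [← ofReal_norm]
    _ ≤ 4 * (ENNReal.ofReal ν⁻¹ * eLpNorm u 2 halfLine ^ 2 +
          ENNReal.ofReal ν⁻¹ * eLpNorm u 2 halfLine ^ 2) := by
        rw [lintegral_const_mul' _ _ (by norm_num), lintegral_add_left' (hm _ hre)]
        gcongr
        · refine (lintegral_sq_heatDx_le_real hν hre).trans ?_
          gcongr
          exact hpart _ fun z => Complex.abs_re_le_norm _
        · refine (lintegral_sq_heatDx_le_real hν him).trans ?_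
          gcongr
          exact hpart _ fun z => Complex.abs_im_le_norm _
    _ = _ := by ring

/-- Apart from the two Gaussian derivatives, the derivative of the kernel contains only the heat
kernel and the Robin correction. These have no singular factor in time, so Schur's test handles the
remainder at each time. -/
theorem exists_kernDy_sub_le (hν : 0 < ν) (hd : 0 ≤ d) (hβ : 0 ≤ β) (hT : 0 < T) :
    ∃ C, 0 ≤ C ∧ ∀ t, 0 < t → t ≤ T → ∀ y, 0 ≤ y → ∀ z, 0 ≤ z →
      |kernDy ν d β σ t y z - Real.exp (-(d * t)) * (heatDx ν t (y - z) + σ * heatDx ν t (y + z))| ≤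
        C * heat ν (2 * t) (y - z) := by
  obtain ⟨C, hC, h⟩ := exists_robinTail_le hν hβ T
  refine ⟨β * (C * Real.sqrt T) * 2 + 2 * β * 2, by positivity, fun t ht htT y hy z hz => ?_⟩
  have hex : Real.exp (-(d * t)) ≤ 1 := Real.exp_le_one_iff.2 (by simpa using by positivity)
  have h1 : heat ν t (y + z) ≤ 2 * heat ν (2 * t) (y - z) :=
    (heat_le hν ht).trans (by gcongr; exact heat_add_le_sub hν (by linarith) hy hz)
  have h0 := heat_nonneg ν t (y + z)
  have h2 : robinTail ν β t (y + z) ≤ C * Real.sqrt T * (2 * heat ν (2 * t) (y - z)) := by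
    refine (h t ht htT _ (add_nonneg hy hz)).trans ?_
    rw [mul_assoc]
    gcongr
  have h3 := robinTail_nonneg hβ ν t (y + z)
  rw [kernDy, ← mul_sub, abs_mul, Real.abs_exp]
  calc _ ≤ 1 * (β * robinTail ν β t (y + z) + 2 * β * heat ν t (y + z)) := by
        gcongr
        rw [add_sub_cancel_left, abs_le]
        constructor
        · linarith
        · have := mul_nonneg hβ h3
          have := mul_nonneg hβ h0
          linarith
    _ ≤ 1 * (β * (C * Real.sqrt T * (2 * heat ν (2 * t) (y - z))) +
          2 * β * (2 * heat ν (2 * t) (y - z))) := by gcongr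
    _ = _ := by ring

theorem eLpNorm_potMajZero_init_le (hν : 0 < ν) {u : ℝ → ℂ} (hu : AEStronglyMeasurable u halfLine)
    (t : ℝ) :
    eLpNorm (potMajZero ν initMeasure (fun p => u p.2) t) 2 halfLine ≤ eLpNorm u 2 halfLine := by
  have e : potMajZero ν initMeasure (fun p => u p.2) t = fun y =>
      ∫⁻ z in Ioi (0 : ℝ), eheat ν (2 * t) (y - z) * ‖u z‖ₑ := by
    funext y
    rw [potMajZero, initMeasure, measurableEmbedding_init.lintegral_map]
    simp only [sub_zero]
  have hk : Measurable (Function.uncurry fun y z : ℝ => eheat ν (2 * t) (y - z)) :=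
    (measurable_eheat ν).comp (f := fun p : ℝ × ℝ => (2 * t, p.1 - p.2)) (by fun_prop)
  rw [e]
  refine (eLpNorm_lintegral_mul_le hk hu.enorm
    (fun y => lintegral_eheat_sub_le' hν _ y _) (fun z => lintegral_eheat_sub_le hν _ z _)).trans ?_
  rw [eLpNorm_enorm]

/-- The derivative splits into the differentiated whole-line evolution `V`, its mirror image and a
remainder bounded in `L²` uniformly in time. The exact space-time identity handles the first two. -/
theorem lintegral_sq_pot_init_lt_top (hν : 0 < ν) (hd : 0 ≤ d) (hβ : 0 ≤ β) (hσ : |σ| ≤ 1)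
    (hT : 0 < T) {u : ℝ → ℂ} (hu : Integrable u halfLine) (hu2 : eLpNorm u 2 halfLine < ⊤) :
    ∫⁻ t in Ioo (0 : ℝ) T,
      eLpNorm (pot (kernDy ν d β σ) initMeasure (fun p => u p.2) t) 2 halfLine ^ 2 < ⊤ := by
  obtain ⟨C, hC, hR⟩ := exists_kernDy_sub_le (σ := σ) hν hd hβ hT
  set V : ℝ → ℝ → ℂ := fun t y => ∫ z in Ioi (0 : ℝ), (heatDx ν t (y - z) : ℂ) * u z with hV
  have hVm : ∀ t : ℝ, AEStronglyMeasurable (V t) volume := by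
    intro t
    have h1 : Measurable fun p : ℝ × ℝ => (heatDx ν t (p.1 - p.2) : ℂ) :=
      Complex.measurable_ofReal.comp
        ((measurable_heatDx ν).comp (f := fun p : ℝ × ℝ => (t, p.1 - p.2)) (by fun_prop))
    exact (h1.aestronglyMeasurable.mul hu.1.comp_snd (μ := volume.prod halfLine)).integral_prod_right'
  have hVm2 : AEStronglyMeasurable (fun q : ℝ × ℝ => V q.1 q.2)
      ((timeInterval T).prod volume) := by
    have h1 : Measurable fun p : (ℝ × ℝ) × ℝ => (heatDx ν p.1.1 (p.1.2 - p.2) : ℂ) :=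
      Complex.measurable_ofReal.comp
        ((measurable_heatDx ν).comp (f := fun p : (ℝ × ℝ) × ℝ => (p.1.1, p.1.2 - p.2)) (by fun_prop))
    exact (h1.aestronglyMeasurable.mul hu.1.comp_snd
      (μ := ((timeInterval T).prod volume).prod halfLine)).integral_prod_right'
  -- The Gaussian derivative is odd, so the image term is `-σ` times `V` at the reflected point
  -- `-y`. For this reason `V` is estimated on the whole line.
  have hdec : ∀ t, 0 < t → t ≤ T → ∀ y, 0 < y →
      ‖pot (kernDy ν d β σ) initMeasure (fun p => u p.2) t y‖ₑ ≤
        (‖V t y‖ₑ + ‖V t (-y)‖ₑ) +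
          ENNReal.ofReal C * potMajZero ν initMeasure (fun p => u p.2) t y := by
    intro t ht htT y hy
    set e := Real.exp (-(d * t))
    have he : ‖e‖ₑ ≤ 1 := by
      rw [Real.enorm_eq_ofReal (Real.exp_pos _).le, ENNReal.ofReal_le_one]
      exact Real.exp_le_one_iff.2 (by simpa using by positivity)
    have hσe : ‖σ‖ₑ ≤ 1 := by rw [Real.enorm_eq_ofReal_abs, ENNReal.ofReal_le_one]; exact hσ
    set R : ℝ → ℝ := fun z => kernDy ν d β σ t y z -
      e * (heatDx ν t (y - z) + σ * heatDx ν t (y + z)) with hRdef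
    have hRm : Measurable R := by
      have m1 : Measurable fun z => kernDy ν d β σ t y z :=
        (measurable_kernDy hν d β σ).comp (f := fun z : ℝ => (t, y, z)) (by fun_prop)
      have m2 : Measurable fun z => heatDx ν t (y - z) :=
        (measurable_heatDx ν).comp (f := fun z : ℝ => (t, y - z)) (by fun_prop)
      have m3 : Measurable fun z => heatDx ν t (y + z) :=
        (measurable_heatDx ν).comp (f := fun z : ℝ => (t, y + z)) (by fun_prop)
      exact m1.sub ((m2.add (m3.const_mul σ)).const_mul e)
    have hRe : ∀ z ∈ Ioi (0 : ℝ), ‖(R z : ℂ) * u z‖ₑ ≤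
        ENNReal.ofReal C * (eheat ν (2 * t) (y - z) * ‖u z‖ₑ) := by
      intro z hz
      rw [enorm_mul, enorm_complex_ofReal, ← mul_assoc, Real.enorm_eq_ofReal_abs, eheat,
        ← ENNReal.ofReal_mul hC]
      gcongr
      exact hR t ht htT y hy.le z (mem_Ioi.1 hz).le
    have hRint : ∫⁻ z in Ioi (0 : ℝ), ‖(R z : ℂ) * u z‖ₑ ≤
        ENNReal.ofReal C * potMajZero ν initMeasure (fun p => u p.2) t y := by
      rw [potMajZero, initMeasure, measurableEmbedding_init.lintegral_map,
        ← lintegral_const_mul' _ _ ENNReal.ofReal_ne_top]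
      simp only [sub_zero]
      exact setLIntegral_mono' measurableSet_Ioi hRe
    have hmaj : potMajZero ν initMeasure (fun p => u p.2) t y < ⊤ := by
      refine (potMajZero_init_le hν u t y).trans_lt ?_
      exact ENNReal.mul_lt_top (ENNReal.mul_lt_top ENNReal.ofReal_lt_top
        (tpow_ne_top _ _).lt_top) hu.2
    have hRi : Integrable (fun z => (R z : ℂ) * u z) halfLine :=
      ⟨(Complex.measurable_ofReal.comp hRm).aestronglyMeasurable.mul hu.1,
        hRint.trans_lt (ENNReal.mul_lt_top ENNReal.ofReal_lt_top hmaj)⟩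
    have i1 := (integrable_heatDx_mul hν hu t y).const_mul (e : ℂ)
    have i2 := (integrable_heatDx_mul hν hu t (-y)).const_mul ((e * σ : ℝ) : ℂ)
    have hpot : pot (kernDy ν d β σ) initMeasure (fun p => u p.2) t y =
        (e * V t y - ((e * σ : ℝ) : ℂ) * V t (-y)) + ∫ z in Ioi (0 : ℝ), (R z : ℂ) * u z := by
      have i3 := integral_add (i1.sub i2) hRi
      have i4 := integral_sub i1 i2
      simp only [Pi.sub_apply] at i3 i4
      rw [pot_init, hV, ← integral_const_mul, ← integral_const_mul, ← i4, ← i3]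
      congr 1 with z
      have : heatDx ν t (-y - z) = -heatDx ν t (y + z) := by
        rw [← heatDx_neg]; congr 1; ring
      rw [this, hRdef]
      push_cast
      ring
    rw [hpot]
    refine (enorm_add_le _ _).trans (add_le_add ((enorm_sub_le).trans (add_le_add ?_ ?_))
      ((enorm_integral_le_lintegral_enorm _).trans hRint))
    · rw [enorm_mul, enorm_complex_ofReal]
      exact mul_le_of_le_one_left' he
    · rw [enorm_mul, enorm_complex_ofReal, enorm_mul]
      exact mul_le_of_le_one_left' (mul_le_one' he hσe)
  set N := ENNReal.ofReal C * eLpNorm u 2 halfLine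
  have hpt : ∀ t ∈ Ioo 0 T,
      eLpNorm (pot (kernDy ν d β σ) initMeasure (fun p => u p.2) t) 2 halfLine ^ 2 ≤
        4 * (4 * ((∫⁻ y, ‖V t y‖ₑ ^ 2) + ∫⁻ y, ‖V t y‖ₑ ^ 2) + N ^ 2) := by
    intro t ht
    rw [eLpNorm_two_sq]
    calc _ ≤ ∫⁻ y in Ioi (0 : ℝ), 4 * (4 * (‖V t y‖ₑ ^ 2 + ‖V t (-y)‖ₑ ^ 2) +
          (ENNReal.ofReal C * potMajZero ν initMeasure (fun p => u p.2) t y) ^ 2) := by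
          refine setLIntegral_mono' measurableSet_Ioi fun y hy => ?_
          calc _ ≤ ((‖V t y‖ₑ + ‖V t (-y)‖ₑ) +
                ENNReal.ofReal C * potMajZero ν initMeasure (fun p => u p.2) t y) ^ 2 := by
                gcongr; exact hdec t ht.1 ht.2.le y hy
            _ ≤ _ := (add_sq_le_four_mul _ _).trans (by gcongr; exact add_sq_le_four_mul _ _)
      _ ≤ _ := by
          have m1 : AEMeasurable (fun y => ‖V t y‖ₑ ^ 2) volume := (hVm t).enorm.pow_const 2
          have m2 : AEMeasurable (fun y => ‖V t (-y)‖ₑ ^ 2) volume :=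
            m1.comp_quasiMeasurePreserving (Measure.measurePreserving_neg volume).quasiMeasurePreserving
          have m3 : AEMeasurable (fun y => 4 * (‖V t y‖ₑ ^ 2 + ‖V t (-y)‖ₑ ^ 2)) halfLine :=
            ((m1.add m2).const_mul 4).mono_measure Measure.restrict_le_self
          rw [lintegral_const_mul' _ _ (by norm_num), lintegral_add_left' m3,
            lintegral_const_mul' _ _ (by norm_num),
            lintegral_add_left' (m1.mono_measure Measure.restrict_le_self)]
          gcongr 4 * (4 * (?_ + ?_) + ?_)
          · exact setLIntegral_le_lintegral _ _
          · exact (setLIntegral_le_lintegral _ _).trans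
              (lintegral_neg_eq_self (fun y => ‖V t y‖ₑ ^ 2)).le
          · simp_rw [mul_pow]
            rw [lintegral_const_mul' _ _ (by finiteness), mul_pow]
            gcongr
            have := eLpNorm_potMajZero_init_le hν hu.1 t
            calc _ = eLpNorm (potMajZero ν initMeasure (fun p => u p.2) t) 2 halfLine ^ 2 := by
                  rw [eLpNorm_two_sq]; simp only [enorm_eq_self]
              _ ≤ _ := by gcongr
  have hE := lintegral_sq_heatDx_le_complex (T := T) hν hu
  have hEm : AEMeasurable (fun q : ℝ × ℝ => ‖V q.1 q.2‖ₑ ^ 2) ((timeInterval T).prod volume) :=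
    hVm2.enorm.pow_const 2
  rw [lintegral_prod _ hEm] at hE
  have hEfin : ∫⁻ t in Ioo (0 : ℝ) T, ∫⁻ y, ‖V t y‖ₑ ^ 2 < ⊤ := hE.trans_lt (by finiteness)
  refine (setLIntegral_mono' measurableSet_Ioo hpt).trans_lt ?_
  have hI : AEMeasurable (fun t => ∫⁻ y, ‖V t y‖ₑ ^ 2) (timeInterval T) :=
    hEm.lintegral_prod_right'
  rw [lintegral_const_mul' _ _ (by norm_num), lintegral_add_right _ measurable_const,
    lintegral_const_mul' _ _ (by norm_num), lintegral_add_left' hI, setLIntegral_const]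
  have : volume (Ioo 0 T) ≠ ⊤ := measure_Ioo_lt_top.ne
  have : N ≠ ⊤ := by finiteness
  finiteness

end Energy

/-! ### The residual kernel -/

section Residual

variable {ν a t : ℝ}

/-- A Gaussian integral along the line `Re μ = a`. The result does not contain `a`, as contour
shifting predicts; completing the square produces the heat kernel at `x + s`. -/
theorem integral_cexp_contour (hν : 0 < ν) (ht : 0 < t) (a k x s : ℝ) :
    ∫ b : ℝ, Complex.exp (ν * ((a + b * Complex.I) ^ 2 - k ^ 2) * t - (a + b * Complex.I) * x +
      -((a + b * Complex.I) - k) * s) =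
      ((2 * Real.pi * Real.exp (-(ν * k ^ 2 * t)) * (Real.exp (k * s) * heat ν t (x + s)) : ℝ) : ℂ) := by
  have hνt : 0 < ν * t := mul_pos hν ht
  have h := integral_cexp_quadratic (b := (-(ν * t) : ℝ)) (by simpa using hνt)
    ((2 * ν * t * a - (x + s) : ℝ) * Complex.I)
    ((ν * t * a ^ 2 - a * (x + s) - ν * k ^ 2 * t + k * s : ℝ))
  have e : ∀ b : ℝ, (ν : ℂ) * ((a + b * Complex.I) ^ 2 - k ^ 2) * t - (a + b * Complex.I) * x +
      -((a + b * Complex.I) - k) * s = ((-(ν * t) : ℝ) : ℂ) * b ^ 2 +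
      ((2 * ν * t * a - (x + s) : ℝ) * Complex.I) * b +
      ((ν * t * a ^ 2 - a * (x + s) - ν * k ^ 2 * t + k * s : ℝ)) := by
    intro b
    push_cast
    linear_combination (ν : ℂ) * b ^ 2 * t * Complex.I_sq
  simp_rw [e]
  rw [h]
  have e1 : ((Real.pi : ℂ) / -((-(ν * t) : ℝ) : ℂ)) ^ (1 / 2 : ℂ) =
      ((2 * Real.pi * (Real.sqrt (4 * Real.pi * ν * t))⁻¹ : ℝ) : ℂ) := by
    have h1 : (Real.pi : ℂ) / -((-(ν * t) : ℝ) : ℂ) =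
        ((2 * Real.pi * (Real.sqrt (4 * Real.pi * ν * t))⁻¹ : ℝ) : ℂ) ^ 2 := by
      rw [← Complex.ofReal_pow, mul_pow, inv_pow, Real.sq_sqrt (by positivity), ← Complex.ofReal_neg,
        ← Complex.ofReal_div]
      congr 1
      field_simp
      norm_num
    rw [h1, one_div, Complex.sq_cpow_two_inv]
    rw [Complex.ofReal_re]
    positivity
  have e2 : ((ν * t * a ^ 2 - a * (x + s) - ν * k ^ 2 * t + k * s : ℝ) : ℂ) -
      ((2 * ν * t * a - (x + s) : ℝ) * Complex.I) ^ 2 / (4 * ((-(ν * t) : ℝ) : ℂ)) =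
      ((-(ν * k ^ 2 * t) + (k * s + -((x + s) ^ 2 / (4 * ν * t))) : ℝ) : ℂ) := by
    have h0 : (ν : ℂ) ≠ 0 := by exact_mod_cast hν.ne'
    have h1 : (t : ℂ) ≠ 0 := by exact_mod_cast ht.ne'
    rw [mul_pow, Complex.I_sq]
    push_cast
    field_simp
    ring
  rw [e1, e2, ← Complex.ofReal_exp, ← Complex.ofReal_mul, Real.exp_add, Real.exp_add, heat]
  congr 1
  ring

/-- The parabola is parametrised so that `λ + ν |ξ|² = ν (a + i b)²`, and `a > 0` selects the
principal branch. -/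
theorem rootMu_contour (hν : 0 < ν) (ξ : Fin 2 → ℤ) (ha : 0 < a) (b : ℝ) :
    rootMu ν ξ (contour ν ξ a b) = a + b * Complex.I := by
  have hs := Real.sqrt_pos.2 hν
  have h1 : contour ν ξ a b + ((ν * freqNorm ξ ^ 2 : ℝ) : ℂ) =
      (((Real.sqrt ν : ℝ) : ℂ) * (a + b * Complex.I)) ^ 2 := by
    rw [contour, mul_pow, ← Complex.ofReal_pow (Real.sqrt ν), Real.sq_sqrt hν.le]
    push_cast
    ring
  rw [rootMu, h1, one_div, Complex.sq_cpow_two_inv]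
  · rw [← mul_assoc, inv_mul_cancel₀ (by exact_mod_cast hs.ne'), one_mul]
  · simp
    positivity

theorem deriv_contour (ν : ℝ) (ξ : Fin 2 → ℤ) (a b : ℝ) :
    deriv (contour ν ξ a) b = 2 * ν * (a + b * Complex.I) * Complex.I := by
  have h1 : HasDerivAt (fun b : ℝ => (a : ℂ) + (b : ℂ) * Complex.I) Complex.I b := by
    simpa using ((Complex.ofRealCLM.hasDerivAt (x := b)).mul_const Complex.I).const_add (a : ℂ)
  have h2 := ((h1.pow 2).sub_const ((freqNorm ξ ^ 2 : ℝ) : ℂ)).const_mul (ν : ℂ)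
  have h3 : deriv (contour ν ξ a) b = _ := h2.deriv
  rw [h3]
  push_cast
  ring

/-- The residual kernel is the Robin correction of the Neumann heat kernel. -/
theorem residualScalar_eq (hν : 0 < ν) (ξ : Fin 2 → ℤ) (hξ : 0 < freqNorm ξ) (ha : freqNorm ξ < a)
    (ht : 0 < t) {y z : ℝ} (hy : 0 ≤ y) (hz : 0 ≤ z) :
    (freqNorm ξ : ℂ) ^ 2 * residualScalar ν ξ a t y z =
      ((Real.exp (-(ν * freqNorm ξ ^ 2 * t)) * robinTail ν (freqNorm ξ) t (y + z) : ℝ) : ℂ) := by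
  set k := freqNorm ξ with hk
  set x := y + z
  have ha0 : 0 < a := hξ.trans ha
  have hk0 : (k : ℂ) ≠ 0 := by exact_mod_cast hξ.ne'
  have hν0 : (ν : ℂ) ≠ 0 := by exact_mod_cast hν.ne'
  set μ : ℝ → ℂ := fun b => a + b * Complex.I with hμ
  have hre : ∀ b, (μ b).re = a := fun b => by simp [hμ]
  set E : ℝ → ℝ → ℂ := fun b s => Complex.exp (ν * (μ b ^ 2 - k ^ 2) * t - μ b * x + -(μ b - k) * s)
    with hE
  -- The factors `μ` and `μ + k` cancel against `dλ = 2 ν i μ db` and `λ = ν (μ - k)(μ + k)`. The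
  -- remaining `1 / (μ - k)` is a Laplace integral, convergent because `Re μ = a > k`.
  have hint : ∀ b, Complex.exp (contour ν ξ a b * (t : ℂ)) *
      ((rootMu ν ξ (contour ν ξ a b) + (k : ℂ)) /
        (rootMu ν ξ (contour ν ξ a b) * contour ν ξ a b * (k : ℂ))) *
      Complex.exp (-(rootMu ν ξ (contour ν ξ a b) * ((|y + z| : ℝ) : ℂ))) *
      deriv (contour ν ξ a) b = 2 * Complex.I * (k : ℂ)⁻¹ * ∫ s in Ioi (0 : ℝ), E b s := by
    intro b
    rw [rootMu_contour hν ξ ha0, deriv_contour, contour, ← hk, abs_of_nonneg (add_nonneg hy hz)]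
    change Complex.exp (ν * (μ b ^ 2 - ((k ^ 2 : ℝ) : ℂ)) * t) * ((μ b + k) /
      (μ b * (ν * (μ b ^ 2 - ((k ^ 2 : ℝ) : ℂ))) * k)) * Complex.exp (-(μ b * (x : ℂ))) *
      (2 * ν * μ b * Complex.I) = _
    have n1 : μ b ≠ 0 := fun h => by have := hre b; rw [h] at this; simp at this; linarith
    have n2 : μ b - k ≠ 0 := fun h => by
      have := congrArg Complex.re h; rw [Complex.sub_re, hre] at this; simp at this; linarith
    have n3 : μ b + k ≠ 0 := fun h => by
      have := congrArg Complex.re h; rw [Complex.add_re, hre] at this; simp at this; linarith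
    have hs : ∫ s in Ioi (0 : ℝ), E b s =
        Complex.exp (ν * (μ b ^ 2 - k ^ 2) * t - μ b * x) * (μ b - k)⁻¹ := by
      simp only [hE, Complex.exp_add]
      rw [integral_const_mul, integral_exp_mul_complex_Ioi (by simp [hre]; linarith)]
      rw [Complex.ofReal_zero, mul_zero, Complex.exp_zero, neg_div_neg_eq, one_div]
    rw [hs, Complex.exp_sub, Complex.exp_neg]
    push_cast
    have n4 : μ b ^ 2 - k ^ 2 ≠ 0 := by
      rw [sq_sub_sq]; exact mul_ne_zero n3 n2
    have n5 := Complex.exp_ne_zero (μ b * x)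
    rw [show (μ b + k) / (μ b * (ν * (μ b ^ 2 - (k : ℂ) ^ 2)) * k) =
      1 / (μ b * ν * (μ b - k) * k) by rw [sq_sub_sq]; field_simp]
    field_simp
  -- The modulus of `E` is exactly a constant times a Gaussian in `b` times `exp (-(a - k) s)`.
  have hEi : Integrable (Function.uncurry E) (volume.prod halfLine) := by
    have h1 : Integrable fun b : ℝ => Real.exp (-(ν * t) * b ^ 2) :=
      integrable_exp_neg_mul_sq (mul_pos hν ht)
    have h2 : Integrable (fun s : ℝ => Real.exp (-(a - k) * s)) halfLine :=
      exp_neg_integrableOn_Ioi 0 (by linarith)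
    refine ((h1.mul_prod h2).const_mul (Real.exp (ν * (a ^ 2 - k ^ 2) * t - a * x))).mono'
      (Continuous.aestronglyMeasurable (by simp only [hE, hμ, Function.uncurry_def]; fun_prop))
      (ae_of_all _ fun p => ?_)
    simp only [Function.uncurry, hE]
    rw [Complex.norm_exp, ← Real.exp_add, ← Real.exp_add]
    refine Real.exp_le_exp.2 (le_of_eq ?_)
    simp [hμ, sq, Complex.add_re, Complex.mul_re, Complex.mul_im]
    ring
  rw [residualScalar, contourIntegral]
  simp_rw [← hk, hint]
  rw [integral_const_mul, integral_integral_swap hEi]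
  simp only [hE, hμ, integral_cexp_contour hν ht a k x]
  rw [integral_complex_ofReal, integral_const_mul, robinTail]
  have hπ : (Real.pi : ℂ) ≠ 0 := by exact_mod_cast Real.pi_ne_zero
  have hI := Complex.I_ne_zero
  push_cast
  field_simp

end Residual

/-! ### Linear combinations -/

theorem integral_sum_mul {α ι : Type*} [MeasurableSpace α] {μ : Measure α} (s : Finset ι)
    (a : ι → ℂ) {f : ι → α → ℂ} {g : α → ℂ} (h : ∀ i ∈ s, Integrable (fun x => f i x * g x) μ) :
    ∫ x, (∑ i ∈ s, a i * f i x) * g x ∂μ = ∑ i ∈ s, a i * ∫ x, f i x * g x ∂μ := by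
  simp_rw [Finset.sum_mul, mul_assoc]
  rw [integral_finsetSum s fun i hi => (h i hi).const_mul _]
  simp_rw [integral_const_mul]

theorem IsH1.integrable_mul {u : ℝ → ℂ} (hu : MemLp u 2 halfLine) {φ : ℝ → ℂ}
    (hφ : Continuous φ) (hc : HasCompactSupport φ) :
    Integrable (fun z => u z * φ z) halfLine :=
  MemLp.integrable_mul hu (hφ.memLp_of_hasCompactSupport hc : MemLp φ 2 halfLine)

theorem IsH1.sum {ι : Type*} (s : Finset ι) (a : ι → ℂ) {u u' : ι → ℝ → ℂ} {c : ι → ℂ}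
    (h : ∀ i ∈ s, IsH1 (u i) (u' i) (c i)) :
    IsH1 (fun z => ∑ i ∈ s, a i * u i z) (fun z => ∑ i ∈ s, a i * u' i z)
      (∑ i ∈ s, a i * c i) := by
  refine ⟨memLp_finsetSum s fun i hi => (h i hi).memLp.const_mul _,
    memLp_finsetSum s fun i hi => (h i hi).memLp_deriv.const_mul _, fun φ hφ hc => ?_⟩
  have hφ' : Continuous (deriv φ) := hφ.continuous_deriv (by simp)
  rw [integral_sum_mul s a fun i hi => IsH1.integrable_mul (h i hi).memLp hφ' hc.deriv,
    integral_sum_mul s a fun i hi => IsH1.integrable_mul (h i hi).memLp_deriv hφ.continuous hc,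
    Finset.sum_mul, ← Finset.sum_neg_distrib, ← Finset.sum_sub_distrib]
  refine Finset.sum_congr rfl fun i hi => ?_
  rw [(h i hi).parts φ hφ hc]
  ring

theorem IsH1.congr {u u' v : ℝ → ℂ} {c : ℂ} (h : IsH1 u u' c) (e : u =ᵐ[halfLine] v) :
    IsH1 v u' c := by
  refine ⟨h.memLp.ae_eq e, h.memLp_deriv, fun φ hφ hc => ?_⟩
  rw [← h.parts φ hφ hc]
  refine integral_congr_ae ?_
  filter_upwards [e] with z hz
  rw [hz]

/-- Scalar functions in `L^p(0, T; H¹(0, ∞))`. -/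
structure MemLpH1 (p : ℝ≥0∞) (T : ℝ) (u u' : ℝ → ℝ → ℂ) (c : ℝ → ℂ) : Prop where
  meas : AEStronglyMeasurable (Function.uncurry u) ((timeInterval T).prod halfLine)
  meas_deriv : AEStronglyMeasurable (Function.uncurry u') ((timeInterval T).prod halfLine)
  isH1 : ∀ᵐ t ∂(timeInterval T), IsH1 (u t) (u' t) (c t)
  norm_lt_top : eLpNorm (fun t => eLpNorm (u t) 2 halfLine) p (timeInterval T) < ⊤
  norm_deriv_lt_top : eLpNorm (fun t => eLpNorm (u' t) 2 halfLine) p (timeInterval T) < ⊤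

theorem memLpH1_one_iff {T : ℝ} {u u' : ℝ → ℝ → ℂ} {c : ℝ → ℂ} :
    MemLpH1 1 T u u' c ↔ MemLOneH1 T u u' c := by
  have e : ∀ f : ℝ → ℝ≥0∞, eLpNorm f 1 (timeInterval T) = ∫⁻ t in Ioo (0 : ℝ) T, f t := fun f => by
    simp [eLpNorm_one_eq_lintegral_enorm]
  constructor
  · rintro ⟨h1, h2, h3, h4, h5⟩
    rw [e] at h4 h5
    exact ⟨h1, h2, h3, h4, h5⟩
  · rintro ⟨h1, h2, h3, h4, h5⟩
    rw [← e] at h4 h5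
    exact ⟨h1, h2, h3, h4, h5⟩

theorem aemeasurable_eLpNorm {E : Type*} [NormedAddCommGroup E] {T : ℝ} {u : ℝ → ℝ → E}
    (hu : AEStronglyMeasurable (Function.uncurry u) ((timeInterval T).prod halfLine)) :
    AEMeasurable (fun t => eLpNorm (u t) 2 halfLine) (timeInterval T) := by
  simp_rw [eLpNorm_eq_lintegral_rpow_enorm_toReal (two_ne_zero : (2 : ℝ≥0∞) ≠ 0)
    (ENNReal.ofNat_ne_top : (2 : ℝ≥0∞) ≠ ⊤)]
  refine AEMeasurable.pow_const (AEMeasurable.lintegral_prod_right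
    (f := fun t y => ‖u t y‖ₑ ^ _) ?_) _
  exact hu.enorm.pow_const _

theorem eLpNorm_ennreal_sum_lt_top {ι : Type*} {T : ℝ} {p : ℝ≥0∞} (hp : 1 ≤ p) (s : Finset ι)
    (a : ι → ℝ≥0∞) (ha : ∀ i ∈ s, a i ≠ ⊤) {f : ι → ℝ → ℝ≥0∞}
    (hf : ∀ i ∈ s, AEMeasurable (f i) (timeInterval T))
    (hn : ∀ i ∈ s, eLpNorm (f i) p (timeInterval T) < ⊤) :
    eLpNorm (fun t => ∑ i ∈ s, a i * f i t) p (timeInterval T) < ⊤ := by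
  have e : (fun t => ∑ i ∈ s, a i * f i t) = ∑ i ∈ s, fun t => a i * f i t := by
    ext t; simp
  rw [e]
  refine (eLpNorm_sum_le (fun i hi => ((hf i hi).const_mul _).aestronglyMeasurable) hp).trans_lt ?_
  refine ENNReal.sum_lt_top.2 fun i hi => ?_
  have h1 := eLpNorm_le_nnreal_smul_eLpNorm_of_ae_le_mul' (μ := timeInterval T)
    (f := fun t => a i * f i t) (g := f i) (c := (a i).toNNReal)
    (ae_of_all _ fun t => by
      simp only [enorm_eq_self]
      rw [ENNReal.coe_toNNReal (ha i hi)]) p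
  refine h1.trans_lt ?_
  rw [ENNReal.smul_def, smul_eq_mul]
  exact ENNReal.mul_lt_top ENNReal.coe_lt_top (hn i hi)

theorem eLpNorm_sum_const_mul_le {ι : Type*} (s : Finset ι) (a : ι → ℂ) {u : ι → ℝ → ℂ}
    (h : ∀ i ∈ s, AEStronglyMeasurable (u i) halfLine) :
    eLpNorm (fun z => ∑ i ∈ s, a i * u i z) 2 halfLine ≤
      ∑ i ∈ s, ‖a i‖ₑ * eLpNorm (u i) 2 halfLine := by
  have e : (fun z => ∑ i ∈ s, a i * u i z) = ∑ i ∈ s, fun z => a i * u i z := by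
    ext t; simp
  rw [e]
  refine (eLpNorm_sum_le (fun i hi => (h i hi).const_mul _) (by norm_num)).trans
    (Finset.sum_le_sum fun i _ => ?_)
  exact (eLpNorm_const_smul (a i) (u i) 2 halfLine).le

theorem MemLpH1.sum {ι : Type*} {p : ℝ≥0∞} (hp : 1 ≤ p) {T : ℝ} (s : Finset ι) (a : ι → ℂ)
    {u u' : ι → ℝ → ℝ → ℂ} {c : ι → ℝ → ℂ} (h : ∀ i ∈ s, MemLpH1 p T (u i) (u' i) (c i)) :
    MemLpH1 p T (fun t z => ∑ i ∈ s, a i * u i t z) (fun t z => ∑ i ∈ s, a i * u' i t z)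
      (fun t => ∑ i ∈ s, a i * c i t) := by
  have hae : ∀ᵐ t ∂(timeInterval T), ∀ i ∈ s, IsH1 (u i t) (u' i t) (c i t) :=
    (ae_ball_iff s.countable_toSet).2 fun i hi => (h i hi).isH1
  have key : ∀ v : ι → ℝ → ℝ → ℂ,
      (∀ i ∈ s, AEStronglyMeasurable (Function.uncurry (v i)) ((timeInterval T).prod halfLine)) →
      (∀ᵐ t ∂(timeInterval T), ∀ i ∈ s, AEStronglyMeasurable (v i t) halfLine) →
      (∀ i ∈ s, eLpNorm (fun t => eLpNorm (v i t) 2 halfLine) p (timeInterval T) < ⊤) →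
      eLpNorm (fun t => eLpNorm (fun z => ∑ i ∈ s, a i * v i t z) 2 halfLine) p (timeInterval T)
        < ⊤ := by
    intro v hv1 hv2 hv3
    refine lt_of_le_of_lt ?_ (eLpNorm_ennreal_sum_lt_top hp s (fun i => ‖a i‖ₑ)
      (fun i _ => enorm_ne_top) (fun i hi => aemeasurable_eLpNorm (hv1 i hi)) hv3)
    refine eLpNorm_mono_enorm_ae ?_
    filter_upwards [hv2] with t ht
    simp only [enorm_eq_self]
    exact eLpNorm_sum_const_mul_le s a ht
  refine ⟨?_, ?_, ?_, ?_, ?_⟩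
  · exact Finset.aestronglyMeasurable_fun_sum s fun i hi => (h i hi).meas.const_mul (a i)
  · exact Finset.aestronglyMeasurable_fun_sum s fun i hi => (h i hi).meas_deriv.const_mul (a i)
  · filter_upwards [hae] with t ht using IsH1.sum s a ht
  · refine key u (fun i hi => (h i hi).meas) ?_ fun i hi => (h i hi).norm_lt_top
    filter_upwards [hae] with t ht i hi using (ht i hi).memLp.1
  · refine key u' (fun i hi => (h i hi).meas_deriv) ?_ fun i hi => (h i hi).norm_deriv_lt_top
    filter_upwards [hae] with t ht i hi using (ht i hi).memLp_deriv.1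

theorem heatForm_sum {ι : Type*} {ν d T : ℝ} {φ : ℝ → ℝ → ℂ} (hφ : IsTest T φ) (s : Finset ι)
    (a : ι → ℂ) {u u' : ι → ℝ → ℝ → ℂ} {c : ι → ℝ → ℂ}
    (h : ∀ i ∈ s, MemLOneH1 T (u i) (u' i) (c i)) :
    heatForm ν d T (fun t z => ∑ i ∈ s, a i * u i t z) (fun t z => ∑ i ∈ s, a i * u' i t z) φ =
      ∑ i ∈ s, a i * heatForm ν d T (u i) (u' i) φ := by
  unfold heatForm
  have i1 := fun i hi => ((h i hi).integrable_test (continuous_testDt hφ.smooth)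
    (hasCompactSupport_testDt hφ.smooth hφ.compact)).1
  have i2 := fun i hi => ((h i hi).integrable_test (continuous_testDz hφ.smooth)
    (hasCompactSupport_testDz hφ.smooth hφ.compact)).2
  have i3 := fun i hi => ((h i hi).integrable_test hφ.smooth.continuous hφ.compact).1
  have e1 := integral_sum_mul s a (f := fun i (q : ℝ × ℝ) => u i q.1 q.2) i1
  have e2 := integral_sum_mul s a (f := fun i (q : ℝ × ℝ) => u' i q.1 q.2) i2
  have e3 := integral_sum_mul s a (f := fun i (q : ℝ × ℝ) => u i q.1 q.2)
    (g := fun q => φ q.1 q.2) i3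
  rw [e1, e2, e3, ← Finset.sum_neg_distrib, Finset.mul_sum, Finset.mul_sum,
    ← Finset.sum_add_distrib, ← Finset.sum_add_distrib]
  refine Finset.sum_congr rfl fun i _ => ?_
  ring

/-! ### Vector-valued functions -/

theorem aestronglyMeasurable_pi {α : Type*} [MeasurableSpace α] {μ : Measure α}
    {f : α → Fin 3 → ℂ} :
    AEStronglyMeasurable f μ ↔ ∀ i, AEStronglyMeasurable (fun x => f x i) μ := by
  refine ⟨fun h i => (continuous_apply i).comp_aestronglyMeasurable h, fun h => ?_⟩
  exact (aemeasurable_pi_iff.2 fun i => (h i).aemeasurable).aestronglyMeasurable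

theorem eLpNorm_le_sum_component {α : Type*} [MeasurableSpace α] {μ : Measure α}
    {f : α → Fin 3 → ℂ} (h : ∀ i, AEStronglyMeasurable (fun x => f x i) μ) :
    eLpNorm f 2 μ ≤ ∑ i, eLpNorm (fun x => f x i) 2 μ := by
  have hle : eLpNorm f 2 μ ≤ eLpNorm (∑ i, fun x => ‖f x i‖) 2 μ := by
    refine eLpNorm_mono_real fun x => ?_
    rw [Finset.sum_apply, pi_norm_le_iff_of_nonneg (Finset.sum_nonneg fun i _ => norm_nonneg _)]
    exact fun i => Finset.single_le_sum (f := fun i => ‖f x i‖) (fun i _ => norm_nonneg _)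
      (Finset.mem_univ i)
  refine hle.trans ((eLpNorm_sum_le (fun i _ => (h i).norm) (by norm_num)).trans ?_)
  simp_rw [eLpNorm_norm]
  rfl

theorem IsLpH1.component {p : ℝ≥0∞} {T : ℝ} {w w' : ℝ → ℝ → Fin 3 → ℂ} {c : ℝ → Fin 3 → ℂ}
    (h : IsLpH1 p T w w' c) (i : Fin 3) :
    MemLpH1 p T (fun t z => w t z i) (fun t z => w' t z i) (fun t => c t i) := by
  refine ⟨aestronglyMeasurable_pi.1 h.meas i, aestronglyMeasurable_pi.1 h.meas_deriv i, ?_, ?_, ?_⟩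
  · filter_upwards [h.isH1] with t ht using ht i
  · refine (eLpNorm_mono_enorm fun t => ?_).trans_lt h.norm_lt_top
    simp only [enorm_eq_self]
    exact (eLpNorm_mono fun z => norm_le_pi_norm (w t z) i).trans le_self_add
  · refine (eLpNorm_mono_enorm fun t => ?_).trans_lt h.norm_lt_top
    simp only [enorm_eq_self]
    exact (eLpNorm_mono fun z => norm_le_pi_norm (w' t z) i).trans le_add_self

theorem isLpH1_of_component {p : ℝ≥0∞} (hp : 1 ≤ p) {T : ℝ} {w w' : ℝ → ℝ → Fin 3 → ℂ}
    {c : ℝ → Fin 3 → ℂ} (h : ∀ i, MemLpH1 p T (fun t z => w t z i) (fun t z => w' t z i)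
      (fun t => c t i)) : IsLpH1 p T w w' c := by
  have hae : ∀ᵐ t ∂(timeInterval T), ∀ i, IsH1 (fun z => w t z i) (fun z => w' t z i) (c t i) :=
    ae_all_iff.2 fun i => (h i).isH1
  refine ⟨aestronglyMeasurable_pi.2 fun i => (h i).meas,
    aestronglyMeasurable_pi.2 fun i => (h i).meas_deriv, hae, ?_⟩
  have e1 := eLpNorm_ennreal_sum_lt_top (T := T) hp Finset.univ (fun _ : Fin 3 => 1)
    (fun _ _ => ENNReal.one_ne_top) (fun i _ => aemeasurable_eLpNorm (h i).meas)
    (fun i _ => (h i).norm_lt_top)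
  have e2 := eLpNorm_ennreal_sum_lt_top (T := T) hp Finset.univ (fun _ : Fin 3 => 1)
    (fun _ _ => ENNReal.one_ne_top) (fun i _ => aemeasurable_eLpNorm (h i).meas_deriv)
    (fun i _ => (h i).norm_deriv_lt_top)
  have m1 : AEMeasurable (fun t => ∑ i : Fin 3, 1 * eLpNorm (fun z => w t z i) 2 halfLine)
      (timeInterval T) := Finset.aemeasurable_fun_sum _ fun i _ =>
        (aemeasurable_eLpNorm (h i).meas).const_mul 1
  have m2 : AEMeasurable (fun t => ∑ i : Fin 3, 1 * eLpNorm (fun z => w' t z i) 2 halfLine)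
      (timeInterval T) := Finset.aemeasurable_fun_sum _ fun i _ =>
        (aemeasurable_eLpNorm (h i).meas_deriv).const_mul 1
  refine lt_of_le_of_lt ?_ (ENNReal.add_lt_top.2 ⟨e1, e2⟩)
  refine le_trans (eLpNorm_mono_enorm_ae ?_)
    (eLpNorm_add_le m1.aestronglyMeasurable m2.aestronglyMeasurable hp)
  filter_upwards [hae] with t ht
  simp only [enorm_eq_self, Pi.add_apply, one_mul]
  exact add_le_add (eLpNorm_le_sum_component fun i => (ht i).memLp.1)
    (eLpNorm_le_sum_component fun i => (ht i).memLp_deriv.1)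

theorem ae_timeInterval_prod_halfLine {T : ℝ} {P : ℝ × ℝ → Prop}
    (h : ∀ t ∈ Ioo 0 T, ∀ z, 0 < z → P (t, z)) : ∀ᵐ q ∂(timeInterval T).prod halfLine, P q := by
  rw [Measure.prod_restrict]
  filter_upwards [ae_restrict_mem (measurableSet_Ioo.prod measurableSet_Ioi)] with q hq
  exact h q.1 hq.1 q.2 hq.2

theorem IsLpH1.congr {p : ℝ≥0∞} {T : ℝ} {w w' v : ℝ → ℝ → Fin 3 → ℂ} {c : ℝ → Fin 3 → ℂ}
    (h : IsLpH1 p T w w' c) (e : ∀ t ∈ Ioo 0 T, ∀ z, 0 < z → w t z = v t z) :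
    IsLpH1 p T v w' c := by
  have hz : ∀ t ∈ Ioo 0 T, w t =ᵐ[halfLine] v t := fun t ht => by
    filter_upwards [ae_restrict_mem measurableSet_Ioi] with z hz using e t ht z hz
  refine ⟨h.meas.congr (ae_timeInterval_prod_halfLine e), h.meas_deriv, ?_, ?_⟩
  · filter_upwards [h.isH1, ae_restrict_mem measurableSet_Ioo] with t ht htT i
    exact (ht i).congr ((hz t htT).mono fun z hz => congrFun hz i)
  · refine lt_of_le_of_lt (eLpNorm_mono_enorm_ae ?_) h.norm_lt_top
    filter_upwards [ae_restrict_mem measurableSet_Ioo] with t ht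
    rw [eLpNorm_congr_ae (hz t ht)]

theorem MemLinftyL2.congr {T : ℝ} {w v : ℝ → ℝ → Fin 3 → ℂ} (h : MemLinftyL2 T w)
    (e : ∀ t ∈ Ioo 0 T, ∀ z, 0 < z → w t z = v t z) : MemLinftyL2 T v := by
  obtain ⟨h1, C, hC⟩ := h
  refine ⟨h1.congr (ae_timeInterval_prod_halfLine e), C, ?_⟩
  filter_upwards [hC, ae_restrict_mem measurableSet_Ioo] with t ht htT
  rw [← eLpNorm_congr_ae (f := w t)]
  · exact ht
  · filter_upwards [ae_restrict_mem measurableSet_Ioi] with z hz using e t htT z hz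

theorem WeakHeat.congr {ν : ℝ} {ξ : Fin 2 → ℤ} {T : ℝ} {u v u' F : ℝ → ℝ → ℂ} {u₀ q : ℝ → ℂ}
    {φ : ℝ → ℝ → ℂ} (h : WeakHeat ν ξ T u u' F u₀ q φ)
    (e : ∀ t ∈ Ioo 0 T, ∀ z, 0 < z → u t z = v t z) : WeakHeat ν ξ T v u' F u₀ q φ := by
  have he : ∀ ψ : ℝ → ℝ → ℂ, ∫ t in Ioo (0 : ℝ) T, ∫ z in Ioi (0 : ℝ), v t z * ψ t z =
      ∫ t in Ioo (0 : ℝ) T, ∫ z in Ioi (0 : ℝ), u t z * ψ t z := fun ψ =>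
    setIntegral_congr_fun measurableSet_Ioo fun t ht =>
      setIntegral_congr_fun measurableSet_Ioi fun z hz => by simp only [e t ht z hz]
  rw [WeakHeat] at h ⊢
  rw [he φ, he fun t z => deriv (fun s => φ s z) t]
  exact h

theorem IsWeakSolution.congr {ν : ℝ} {ξ : Fin 2 → ℤ} {T : ℝ} {w₀ : ℝ → Fin 3 → ℂ}
    {f w v : ℝ → ℝ → Fin 3 → ℂ} {g : ℝ → Fin 2 → ℂ} (h : IsWeakSolution ν ξ T w₀ f g w)
    (e : ∀ t ∈ Ioo 0 T, ∀ z, 0 < z → w t z = v t z) : IsWeakSolution ν ξ T w₀ f g v := by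
  obtain ⟨w', c, h1, h2, h3, h4⟩ := h
  exact ⟨w', c, h1.congr e,
    fun φ hφ i => (h2 φ hφ i).congr fun t ht z hz => congrFun (e t ht z hz) _, h3,
    fun φ hφ h0 => (h4 φ hφ h0).congr fun t ht z hz => congrFun (e t ht z hz) _⟩

/-- The weak form in terms of integrals over space-time. -/
theorem weakHeat_iff {ν : ℝ} {ξ : Fin 2 → ℤ} {T : ℝ} {u u' F : ℝ → ℝ → ℂ} {u₀ q c : ℝ → ℂ}
    {φ : ℝ → ℝ → ℂ} (h : MemLOneH1 T u u' c) (hφ : IsTest T φ) :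
    WeakHeat ν ξ T u u' F u₀ q φ ↔ heatForm ν (ν * freqNorm ξ ^ 2) T u u' φ =
      (∫ z in Ioi (0 : ℝ), u₀ z * φ 0 z) +
      (∫ t in Ioo (0 : ℝ) T, ∫ z in Ioi (0 : ℝ), F t z * φ t z) +
      ∫ t in Ioo (0 : ℝ) T, q t * φ t 0 := by
  have e3 : Integrable (fun q : ℝ × ℝ => u q.1 q.2 * φ q.1 q.2) ((timeInterval T).prod halfLine) :=
    (h.integrable_test hφ.smooth.continuous hφ.compact).1
  rw [WeakHeat, heatForm,
    integral_prod _ (h.integrable_test (continuous_testDt hφ.smooth)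
      (hasCompactSupport_testDt hφ.smooth hφ.compact)).1,
    integral_prod _ (h.integrable_test (continuous_testDz hφ.smooth)
      (hasCompactSupport_testDz hφ.smooth hφ.compact)).2,
    integral_prod _ e3]
  rfl

/-! ### Splitting by boundary condition -/

/-- The projection `(ξ^⊥ ⊗ ξ^⊥) / |ξ|²`, zero for `ξ = 0`. -/
def perpProj (ξ : Fin 2 → ℤ) (i j : Fin 2) : ℂ := perpMatrix ξ i j * ((freqNorm ξ : ℂ) ^ 2)⁻¹

/-- The projections to the components with Neumann, Robin and Dirichlet boundary condition. -/
def bcProj (ξ : Fin 2 → ℤ) : Fin 3 → Matrix (Fin 3) (Fin 3) ℂ :=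
  ![!![1 - perpProj ξ 0 0, -perpProj ξ 0 1, 0; -perpProj ξ 1 0, 1 - perpProj ξ 1 1, 0; 0, 0, 0],
    !![perpProj ξ 0 0, perpProj ξ 0 1, 0; perpProj ξ 1 0, perpProj ξ 1 1, 0; 0, 0, 0],
    !![0, 0, 0; 0, 0, 0; 0, 0, 1]]

/-- The Robin parameters. -/
def bcRobin (ξ : Fin 2 → ℤ) : Fin 3 → ℝ := ![0, freqNorm ξ, 0]

/-- The image signs. -/
def bcSign : Fin 3 → ℝ := ![1, 1, -1]

theorem bcRobin_nonneg (ξ : Fin 2 → ℤ) (m : Fin 3) : 0 ≤ bcRobin ξ m := by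
  fin_cases m <;> simp [bcRobin, freqNorm]

theorem abs_bcSign_le (m : Fin 3) : |bcSign m| ≤ 1 := by
  fin_cases m <;> simp [bcSign]

theorem bcSign_cases (ξ : Fin 2 → ℤ) (m : Fin 3) :
    bcSign m = 1 ∨ bcSign m = -1 ∧ bcRobin ξ m = 0 := by
  fin_cases m <;> simp [bcSign, bcRobin]

theorem freqNorm_sq (ξ : Fin 2 → ℤ) : (freqNorm ξ : ℂ) ^ 2 = (ξ 0 : ℂ) ^ 2 + (ξ 1 : ℂ) ^ 2 := by
  rw [← Complex.ofReal_pow, freqNorm, Real.sq_sqrt (by positivity)]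
  push_cast
  ring

theorem freqNorm_eq_zero {ξ : Fin 2 → ℤ} (h : freqNorm ξ = 0) : ξ 0 = 0 ∧ ξ 1 = 0 := by
  rw [freqNorm, Real.sqrt_eq_zero (by positivity)] at h
  have h0 : (ξ 0 : ℝ) = 0 := by nlinarith [sq_nonneg (ξ 0 : ℝ), sq_nonneg (ξ 1 : ℝ)]
  have h1 : (ξ 1 : ℝ) = 0 := by nlinarith [sq_nonneg (ξ 0 : ℝ), sq_nonneg (ξ 1 : ℝ)]
  exact ⟨by exact_mod_cast h0, by exact_mod_cast h1⟩

/-- The vector `ξ^⊥` has length `|ξ|`, so the normalised matrix is idempotent. For `ξ = 0` division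
by zero makes it the zero projection. -/
theorem perpProj_mul_self (ξ : Fin 2 → ℤ) (i j : Fin 2) :
    perpProj ξ i 0 * perpProj ξ 0 j + perpProj ξ i 1 * perpProj ξ 1 j = perpProj ξ i j := by
  rcases eq_or_ne (freqNorm ξ) 0 with h | h
  · simp [perpProj, h]
  · have hk : (freqNorm ξ : ℂ) ≠ 0 := by exact_mod_cast h
    have hs := freqNorm_sq ξ
    fin_cases i <;> fin_cases j <;> simp [perpProj, perpMatrix] <;> field_simp <;> rw [hs] <;> ring

/-- `I - ξ ⊗ ξ / |ξ|²` is the projection onto `ξ^⊥`. The condition is thus Neumann along `ξ` and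
Robin with parameter `|ξ|` along `ξ^⊥`. -/
theorem boundaryFlux_eq (ν : ℝ) (ξ : Fin 2 → ℤ) (g : Fin 2 → ℂ) (c : Fin 3 → ℂ) (i : Fin 2) :
    boundaryFlux ν ξ g c i =
      g i + ν * freqNorm ξ * (perpProj ξ i 0 * c 0 + perpProj ξ i 1 * c 1) := by
  rcases eq_or_ne (freqNorm ξ) 0 with h | h
  · simp [boundaryFlux, perpProj, h]
  · have hk : (freqNorm ξ : ℂ) ≠ 0 := by exact_mod_cast h
    have hs := freqNorm_sq ξ
    fin_cases i <;> simp [boundaryFlux, perpProj, perpMatrix] <;> field_simp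
    · linear_combination ν * c 0 * hs
    · linear_combination ν * c 1 * hs

theorem imageHeatKernel_eq (ν : ℝ) (ξ : Fin 2 → ℤ) (σ t y z : ℝ) :
    imageHeatKernel ν ξ σ t y z = kern ν (ν * freqNorm ξ ^ 2) 0 σ t y z := by
  have e : (z - y) ^ 2 = (y - z) ^ 2 := by ring
  rw [imageHeatKernel, kern, heat, heat, robinTail, e, add_comm z y]
  ring

/-- The factor `|ξ|²` needed by the residual kernel is supplied by normalising the matrix. For `ξ =
0` the matrix vanishes, so the value of the scalar factor is irrelevant. -/
theorem residualScalar_mul_perpMatrix {ν a t y z : ℝ} (hν : 0 < ν) (ξ : Fin 2 → ℤ)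
    (ha : freqNorm ξ < a) (ht : 0 < t) (hy : 0 ≤ y) (hz : 0 ≤ z) (i j : Fin 2) :
    residualScalar ν ξ a t y z * perpMatrix ξ i j =
      (kern ν (ν * freqNorm ξ ^ 2) (freqNorm ξ) 1 t y z -
        kern ν (ν * freqNorm ξ ^ 2) 0 1 t y z : ℝ) * perpProj ξ i j := by
  rcases (Real.sqrt_nonneg _ : 0 ≤ freqNorm ξ).eq_or_lt with h | h
  · obtain ⟨h0, h1⟩ := freqNorm_eq_zero h.symm
    have : perpMatrix ξ i j = 0 := by fin_cases i <;> fin_cases j <;> simp [perpMatrix, h0, h1]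
    simp [perpProj, this]
  · have hk : (freqNorm ξ : ℂ) ≠ 0 := Complex.ofReal_ne_zero.2 h.ne'
    have e := residualScalar_eq hν ξ h ha ht hy hz
    have e2 : kern ν (ν * freqNorm ξ ^ 2) (freqNorm ξ) 1 t y z -
        kern ν (ν * freqNorm ξ ^ 2) 0 1 t y z =
        Real.exp (-(ν * freqNorm ξ ^ 2 * t)) * robinTail ν (freqNorm ξ) t (y + z) := by
      have : robinTail ν 0 t (y + z) = 0 := by simp [robinTail]
      rw [kern, kern, this]
      ring
    rw [e2, ← e, perpProj]
    field_simp

/-- The Green function in terms of the half-line kernels. -/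
theorem green_apply {ν a t y z : ℝ} (hν : 0 < ν) (ξ : Fin 2 → ℤ)
    (ha : freqNorm ξ < a) (ht : 0 < t) (hy : 0 ≤ y) (hz : 0 ≤ z) (i j : Fin 3) :
    green ν ξ a t y z i j = ∑ m, bcProj ξ m i j *
      (kern ν (ν * freqNorm ξ ^ 2) (bcRobin ξ m) (bcSign m) t y z : ℂ) := by
  have h := residualScalar_mul_perpMatrix hν ξ ha ht hy hz
  have h00 := h 0 0
  have h01 := h 0 1
  have h10 := h 1 0
  have h11 := h 1 1
  push_cast at h00 h01 h10 h11
  fin_cases i <;> fin_cases j <;>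
    simp [green, greenTangential, bcProj, bcRobin, bcSign, Fin.sum_univ_three,
      imageHeatKernel_eq, h00, h01, h10, h11] <;> ring

section MulVec

variable {α : Type*} [MeasurableSpace α] {μ : Measure α}

theorem integrable_mulVec {G : α → Matrix (Fin 3) (Fin 3) ℂ} {κ : Fin 3 → α → ℂ}
    {A : Fin 3 → Matrix (Fin 3) (Fin 3) ℂ} {b : α → Fin 3 → ℂ}
    (hG : ∀ᵐ x ∂μ, ∀ i j, G x i j = ∑ m, A m i j * κ m x)
    (hi : ∀ m j, Integrable (fun x => κ m x * b x j) μ) :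
    Integrable (fun x => (G x).mulVec (b x)) μ ∧
    ∀ i, (∫ x, (G x).mulVec (b x) ∂μ) i = ∑ m, ∑ j, A m i j * ∫ x, κ m x * b x j ∂μ := by
  have hae : ∀ i, (fun x => (G x).mulVec (b x) i) =ᵐ[μ]
      fun x => ∑ m, ∑ j, A m i j * (κ m x * b x j) := by
    intro i
    filter_upwards [hG] with x hx
    simp only [Matrix.mulVec, dotProduct, hx, Finset.sum_mul]
    rw [Finset.sum_comm]
    simp only [mul_assoc]
  have hint : ∀ i, Integrable (fun x => ∑ m, ∑ j, A m i j * (κ m x * b x j)) μ := fun i =>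
    integrable_finsetSum _ fun m _ => integrable_finsetSum _ fun j _ => (hi m j).const_mul _
  have h1 : ∀ i, Integrable (fun x => (G x).mulVec (b x) i) μ := fun i => (hint i).congr (hae i).symm
  refine ⟨Integrable.of_eval h1, fun i => ?_⟩
  rw [eval_integral h1, integral_congr_ae (hae i), integral_finsetSum _ fun m _ =>
    integrable_finsetSum _ fun j _ => (hi m j).const_mul _]
  refine Finset.sum_congr rfl fun m _ => ?_
  rw [integral_finsetSum _ fun j _ => (hi m j).const_mul _]
  simp_rw [integral_const_mul]

end MulVec

theorem integrable_kern_mul {ν d β σ T : ℝ} {ρ : Measure (ℝ × ℝ)} [SFinite ρ] {a : ℝ × ℝ → ℂ}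
    (hν : 0 < ν) (hd : 0 ≤ d) (hβ : 0 ≤ β) (hσ : |σ| ≤ 1) (hT : 0 < T)
    (ha : AEStronglyMeasurable a ρ) (hs : ∀ᵐ p ∂ρ, 0 ≤ p.1 ∧ p.1 < T ∧ 0 ≤ p.2) {t y : ℝ}
    (ht : t ≤ T) (hy : 0 ≤ y) (hfin : potMajZero ν ρ a t y < ⊤) :
    Integrable (fun p => (kern ν d β σ (t - p.1) y p.2 : ℂ) * a p) ρ := by
  obtain ⟨C, hC, h⟩ := exists_lintegral_kern_le (a := a) (d := d) (β := β) (σ := σ) hν hd hβ hσ hT hs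
  refine ⟨(Complex.measurable_ofReal.comp ((measurable_kern hν d β σ).comp
    (f := fun p : ℝ × ℝ => (t - p.1, y, p.2)) (by fun_prop))).aestronglyMeasurable.mul ha, ?_⟩
  refine lt_of_le_of_lt ?_ (ENNReal.mul_lt_top hC.lt_top hfin)
  refine le_trans (le_of_eq ?_) (h t ht y hy).1
  simp only [enorm_mul, enorm_complex_ofReal]

/-! ### The Duhamel formula in terms of potentials -/

/-- The three measures carrying the data. -/
def dataMeasure (T : ℝ) : Fin 3 → Measure (ℝ × ℝ) :=
  ![initMeasure, (timeInterval T).prod halfLine, bdryMeasure T]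

/-- The densities of the `j`-th components of the data. -/
def dataDensity (w₀ : ℝ → Fin 3 → ℂ) (f : ℝ → ℝ → Fin 3 → ℂ) (g : ℝ → Fin 2 → ℂ) (j : Fin 3) :
    Fin 3 → ℝ × ℝ → ℂ :=
  ![fun p => w₀ p.2 j, fun p => f p.1 p.2 j, fun p => ![g p.1 0, g p.1 1, 0] j]

instance (T : ℝ) (r : Fin 3) : SFinite (dataMeasure T r) := by
  fin_cases r
  · exact inferInstanceAs (SFinite initMeasure)
  · exact inferInstanceAs (SFinite ((timeInterval T).prod halfLine))
  · exact inferInstanceAs (SFinite (bdryMeasure T))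

/-- The potential of the `j`-th component of the data with the `m`-th boundary condition. -/
def dataPot (k : Fin 3 → ℝ → ℝ → ℝ → ℝ) (T : ℝ) (w₀ : ℝ → Fin 3 → ℂ) (f : ℝ → ℝ → Fin 3 → ℂ)
    (g : ℝ → Fin 2 → ℂ) (m j : Fin 3) (t y : ℝ) : ℂ :=
  -- The coefficient `1` gives the sum the form of a general linear combination, to which the lemmas
  -- on such combinations apply directly.
  ∑ r, 1 * pot (k m) (dataMeasure T r) (dataDensity w₀ f g j r) t y

/-- The kernels for the three boundary conditions. -/
def bcKern (ν : ℝ) (ξ : Fin 2 → ℤ) (m : Fin 3) : ℝ → ℝ → ℝ → ℝ :=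
  kern ν (ν * freqNorm ξ ^ 2) (bcRobin ξ m) (bcSign m)

/-- The derivatives of the kernels for the three boundary conditions. -/
def bcKernDy (ν : ℝ) (ξ : Fin 2 → ℤ) (m : Fin 3) : ℝ → ℝ → ℝ → ℝ :=
  kernDy ν (ν * freqNorm ξ ^ 2) (bcRobin ξ m) (bcSign m)

/-- The vector field assembled from the components with the three boundary conditions. -/
def assemble (ξ : Fin 2 → ℤ) (U : Fin 3 → Fin 3 → ℝ → ℝ → ℂ) (t y : ℝ) (i : Fin 3) : ℂ :=
  ∑ x : Fin 3 × Fin 3, bcProj ξ x.1 i x.2 * U x.1 x.2 t y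

section Data

variable {ν T a : ℝ} {ξ : Fin 2 → ℤ} {w₀ : ℝ → Fin 3 → ℂ} {f : ℝ → ℝ → Fin 3 → ℂ}
  {g : ℝ → Fin 2 → ℂ}

theorem isBddSource_data_force (hν : 0 < ν) (hf : MemLinftyL2 T f) (j : Fin 3) :
    IsBddSource ν T ((timeInterval T).prod halfLine) fun p => f p.1 p.2 j := by
  obtain ⟨h1, C, hC⟩ := hf
  refine isBddSource_force hν (F := fun t z => f t z j) (aestronglyMeasurable_pi.1 h1 j)
    (M := C) ENNReal.coe_ne_top ?_
  filter_upwards [hC] with t ht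
  exact (eLpNorm_mono fun z => norm_le_pi_norm (f t z) j).trans ht

theorem isBddSource_data_bdry (hν : 0 < ν) (hg : MemLp g ⊤ (timeInterval T)) (j : Fin 3) :
    IsBddSource ν T (bdryMeasure T) fun p => ![g p.1 0, g p.1 1, 0] j := by
  have h : ∀ i : Fin 2, IsBddSource ν T (bdryMeasure T) fun p => g p.1 i := by
    intro i
    have hi := hg.eval i
    refine isBddSource_bdry hν (q := fun t => g t i) hi.1 (M := eLpNorm (fun t => g t i) ⊤
      (timeInterval T)) hi.2.ne ?_
    rw [eLpNorm_exponent_top]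
    exact ae_le_eLpNormEssSup
  fin_cases j
  · exact h 0
  · exact h 1
  · exact isBddSource_bdry hν (q := fun _ => 0) aestronglyMeasurable_const (M := 0)
      ENNReal.zero_ne_top (ae_of_all _ fun _ => by simp)

theorem isSource_data (hν : 0 < ν) (hT : 0 < T) (hw₀ : MemLp w₀ 1 halfLine) (hf : MemLinftyL2 T f)
    (hg : MemLp g ⊤ (timeInterval T)) (j r : Fin 3) :
    IsSource ν T (dataMeasure T r) (dataDensity w₀ f g j r) := by
  fin_cases r
  · exact isSource_init hν hT (u := fun z => w₀ z j) (memLp_one_iff_integrable.1 (hw₀.eval j))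
  · exact (isBddSource_data_force hν hf j).isSource
  · exact (isBddSource_data_bdry hν hg j).isSource

/-- Finiteness at every point, rather than almost everywhere, makes the Duhamel integrals converge
for all `t` in `(0, T]` and all `y ≥ 0`. -/
theorem potMajZero_data_lt_top (hν : 0 < ν) (hw₀ : MemLp w₀ 1 halfLine) (hf : MemLinftyL2 T f)
    (hg : MemLp g ⊤ (timeInterval T)) (j r : Fin 3) {t : ℝ} (ht : t ≤ T) (y : ℝ) :
    potMajZero ν (dataMeasure T r) (dataDensity w₀ f g j r) t y < ⊤ := by
  fin_cases r
  · refine (potMajZero_init_le hν (fun z => w₀ z j) t y).trans_lt ?_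
    exact ENNReal.mul_lt_top (ENNReal.mul_lt_top ENNReal.ofReal_lt_top (tpow_ne_top _ _).lt_top)
      (memLp_one_iff_integrable.1 (hw₀.eval j)).2
  · obtain ⟨M, hM, h⟩ := (isBddSource_data_force hν hf j).bdd
    exact ((h t ht).2 y).trans_lt hM.lt_top
  · obtain ⟨M, hM, h⟩ := (isBddSource_data_bdry hν hg j).bdd
    exact ((h t ht).2 y).trans_lt hM.lt_top

theorem integrable_bcKern_mul (hν : 0 < ν) (hT : 0 < T) (hw₀ : MemLp w₀ 1 halfLine)
    (hf : MemLinftyL2 T f) (hg : MemLp g ⊤ (timeInterval T)) (m j r : Fin 3) {t y : ℝ}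
    (ht : t ≤ T) (hy : 0 ≤ y) :
    Integrable (fun p => (bcKern ν ξ m (t - p.1) y p.2 : ℂ) * dataDensity w₀ f g j r p)
      (dataMeasure T r) :=
  have hs := isSource_data hν hT hw₀ hf hg j r
  integrable_kern_mul hν (by positivity) (bcRobin_nonneg ξ m) (abs_bcSign_le m) hT hs.meas
    hs.supp ht hy (potMajZero_data_lt_top hν hw₀ hf hg j r ht y)

theorem timeInterval_eq_restrict {t : ℝ} (ht : t ≤ T) :
    timeInterval t = (timeInterval T).restrict (Iio t) := by
  rw [timeInterval, timeInterval, Measure.restrict_restrict measurableSet_Iio]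
  congr 1
  ext s
  simp only [mem_Ioo, mem_inter_iff, mem_Iio]
  exact ⟨fun h => ⟨h.2, h.1, h.2.trans_le ht⟩, fun h => ⟨h.2.1, h.1⟩⟩

theorem timeInterval_prod_eq_restrict {t : ℝ} (ht : t ≤ T) :
    (timeInterval t).prod halfLine =
      ((timeInterval T).prod halfLine).restrict (Iio t ×ˢ univ) := by
  rw [timeInterval_eq_restrict ht, ← Measure.prod_restrict, Measure.restrict_univ]

theorem bcKern_of_nonpos (hν : 0 < ν) (ξ : Fin 2 → ℤ) (m : Fin 3) {t : ℝ} (ht : t ≤ 0) (y z : ℝ) :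
    bcKern ν ξ m t y z = 0 := kern_of_nonpos hν ht _ _ _ _ _

/-- Absolute convergence of the integrals in the Duhamel formula, and their values. -/
theorem duhamel_eq (hν : 0 < ν) (hT : 0 < T) (ha : freqNorm ξ < a) (hw₀ : MemLp w₀ 1 halfLine)
    (hf : MemLinftyL2 T f) (hg : MemLp g ⊤ (timeInterval T)) {t y : ℝ} (ht : t ∈ Ioc 0 T)
    (hy : 0 ≤ y) :
    (Integrable (fun z => (green ν ξ a t y z).mulVec (w₀ z)) halfLine ∧
      Integrable (fun p : ℝ × ℝ => (green ν ξ a (t - p.1) y p.2).mulVec (f p.1 p.2))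
        ((timeInterval t).prod halfLine) ∧
      Integrable (fun s => (green ν ξ a (t - s) y 0).mulVec ![g s 0, g s 1, 0])
        (timeInterval t)) ∧
    duhamel ν ξ a w₀ f g t y = assemble ξ (dataPot (bcKern ν ξ) T w₀ f g) t y := by
  have hi := fun m j r => integrable_bcKern_mul (ξ := ξ) hν hT hw₀ hf hg m j r ht.2 hy
  obtain ⟨a0, b0⟩ := integrable_mulVec (μ := halfLine) (G := fun z => green ν ξ a t y z)
    (κ := fun m z => (bcKern ν ξ m t y z : ℂ)) (A := bcProj ξ) (b := w₀)
    (by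
      filter_upwards [ae_restrict_mem measurableSet_Ioi] with z hz i j
      exact green_apply hν ξ ha ht.1 hy (mem_Ioi.1 hz).le i j)
    (fun m j => by
      have := (measurableEmbedding_init.integrable_map_iff).1 (hi m j 0)
      simpa [Function.comp_def, dataDensity] using this)
  have hi1 := fun m j => (hi m j 1).mono_measure
    (Measure.restrict_le_self (s := Iio t ×ˢ (univ : Set ℝ)))
  obtain ⟨a1, b1⟩ := integrable_mulVec (μ := (timeInterval t).prod halfLine)
    (G := fun p : ℝ × ℝ => green ν ξ a (t - p.1) y p.2)
    (κ := fun m p => (bcKern ν ξ m (t - p.1) y p.2 : ℂ)) (A := bcProj ξ) (b := fun p => f p.1 p.2)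
    (by
      refine ae_timeInterval_prod_halfLine fun s hs z hz i j => ?_
      exact green_apply hν ξ ha (sub_pos.2 hs.2) hy hz.le i j)
    (fun m j => by rw [timeInterval_prod_eq_restrict ht.2]; exact hi1 m j)
  have hi2 := fun m j => ((measurableEmbedding_bdry.integrable_map_iff).1 (hi m j 2)).mono_measure
    (Measure.restrict_le_self (s := Iio t))
  obtain ⟨a2, b2⟩ := integrable_mulVec (μ := timeInterval t)
    (G := fun s : ℝ => green ν ξ a (t - s) y 0)
    (κ := fun m s => (bcKern ν ξ m (t - s) y 0 : ℂ)) (A := bcProj ξ)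
    (b := fun s => ![g s 0, g s 1, 0])
    (by
      filter_upwards [ae_restrict_mem measurableSet_Ioo] with s hs i j
      exact green_apply hν ξ ha (sub_pos.2 hs.2) hy le_rfl i j)
    (fun m j => by rw [timeInterval_eq_restrict ht.2]; exact hi2 m j)
  refine ⟨⟨a0, a1, a2⟩, ?_⟩
  have c0 : ∀ m j, ∫ z, (bcKern ν ξ m t y z : ℂ) * w₀ z j ∂halfLine =
      pot (bcKern ν ξ m) (dataMeasure T 0) (dataDensity w₀ f g j 0) t y := fun m j =>
    (pot_init (bcKern ν ξ m) (fun z => w₀ z j) t y).symm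
  have c1 : ∀ m j, ∫ p : ℝ × ℝ, (bcKern ν ξ m (t - p.1) y p.2 : ℂ) * f p.1 p.2 j
        ∂(timeInterval t).prod halfLine =
      pot (bcKern ν ξ m) (dataMeasure T 1) (dataDensity w₀ f g j 1) t y := by
    intro m j
    rw [timeInterval_prod_eq_restrict ht.2]
    -- Sources later than `t` contribute nothing, because the kernel vanishes at nonpositive times.
    refine setIntegral_eq_integral_of_forall_compl_eq_zero fun p hp => ?_
    have : t ≤ p.1 := by simpa using hp
    rw [bcKern_of_nonpos hν ξ m (by linarith)]
    simp
  have c2 : ∀ m j, ∫ s, (bcKern ν ξ m (t - s) y 0 : ℂ) * ![g s 0, g s 1, 0] j ∂timeInterval t =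
      pot (bcKern ν ξ m) (dataMeasure T 2) (dataDensity w₀ f g j 2) t y := by
    intro m j
    refine Eq.trans ?_ (pot_bdry (bcKern ν ξ m) (fun s => ![g s 0, g s 1, 0] j) t y).symm
    rw [timeInterval_eq_restrict ht.2]
    refine setIntegral_eq_integral_of_forall_compl_eq_zero fun s hs => ?_
    have : t ≤ s := by simpa using hs
    rw [bcKern_of_nonpos hν ξ m (by linarith)]
    simp
  funext i
  rw [duhamel, Pi.add_apply, Pi.add_apply, b0 i, b2 i, ← integral_prod _ a1, b1 i, assemble,
    Fintype.sum_prod_type, ← Finset.sum_add_distrib, ← Finset.sum_add_distrib]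
  refine Finset.sum_congr rfl fun m _ => ?_
  rw [← Finset.sum_add_distrib, ← Finset.sum_add_distrib]
  refine Finset.sum_congr rfl fun j _ => ?_
  rw [c0, c1, c2, dataPot, Fin.sum_univ_three]
  ring

end Data

/-! ### Scalar potentials in the energy class -/

section Energy

theorem lt_top_of_sq_lt_top {a : ℝ≥0∞} (h : a ^ 2 < ⊤) : a < ⊤ :=
  (ENNReal.pow_lt_top_iff.1 h).resolve_right two_ne_zero

variable {ν d β σ T : ℝ}

theorem eLpNorm_two_lt_top_of_le {f : ℝ → ℝ≥0∞} {M : ℝ≥0∞} (hM : M ≠ ⊤)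
    (h : ∀ t ∈ Ioo 0 T, f t ≤ M) : eLpNorm f 2 (timeInterval T) < ⊤ := by
  refine lt_top_of_sq_lt_top ?_
  rw [eLpNorm_two_sq]
  simp only [enorm_eq_self]
  refine (setLIntegral_mono' (g := fun _ => M ^ 2) measurableSet_Ioo fun t ht => ?_).trans_lt ?_
  · have := h t ht
    gcongr
  · rw [setLIntegral_const]
    exact ENNReal.mul_lt_top (ENNReal.pow_lt_top hM.lt_top) measure_Ioo_lt_top

/-- Potentials of bounded sources belong to the energy class. -/
theorem IsBddSource.energy {ρ : Measure (ℝ × ℝ)} [SFinite ρ] {a : ℝ × ℝ → ℂ} (hν : 0 < ν)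
    (hd : 0 ≤ d) (hβ : 0 ≤ β) (hσ : |σ| ≤ 1) (hT : 0 < T) (h : IsBddSource ν T ρ a) :
    MemLpH1 2 T (pot (kern ν d β σ) ρ a) (pot (kernDy ν d β σ) ρ a)
      (fun t => pot (kern ν d β σ) ρ a t 0) ∧
    ∃ M : ℝ≥0∞, M ≠ ⊤ ∧ ∀ t ∈ Ioo 0 T, eLpNorm (pot (kern ν d β σ) ρ a t) 2 halfLine ≤ M := by
  obtain ⟨C, hC, hle⟩ := exists_enorm_pot_le (a := a) (d := d) (β := β) (σ := σ)
    hν hd hβ hσ hT h.supp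
  obtain ⟨M, hM, hb⟩ := h.bdd
  obtain ⟨m1, m2, m3, -, -⟩ := h.isSource.memLOneH1 (d := d) (β := β) (σ := σ) hν hd hβ hσ hT
  have b1 : ∀ t ∈ Ioo 0 T, eLpNorm (pot (kern ν d β σ) ρ a t) 2 halfLine ≤ C * M := fun t ht =>
    (eLpNorm_le_mul_of_enorm_le hC fun y hy => (hle t ht.2.le y hy.le).2.1).trans
      (by gcongr; exact (hb t ht.2.le).1)
  have b2 : ∀ t ∈ Ioo 0 T, eLpNorm (pot (kernDy ν d β σ) ρ a t) 2 halfLine ≤ C * M := fun t ht =>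
    (eLpNorm_le_mul_of_enorm_le hC fun y hy => (hle t ht.2.le y hy.le).2.2).trans
      (by gcongr; exact (hb t ht.2.le).1)
  have hCM : C * M ≠ ⊤ := ENNReal.mul_ne_top hC hM
  exact ⟨⟨m1, m2, m3, eLpNorm_two_lt_top_of_le hCM b1, eLpNorm_two_lt_top_of_le hCM b2⟩, C * M,
    hCM, b1⟩

/-- Evolutions of square integrable initial data belong to the energy class. -/
theorem energy_init {u : ℝ → ℂ} (hν : 0 < ν) (hd : 0 ≤ d) (hβ : 0 ≤ β) (hσ : |σ| ≤ 1) (hT : 0 < T)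
    (hu : Integrable u halfLine) (hu2 : eLpNorm u 2 halfLine < ⊤) :
    MemLpH1 2 T (pot (kern ν d β σ) initMeasure fun p => u p.2)
      (pot (kernDy ν d β σ) initMeasure fun p => u p.2)
      (fun t => pot (kern ν d β σ) initMeasure (fun p => u p.2) t 0) ∧
    ∃ M : ℝ≥0∞, M ≠ ⊤ ∧ ∀ t ∈ Ioo 0 T,
      eLpNorm (pot (kern ν d β σ) initMeasure (fun p => u p.2) t) 2 halfLine ≤ M := by
  have h := isSource_init hν hT hu
  obtain ⟨C, hC, hle⟩ := exists_enorm_pot_le (a := fun p => u p.2) (d := d) (β := β) (σ := σ)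
    hν hd hβ hσ hT h.supp
  obtain ⟨m1, m2, m3, -, -⟩ := h.memLOneH1 (d := d) (β := β) (σ := σ) hν hd hβ hσ hT
  have b1 : ∀ t ∈ Ioo 0 T, eLpNorm (pot (kern ν d β σ) initMeasure (fun p => u p.2) t) 2 halfLine ≤
      C * eLpNorm u 2 halfLine := fun t ht =>
    (eLpNorm_le_mul_of_enorm_le hC fun y hy => (hle t ht.2.le y hy.le).1).trans
      (by gcongr; exact eLpNorm_potMajZero_init_le hν hu.1 t)
  have hCM : C * eLpNorm u 2 halfLine ≠ ⊤ := ENNReal.mul_ne_top hC hu2.ne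
  refine ⟨⟨m1, m2, m3, eLpNorm_two_lt_top_of_le hCM b1, ?_⟩, _, hCM, b1⟩
  refine lt_top_of_sq_lt_top ?_
  rw [eLpNorm_two_sq]
  simp only [enorm_eq_self]
  exact lintegral_sq_pot_init_lt_top hν hd hβ hσ hT hu hu2

end Energy

/-! ### Assembly of the vector solution and uniqueness -/

section Solution

variable {ν T : ℝ} {ξ : Fin 2 → ℤ} {w₀ : ℝ → Fin 3 → ℂ} {f : ℝ → ℝ → Fin 3 → ℂ}
  {g : ℝ → Fin 2 → ℂ}

theorem memLpH1_assemble {p : ℝ≥0∞} (hp : 1 ≤ p) {U U' : Fin 3 → Fin 3 → ℝ → ℝ → ℂ}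
    {c : Fin 3 → Fin 3 → ℝ → ℂ} (h : ∀ m j, MemLpH1 p T (U m j) (U' m j) (c m j)) (i : Fin 3) :
    MemLpH1 p T (fun t z => assemble ξ U t z i) (fun t z => assemble ξ U' t z i)
      (fun t => ∑ x : Fin 3 × Fin 3, bcProj ξ x.1 i x.2 * c x.1 x.2 t) :=
  MemLpH1.sum hp Finset.univ (fun x : Fin 3 × Fin 3 => bcProj ξ x.1 i x.2)
    (u := fun x => U x.1 x.2) (u' := fun x => U' x.1 x.2) (c := fun x => c x.1 x.2)
    fun x _ => h x.1 x.2

theorem memLpH1_dataPot {p : ℝ≥0∞} (hp : 1 ≤ p) {m j : Fin 3}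
    (h : ∀ r, MemLpH1 p T (pot (bcKern ν ξ m) (dataMeasure T r) (dataDensity w₀ f g j r))
      (pot (bcKernDy ν ξ m) (dataMeasure T r) (dataDensity w₀ f g j r))
      (fun t => pot (bcKern ν ξ m) (dataMeasure T r) (dataDensity w₀ f g j r) t 0)) :
    MemLpH1 p T (dataPot (bcKern ν ξ) T w₀ f g m j) (dataPot (bcKernDy ν ξ) T w₀ f g m j)
      (fun t => dataPot (bcKern ν ξ) T w₀ f g m j t 0) :=
  MemLpH1.sum hp Finset.univ (fun _ : Fin 3 => 1) fun r _ => h r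

theorem memLOneH1_data (hν : 0 < ν) (hT : 0 < T) (hw₀ : MemLp w₀ 1 halfLine)
    (hf : MemLinftyL2 T f) (hg : MemLp g ⊤ (timeInterval T)) (m j r : Fin 3) :
    MemLOneH1 T (pot (bcKern ν ξ m) (dataMeasure T r) (dataDensity w₀ f g j r))
      (pot (bcKernDy ν ξ m) (dataMeasure T r) (dataDensity w₀ f g j r))
      (fun t => pot (bcKern ν ξ m) (dataMeasure T r) (dataDensity w₀ f g j r) t 0) :=
  (isSource_data hν hT hw₀ hf hg j r).memLOneH1 hν (by positivity) (bcRobin_nonneg ξ m)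
    (abs_bcSign_le m) hT

theorem energy_data (hν : 0 < ν) (hT : 0 < T) (hw₀ : MemLp w₀ 1 halfLine)
    (hf : MemLinftyL2 T f) (hg : MemLp g ⊤ (timeInterval T)) (hw₂ : MemLp w₀ 2 halfLine)
    (m j r : Fin 3) :
    MemLpH1 2 T (pot (bcKern ν ξ m) (dataMeasure T r) (dataDensity w₀ f g j r))
      (pot (bcKernDy ν ξ m) (dataMeasure T r) (dataDensity w₀ f g j r))
      (fun t => pot (bcKern ν ξ m) (dataMeasure T r) (dataDensity w₀ f g j r) t 0) ∧
    ∃ M : ℝ≥0∞, M ≠ ⊤ ∧ ∀ t ∈ Ioo 0 T,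
      eLpNorm (pot (bcKern ν ξ m) (dataMeasure T r) (dataDensity w₀ f g j r) t) 2 halfLine ≤ M := by
  have hd : 0 ≤ ν * freqNorm ξ ^ 2 := by positivity
  fin_cases r
  · exact energy_init hν hd (bcRobin_nonneg ξ m) (abs_bcSign_le m) hT (u := fun z => w₀ z j)
      (memLp_one_iff_integrable.1 (hw₀.eval j)) (hw₂.eval j).2
  · exact (isBddSource_data_force hν hf j).energy hν hd (bcRobin_nonneg ξ m) (abs_bcSign_le m) hT
  · exact (isBddSource_data_bdry hν hg j).energy hν hd (bcRobin_nonneg ξ m) (abs_bcSign_le m) hT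

theorem exists_eLpNorm_sum_le {ι : Type*} (s : Finset ι) (a : ι → ℂ) {u : ι → ℝ → ℝ → ℂ}
    (hm : ∀ i ∈ s, AEStronglyMeasurable (Function.uncurry (u i)) ((timeInterval T).prod halfLine))
    (h : ∀ i ∈ s, ∃ M : ℝ≥0∞, M ≠ ⊤ ∧ ∀ᵐ t ∂(timeInterval T), eLpNorm (u i t) 2 halfLine ≤ M) :
    ∃ M : ℝ≥0∞, M ≠ ⊤ ∧ ∀ᵐ t ∂(timeInterval T),
      eLpNorm (fun z => ∑ i ∈ s, a i * u i t z) 2 halfLine ≤ M := by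
  choose! M hM hb using h
  refine ⟨∑ i ∈ s, ‖a i‖ₑ * M i, ?_, ?_⟩
  · exact (ENNReal.sum_lt_top.2 fun i hi => ENNReal.mul_lt_top enorm_lt_top (hM i hi).lt_top).ne
  · have h1 : ∀ᵐ t ∂(timeInterval T), ∀ i ∈ s, eLpNorm (u i t) 2 halfLine ≤ M i :=
      (ae_ball_iff s.countable_toSet).2 hb
    have h2 : ∀ᵐ t ∂(timeInterval T), ∀ i ∈ s, AEStronglyMeasurable (u i t) halfLine :=
      (ae_ball_iff s.countable_toSet).2 fun i hi => (hm i hi).prodMk_left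
    filter_upwards [h1, h2] with t ht1 ht2
    refine (eLpNorm_sum_const_mul_le s a ht2).trans (Finset.sum_le_sum fun i hi => ?_)
    gcongr
    exact ht1 i hi

theorem memEnergyClass_assemble (hν : 0 < ν) (hT : 0 < T) (hw₀ : MemLp w₀ 1 halfLine)
    (hf : MemLinftyL2 T f) (hg : MemLp g ⊤ (timeInterval T)) (hw₂ : MemLp w₀ 2 halfLine) :
    MemEnergyClass T (assemble ξ (dataPot (bcKern ν ξ) T w₀ f g)) := by
  have he := energy_data (ξ := ξ) hν hT hw₀ hf hg hw₂
  have h2 : (1 : ℝ≥0∞) ≤ 2 := by norm_num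
  have hU := fun m j => memLpH1_dataPot h2 fun r => (he m j r).1
  have hW := memLpH1_assemble (ξ := ξ) h2 hU
  refine ⟨⟨_, _, isLpH1_of_component h2 (w' := assemble ξ (dataPot (bcKernDy ν ξ) T w₀ f g))
    (c := fun t i => ∑ x : Fin 3 × Fin 3, bcProj ξ x.1 i x.2 *
      dataPot (bcKern ν ξ) T w₀ f g x.1 x.2 t 0) hW⟩,
    aestronglyMeasurable_pi.2 fun i => (hW i).meas, ?_⟩
  have hUb := fun m j => exists_eLpNorm_sum_le (T := T) Finset.univ (fun _ : Fin 3 => 1)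
    (u := fun r => pot (bcKern ν ξ m) (dataMeasure T r) (dataDensity w₀ f g j r))
    (fun r _ => (he m j r).1.meas) fun r _ => by
      obtain ⟨M, hM, hb⟩ := (he m j r).2
      exact ⟨M, hM, by filter_upwards [ae_restrict_mem measurableSet_Ioo] with t ht using hb t ht⟩
  have hWb := fun i => exists_eLpNorm_sum_le (T := T) Finset.univ
    (fun x : Fin 3 × Fin 3 => bcProj ξ x.1 i x.2)
    (u := fun x => dataPot (bcKern ν ξ) T w₀ f g x.1 x.2)
    (fun x _ => (hU x.1 x.2).meas) fun x _ => hUb x.1 x.2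
  choose M hM hb using hWb
  have hsum : ∑ i, M i ≠ ⊤ := (ENNReal.sum_lt_top.2 fun i _ => (hM i).lt_top).ne
  refine ⟨(∑ i, M i).toNNReal, ?_⟩
  rw [ENNReal.coe_toNNReal hsum]
  filter_upwards [ae_all_iff.2 hb, ae_all_iff.2 fun i => (hW i).isH1] with t ht1 ht2
  exact (eLpNorm_le_sum_component fun i => (ht2 i).memLp.1).trans
    (Finset.sum_le_sum fun i _ => ht1 i)

theorem integrable_mul_test {c : ℝ → ℂ} (hc : Integrable c (timeInterval T)) {φ : ℝ → ℝ → ℂ}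
    (hφ : IsTest T φ) : Integrable (fun t => c t * φ t 0) (timeInterval T) := by
  have hcont : Continuous fun t => φ t 0 :=
    hφ.smooth.continuous.comp (f := fun t : ℝ => (t, (0 : ℝ))) (by fun_prop)
  obtain ⟨M, hM⟩ := hφ.compact.exists_bound_of_continuous hφ.smooth.continuous
  exact hc.mul_bdd (c := M) hcont.aestronglyMeasurable (ae_of_all _ fun t => hM (t, 0))

theorem integral_boundaryFlux {c : ℝ → Fin 3 → ℂ}
    (hc : ∀ l, Integrable (fun t => c t l) (timeInterval T))
    (hg : ∀ i, Integrable (fun t => g t i) (timeInterval T)) {φ : ℝ → ℝ → ℂ} (hφ : IsTest T φ)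
    (i : Fin 2) :
    ∫ t in Ioo (0 : ℝ) T, boundaryFlux ν ξ (g t) (c t) i * φ t 0 =
      (∫ t in Ioo (0 : ℝ) T, g t i * φ t 0) + ν * freqNorm ξ *
        (perpProj ξ i 0 * (∫ t in Ioo (0 : ℝ) T, c t 0 * φ t 0) +
          perpProj ξ i 1 * ∫ t in Ioo (0 : ℝ) T, c t 1 * φ t 0) := by
  have i0 := (integrable_mul_test (hc 0) hφ).const_mul (perpProj ξ i 0)
  have i1 := (integrable_mul_test (hc 1) hφ).const_mul (perpProj ξ i 1)
  have h1 := integral_add (integrable_mul_test (hg i) hφ)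
    ((i0.add i1).const_mul ((ν : ℂ) * freqNorm ξ))
  have h2 := integral_add i0 i1
  simp only [Pi.add_apply] at h1 h2
  rw [integral_const_mul, h2, integral_const_mul, integral_const_mul] at h1
  rw [← h1]
  congr 1 with t
  rw [boundaryFlux_eq]
  ring

/-- Adds the weak identities of the three sources. Every data component is evolved under each of the
three boundary conditions; the projections select afterwards what is needed. -/
theorem heatForm_dataPot (hν : 0 < ν) (hT : 0 < T) (hw₀ : MemLp w₀ 1 halfLine)
    (hf : MemLinftyL2 T f) (hg : MemLp g ⊤ (timeInterval T)) {φ : ℝ → ℝ → ℂ} (hφ : IsTest T φ)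
    (m j : Fin 3) (hm : m = 2 → ∀ t, φ t 0 = 0) :
    heatForm ν (ν * freqNorm ξ ^ 2) T (dataPot (bcKern ν ξ) T w₀ f g m j)
      (dataPot (bcKernDy ν ξ) T w₀ f g m j) φ =
      (∫ z in Ioi (0 : ℝ), w₀ z j * φ 0 z) +
      (∫ t in Ioo (0 : ℝ) T, ∫ z in Ioi (0 : ℝ), f t z j * φ t z) +
      (∫ t in Ioo (0 : ℝ) T, ![g t 0, g t 1, 0] j * φ t 0) +
      ν * bcRobin ξ m * ∫ t in Ioo (0 : ℝ) T, dataPot (bcKern ν ξ) T w₀ f g m j t 0 * φ t 0 := by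
  have hmem := fun r => memLOneH1_data (ξ := ξ) hν hT hw₀ hf hg m j r
  have hpot := fun r => (isSource_data hν hT hw₀ hf hg j r).heatForm_pot
    (d := ν * freqNorm ξ ^ 2) (β := bcRobin ξ m) (σ := bcSign m) hν (by positivity)
    (bcRobin_nonneg ξ m) hT hφ (by
      by_cases h2 : m = 2
      · exact Or.inr ⟨by simp [h2, bcSign], by simp [h2, bcRobin], hm h2⟩
      · left; fin_cases m <;> simp_all [bcSign])
  have hform := heatForm_sum (ν := ν) (d := ν * freqNorm ξ ^ 2) hφ Finset.univ (fun _ : Fin 3 => 1)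
    fun r _ => hmem r
  have htr := integral_sum_mul (μ := timeInterval T) Finset.univ (fun _ : Fin 3 => 1)
    (f := fun r t => pot (bcKern ν ξ m) (dataMeasure T r) (dataDensity w₀ f g j r) t 0)
    (g := fun t => φ t 0) fun r _ => (hpot r).2.1
  have e0 : ∫ p, dataDensity w₀ f g j 0 p * φ p.1 p.2 ∂dataMeasure T 0 =
      ∫ z in Ioi (0 : ℝ), w₀ z j * φ 0 z :=
    measurableEmbedding_init.integral_map (fun p : ℝ × ℝ => w₀ p.2 j * φ p.1 p.2)
  have e1 : ∫ p, dataDensity w₀ f g j 1 p * φ p.1 p.2 ∂dataMeasure T 1 =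
      ∫ t in Ioo (0 : ℝ) T, ∫ z in Ioi (0 : ℝ), f t z j * φ t z :=
    integral_prod _ (hpot 1).1
  have e2 : ∫ p, dataDensity w₀ f g j 2 p * φ p.1 p.2 ∂dataMeasure T 2 =
      ∫ t in Ioo (0 : ℝ) T, ![g t 0, g t 1, 0] j * φ t 0 :=
    measurableEmbedding_bdry.integral_map (fun p : ℝ × ℝ => ![g p.1 0, g p.1 1, 0] j * φ p.1 p.2)
  refine hform.trans ?_
  rw [← e0, ← e1, ← e2]
  change _ = _ + ν * bcRobin ξ m * ∫ t in Ioo (0 : ℝ) T, (∑ r : Fin 3, 1 *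
    pot (bcKern ν ξ m) (dataMeasure T r) (dataDensity w₀ f g j r) t 0) * φ t 0
  rw [htr]
  simp only [Fin.sum_univ_three, one_mul]
  have hp : ∀ r, heatForm ν (ν * freqNorm ξ ^ 2) T
      (pot (bcKern ν ξ m) (dataMeasure T r) (dataDensity w₀ f g j r))
      (pot (bcKernDy ν ξ m) (dataMeasure T r) (dataDensity w₀ f g j r)) φ =
      (∫ p, dataDensity w₀ f g j r p * φ p.1 p.2 ∂dataMeasure T r) + ν * bcRobin ξ m *
        ∫ t in Ioo (0 : ℝ) T, pot (bcKern ν ξ m) (dataMeasure T r) (dataDensity w₀ f g j r) t 0 *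
          φ t 0 := fun r => (hpot r).2.2
  rw [hp, hp, hp]
  ring

/-- The projections sum to the identity, so the data terms recombine. The Robin evolution yields the
wall term `ν |ξ| P U`, while the flux demands `ν |ξ| P` applied to the whole tangential trace. They
agree because `P² = P` makes the Neumann part invisible to `P`. -/
theorem isWeakSolution_assemble (hν : 0 < ν) (hT : 0 < T) (hw₀ : MemLp w₀ 1 halfLine)
    (hf : MemLinftyL2 T f) (hg : MemLp g ⊤ (timeInterval T)) :
    IsWeakSolution ν ξ T w₀ f g (assemble ξ (dataPot (bcKern ν ξ) T w₀ f g)) := by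
  set U := dataPot (bcKern ν ξ) T w₀ f g with hUdef
  set U' := dataPot (bcKernDy ν ξ) T w₀ f g with hUdef'
  have hU : ∀ m j, MemLpH1 1 T (U m j) (U' m j) (fun t => U m j t 0) := fun m j =>
    memLpH1_dataPot le_rfl fun r => memLpH1_one_iff.2 (memLOneH1_data hν hT hw₀ hf hg m j r)
  have hU1 := fun m j => memLpH1_one_iff.1 (hU m j)
  have hW := memLpH1_assemble (ξ := ξ) le_rfl hU
  have hform : ∀ φ, IsTest T φ → ∀ i, heatForm ν (ν * freqNorm ξ ^ 2) T
      (fun t z => assemble ξ U t z i) (fun t z => assemble ξ U' t z i) φ =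
      ∑ x : Fin 3 × Fin 3, bcProj ξ x.1 i x.2 *
        heatForm ν (ν * freqNorm ξ ^ 2) T (U x.1 x.2) (U' x.1 x.2) φ := fun φ hφ i =>
    heatForm_sum hφ Finset.univ (fun x : Fin 3 × Fin 3 => bcProj ξ x.1 i x.2)
      (u := fun x => U x.1 x.2) (u' := fun x => U' x.1 x.2) fun x _ => hU1 x.1 x.2
  have hgi : ∀ i, Integrable (fun t => g t i) (timeInterval T) := fun i =>
    (hg.eval i).integrable le_top
  set c : ℝ → Fin 3 → ℂ := fun t i => ∑ x : Fin 3 × Fin 3, bcProj ξ x.1 i x.2 * U x.1 x.2 t 0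
    with hc
  have hci : ∀ l, Integrable (fun t => c t l) (timeInterval T) := fun l =>
    (memLpH1_one_iff.1 (hW l)).integrable_trace
  refine ⟨assemble ξ U', c, isLpH1_of_component le_rfl hW, fun φ hφ i => ?_,
    ae_of_all _ fun t => ?_, fun φ hφ h0 => ?_⟩
  · have hdata := fun m j hm => heatForm_dataPot (ξ := ξ) hν hT hw₀ hf hg hφ m j hm
    have hB : ∀ l, ∫ t in Ioo (0 : ℝ) T, c t l * φ t 0 = ∑ x : Fin 3 × Fin 3,
        bcProj ξ x.1 l x.2 * ∫ t in Ioo (0 : ℝ) T, U x.1 x.2 t 0 * φ t 0 := fun l =>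
      integral_sum_mul Finset.univ (fun x : Fin 3 × Fin 3 => bcProj ξ x.1 l x.2)
        fun x _ => integrable_mul_test (hU1 x.1 x.2).integrable_trace hφ
    rw [weakHeat_iff (memLpH1_one_iff.1 (hW i.castSucc)) hφ, hform φ hφ,
      integral_boundaryFlux hci hgi hφ, hB, hB]
    have h00 := perpProj_mul_self ξ 0 0
    have h01 := perpProj_mul_self ξ 0 1
    have h10 := perpProj_mul_self ξ 1 0
    have h11 := perpProj_mul_self ξ 1 1
    have d00 := hdata 0 0 (by simp)
    have d01 := hdata 0 1 (by simp)
    have d10 := hdata 1 0 (by simp)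
    have d11 := hdata 1 1 (by simp)
    rw [← hUdef, ← hUdef'] at d00 d01 d10 d11
    fin_cases i
    · simp [Fintype.sum_prod_type, Fin.sum_univ_three, bcProj, d00, d01, d10, d11, bcRobin]
      linear_combination ((ν : ℂ) * freqNorm ξ * ((∫ t in Ioo (0 : ℝ) T, U 0 0 t 0 * φ t 0) -
        ∫ t in Ioo (0 : ℝ) T, U 1 0 t 0 * φ t 0)) * h00 + ((ν : ℂ) * freqNorm ξ *
        ((∫ t in Ioo (0 : ℝ) T, U 0 1 t 0 * φ t 0) -
        ∫ t in Ioo (0 : ℝ) T, U 1 1 t 0 * φ t 0)) * h01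
    · simp [Fintype.sum_prod_type, Fin.sum_univ_three, bcProj, d00, d01, d10, d11, bcRobin]
      linear_combination ((ν : ℂ) * freqNorm ξ * ((∫ t in Ioo (0 : ℝ) T, U 0 0 t 0 * φ t 0) -
        ∫ t in Ioo (0 : ℝ) T, U 1 0 t 0 * φ t 0)) * h10 + ((ν : ℂ) * freqNorm ξ *
        ((∫ t in Ioo (0 : ℝ) T, U 0 1 t 0 * φ t 0) -
        ∫ t in Ioo (0 : ℝ) T, U 1 1 t 0 * φ t 0)) * h11
  · have : U 2 2 t 0 = 0 := by
      rw [hUdef, dataPot]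
      refine Finset.sum_eq_zero fun r _ => ?_
      have hk : ∀ s z, bcKern ν ξ 2 s 0 z = 0 := fun s z => kern_dirichlet_zero _ _ _ _
      simp [pot, hk]
    simp [hc, Fintype.sum_prod_type, Fin.sum_univ_three, bcProj, this]
  · have hdata := heatForm_dataPot (ξ := ξ) hν hT hw₀ hf hg hφ 2 2 fun _ => h0
    rw [← hUdef, ← hUdef'] at hdata
    rw [weakHeat_iff (memLpH1_one_iff.1 (hW 2)) hφ, hform φ hφ]
    simp [Fintype.sum_prod_type, Fin.sum_univ_three, bcProj, hdata, bcRobin, h0]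

/-- Weak solutions are unique. -/
theorem IsWeakSolution.unique (hν : 0 < ν) (hg : MemLp g ⊤ (timeInterval T))
    {v w : ℝ → ℝ → Fin 3 → ℂ} (hv : IsWeakSolution ν ξ T w₀ f g v)
    (hw : IsWeakSolution ν ξ T w₀ f g w) :
    ∀ᵐ p ∂(timeInterval T).prod halfLine, v p.1 p.2 = w p.1 p.2 := by
  obtain ⟨v', a, v1, v2, v3, v4⟩ := hv
  obtain ⟨w', b, w1, w2, w3, w4⟩ := hw
  have hvm := fun i => memLpH1_one_iff.1 (v1.component i)
  have hwm := fun i => memLpH1_one_iff.1 (w1.component i)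
  have hgi : ∀ i, Integrable (fun t => g t i) (timeInterval T) := fun i =>
    (hg.eval i).integrable le_top
  -- Writing the difference of the two solutions as a two-term linear combination makes the general
  -- lemmas on sums applicable.
  set s : Fin 2 → ℂ := ![1, -1] with hs
  set D : Fin 3 → ℝ → ℝ → ℂ := fun i t z => ∑ q, s q * ![v, w] q t z i with hD
  set D' : Fin 3 → ℝ → ℝ → ℂ := fun i t z => ∑ q, s q * ![v', w'] q t z i with hD'
  set c : Fin 3 → ℝ → ℂ := fun i t => ∑ q, s q * ![a, b] q t i with hc
  have hq : ∀ i, ∀ q ∈ (Finset.univ : Finset (Fin 2)), MemLpH1 1 T (fun t z => ![v, w] q t z i)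
      (fun t z => ![v', w'] q t z i) (fun t => ![a, b] q t i) := by
    intro i q _
    fin_cases q
    · exact v1.component i
    · exact w1.component i
  have hDm : ∀ i, MemLpH1 1 T (D i) (D' i) (c i) := fun i => MemLpH1.sum le_rfl _ s (hq i)
  have hDform : ∀ φ, IsTest T φ → ∀ i, heatForm ν (ν * freqNorm ξ ^ 2) T (D i) (D' i) φ =
      heatForm ν (ν * freqNorm ξ ^ 2) T (fun t z => v t z i) (fun t z => v' t z i) φ -
      heatForm ν (ν * freqNorm ξ ^ 2) T (fun t z => w t z i) (fun t z => w' t z i) φ := by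
    intro φ hφ i
    have := heatForm_sum (ν := ν) (d := ν * freqNorm ξ ^ 2) hφ Finset.univ s
      fun q hqu => memLpH1_one_iff.1 (hq i q hqu)
    refine this.trans ?_
    simp [Fin.sum_univ_two, hs]
    ring
  have hcint : ∀ φ, IsTest T φ → ∀ i, ∫ t in Ioo (0 : ℝ) T, c i t * φ t 0 =
      (∫ t in Ioo (0 : ℝ) T, a t i * φ t 0) - ∫ t in Ioo (0 : ℝ) T, b t i * φ t 0 := by
    intro φ hφ i
    have := integral_sum_mul (μ := timeInterval T) Finset.univ s (f := fun q t => ![a, b] q t i)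
      (g := fun t => φ t 0) fun q hqu => integrable_mul_test
        (memLpH1_one_iff.1 (hq i q hqu)).integrable_trace hφ
    refine this.trans ?_
    simp [Fin.sum_univ_two, hs]
    ring
  have htan : ∀ φ, IsTest T φ → ∀ i : Fin 2, heatForm ν (ν * freqNorm ξ ^ 2) T (D i.castSucc)
      (D' i.castSucc) φ = ν * freqNorm ξ *
        (perpProj ξ i 0 * (∫ t in Ioo (0 : ℝ) T, c 0 t * φ t 0) +
          perpProj ξ i 1 * ∫ t in Ioo (0 : ℝ) T, c 1 t * φ t 0) := by
    intro φ hφ i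
    have e1 := (weakHeat_iff (hvm i.castSucc) hφ).1 (v2 φ hφ i)
    have e2 := (weakHeat_iff (hwm i.castSucc) hφ).1 (w2 φ hφ i)
    rw [integral_boundaryFlux (fun l => (hvm l).integrable_trace) hgi hφ] at e1
    rw [integral_boundaryFlux (fun l => (hwm l).integrable_trace) hgi hφ] at e2
    rw [hDform φ hφ, e1, e2, hcint φ hφ, hcint φ hφ]
    ring
  have hnor : ∀ φ, IsTest T φ → (∀ t, φ t 0 = 0) →
      heatForm ν (ν * freqNorm ξ ^ 2) T (D 2) (D' 2) φ = 0 := by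
    intro φ hφ h0
    rw [hDform φ hφ, (weakHeat_iff (hvm 2) hφ).1 (v4 φ hφ h0),
      (weakHeat_iff (hwm 2) hφ).1 (w4 φ hφ h0), sub_self]
  -- Each projection of the difference is a scalar homogeneous solution for the corresponding
  -- boundary condition; idempotence of `P` decouples the traces. All of them vanish, and the
  -- projections sum to the identity.
  have hmi : ∀ m i : Fin 3, ∀ᵐ p ∂(timeInterval T).prod halfLine,
      ∑ j, bcProj ξ m i j * D j p.1 p.2 = 0 := by
    intro m i
    refine IsHomogeneousSolution.eq_zero (u := fun t z => ∑ j, bcProj ξ m i j * D j t z)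
      (u' := fun t z => ∑ j, bcProj ξ m i j * D' j t z)
      (c := fun t => ∑ j, bcProj ξ m i j * c j t)
      (ν := ν) (d := ν * freqNorm ξ ^ 2) (β := bcRobin ξ m) (σ := bcSign m)
      ⟨memLpH1_one_iff.1 (MemLpH1.sum le_rfl _ (bcProj ξ m i) fun j _ => hDm j), ?_, ?_⟩ hν
      (by positivity) (bcRobin_nonneg ξ m) (bcSign_cases ξ m)
    · intro hm
      have hm2 : m = 2 := by fin_cases m <;> first | rfl | (norm_num [bcSign] at hm)
      filter_upwards [v3, w3] with t ht1 ht2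
      subst hm2
      fin_cases i <;> simp [bcProj, Fin.sum_univ_three, hc, ht1, ht2]
    · intro φ hφ hm
      have hform := heatForm_sum (ν := ν) (d := ν * freqNorm ξ ^ 2) hφ Finset.univ (bcProj ξ m i)
        fun j _ => memLpH1_one_iff.1 (hDm j)
      have hint := integral_sum_mul (μ := timeInterval T) Finset.univ (bcProj ξ m i) (f := c)
        (g := fun t => φ t 0) fun j _ => integrable_mul_test
          (memLpH1_one_iff.1 (hDm j)).integrable_trace hφ
      rw [hform, hint]
      have t0 := htan φ hφ 0
      have t1 := htan φ hφ 1
      rw [Fin.castSucc_zero] at t0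
      rw [Fin.castSucc_one] at t1
      have h00 := perpProj_mul_self ξ 0 0
      have h01 := perpProj_mul_self ξ 0 1
      have h10 := perpProj_mul_self ξ 1 0
      have h11 := perpProj_mul_self ξ 1 1
      set J0 := ∫ t in Ioo (0 : ℝ) T, c 0 t * φ t 0
      set J1 := ∫ t in Ioo (0 : ℝ) T, c 1 t * φ t 0
      fin_cases m
      · fin_cases i
        · simp [bcProj, Fin.sum_univ_three, t0, t1, bcRobin]
          linear_combination (-(ν : ℂ) * freqNorm ξ * J0) * h00 + (-(ν : ℂ) * freqNorm ξ * J1) * h01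
        · simp [bcProj, Fin.sum_univ_three, t0, t1, bcRobin]
          linear_combination (-(ν : ℂ) * freqNorm ξ * J0) * h10 + (-(ν : ℂ) * freqNorm ξ * J1) * h11
        · simp [bcProj, Fin.sum_univ_three]
      · fin_cases i
        · simp [bcProj, Fin.sum_univ_three, t0, t1, bcRobin]
          linear_combination ((ν : ℂ) * freqNorm ξ * J0) * h00 + ((ν : ℂ) * freqNorm ξ * J1) * h01
        · simp [bcProj, Fin.sum_univ_three, t0, t1, bcRobin]
          linear_combination ((ν : ℂ) * freqNorm ξ * J0) * h10 + ((ν : ℂ) * freqNorm ξ * J1) * h11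
        · simp [bcProj, Fin.sum_univ_three]
      · have h2 := hnor φ hφ (hm (by simp [bcSign]))
        fin_cases i <;> simp [bcProj, Fin.sum_univ_three, h2, bcRobin]
  filter_upwards [ae_all_iff.2 fun m => ae_all_iff.2 (hmi m)] with p hp
  have hzero : ∀ i, D i p.1 p.2 = 0 := by
    intro i
    have n := hp 0 i
    have r := hp 1 i
    have d := hp 2 i
    fin_cases i <;> simp [bcProj, Fin.sum_univ_three] at n r d
    · change D 0 p.1 p.2 = 0
      linear_combination n + r
    · change D 1 p.1 p.2 = 0
      linear_combination n + r
    · exact d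
  funext i
  have := hzero i
  simp only [hD, Fin.sum_univ_two, hs, Matrix.cons_val_zero, Matrix.cons_val_one, one_mul,
    neg_mul] at this
  linear_combination this

end Solution

end StokesDuhamel

end

theorem theorem4p3 (ν : ℝ) (hν : 0 < ν) (ξ : Fin 2 → ℤ) (T : ℝ) (hT : 0 < T)
    (a : ℝ) (ha : StokesDuhamel.freqNorm ξ < a)
    (w₀ : ℝ → Fin 3 → ℂ) (hw₀ : MemLp w₀ 1 StokesDuhamel.halfLine)
    (f : ℝ → ℝ → Fin 3 → ℂ) (hf : StokesDuhamel.MemLinftyL2 T f)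
    (g : ℝ → Fin 2 → ℂ) (hg : MemLp g ⊤ (StokesDuhamel.timeInterval T)) :
    -- the integrals in the Duhamel formula converge absolutely
    (∀ t ∈ Ioc (0 : ℝ) T, ∀ y ∈ Ici (0 : ℝ),
      Integrable (fun z => (StokesDuhamel.green ν ξ a t y z).mulVec (w₀ z))
        StokesDuhamel.halfLine ∧
      Integrable (fun p : ℝ × ℝ =>
          (StokesDuhamel.green ν ξ a (t - p.1) y p.2).mulVec (f p.1 p.2))
        ((StokesDuhamel.timeInterval t).prod StokesDuhamel.halfLine) ∧
      Integrable (fun s => (StokesDuhamel.green ν ξ a (t - s) y 0).mulVec ![g s 0, g s 1, 0])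
        (StokesDuhamel.timeInterval t)) ∧
    -- the formula defines a solution
    StokesDuhamel.IsWeakSolution ν ξ T w₀ f g (StokesDuhamel.duhamel ν ξ a w₀ f g) ∧
    -- which lies in the energy class for square integrable initial data
    (MemLp w₀ 2 StokesDuhamel.halfLine →
      StokesDuhamel.MemEnergyClass T (StokesDuhamel.duhamel ν ξ a w₀ f g)) ∧
    -- every solution, in particular every solution in the energy class, is given by the formula
    (∀ w : ℝ → ℝ → Fin 3 → ℂ, StokesDuhamel.IsWeakSolution ν ξ T w₀ f g w →
      ∀ᵐ p ∂((StokesDuhamel.timeInterval T).prod StokesDuhamel.halfLine),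
        w p.1 p.2 = StokesDuhamel.duhamel ν ξ a w₀ f g p.1 p.2) := by
  -- The two functions agree on the open space-time domain, which is all that the notions of weak
  -- solution and energy class see.
  have he : ∀ t ∈ Ioo 0 T, ∀ y, 0 < y →
      StokesDuhamel.assemble ξ
        (StokesDuhamel.dataPot (StokesDuhamel.bcKern ν ξ) T w₀ f g) t y =
        StokesDuhamel.duhamel ν ξ a w₀ f g t y := fun t ht y hy =>
    (StokesDuhamel.duhamel_eq hν hT ha hw₀ hf hg ⟨ht.1, ht.2.le⟩ hy.le).2.symm
  have hsol := (StokesDuhamel.isWeakSolution_assemble (ξ := ξ) hν hT hw₀ hf hg).congr he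
  refine ⟨fun t ht y hy => (StokesDuhamel.duhamel_eq hν hT ha hw₀ hf hg ht hy).1, hsol,
    fun hw₂ => ?_, fun w hw => hw.unique hν hg hsol⟩
  obtain ⟨⟨w', c, h1⟩, h2⟩ :=
    StokesDuhamel.memEnergyClass_assemble (ξ := ξ) hν hT hw₀ hf hg hw₂
  exact ⟨⟨w', c, h1.congr he⟩, h2.congr he⟩
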